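/- Let $K$ be an algebraically closed field of characteristic $0$ and let $X$ be an integral scheme, smooth of relative dimension $n$ over $K$ (for example a smooth irreducible quasi-projective variety of dimension $n$), with sheaf of functions $\mathcal O$ and sheaf of vector fields $\Theta=\mathrm{Der}_K(\mathcal O)$. Definitions. (a) $\widehat L_+$ is the Lie algebra of derivations of $K[[X_1,\dots,X_n]]$ that vanish at $0$; its group scheme $\mathrm{Aut}\,K[[X_1,\dots,X_n]]$ has as $R$-points the $R$-algebra automorphisms $X_i\mapsto F_i$ of $R[[X_1,\dots,X_n]]$ with $F_i$ without constant term. A finite-dimensional $\widehat L_+$-module $W$ is rational if the action of $\mathrm{span}\{X_j\,\partial/\partial X_i\}\cong\mathfrak{gl}_n$ is the differential of a rational representation of $GL_n$. (b) An étale chart is an affine open set $U\subset X$ with functions $x_1,\dots,x_n\in\mathcal O(U)$ (uniformizing parameters) that are algebraically independent over $K$, such that $\mathcal O(U)$ is algebraic over $K[x_1,\dots,x_n]$ and the derivations $\partial/\partial x_i$ extend to $\mathcal O(U)$. We write $f(x+X)=\sum_{s\in\mathbb Z_+^n}\frac1{s!}\frac{\partial^s f}{\partial x^s}X^s$. (c)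 For $U$ affine, $A=\mathcal O(U)$, $V=\Theta(U)$ and $\Delta=\ker(A\otimes_K A\to A)$, let $A\#V=A\otimes_K V$ be the Lie algebra with bracket $[f\#\eta,g\#\mu]=f\eta(g)\#\mu-g\mu(f)\#\eta+fg\#[\eta,\mu]$, let $A\widehat{\#}V=\varprojlim_m (A\#V)/(\Delta^m\otimes_A V)$, and let $\mathcal{AV}(U)$ be the strong enveloping algebra of the Lie–Rinehart pair $(A,A\widehat{\#}V)$, that is, the algebra generated by $A$ and $A\widehat{\#}V$ in which $A$ is a subalgebra, $f\cdot\xi=f\xi$, $[\xi,f]=\xi(f)$ and commutators in $A\widehat{\#}V$ are Lie brackets. A sheaf of $AV$-modules is a sheaf of $\mathcal O$-modules $\mathcal M$ with actions of $\mathcal{AV}(U)$ on $\mathcal M(U)$, for $U$ affine open, that extend the action of $\mathcal O(U)$ and are compatible with restrictions; $\eta\in\Theta(U)$ acts as $1\#\eta$. Theorem. Let $W$ be a rational finite-dimensional $\widehat L_+$-module. Then the following hold. (1) For each $i$, $X^s\frac{\partial}{\partial X_i}$ acts on $W$ by $0$ for all but finitely many $s\in\mathbb Z_+^n\setminus\{0\}$,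 and there is a representation $\rho$ of the group scheme $\mathrm{Aut}\,K[[X_1,\dots,X_n]]$ on $W$ whose differential is the given action of $\widehat L_+$. (2) The étale charts cover $X$. If $(U_1,x)$ and $(U_2,y)$ are étale charts, then over every open subset of $U_1\cap U_2$, writing $x_i=G_i(y)$, there is exactly one automorphism $\varphi_G:\ X_i\mapsto G_i(y+Y)-G_i(y)$ of the algebra of power series with coefficients in the ring of functions on that subset (with the variables $Y_i$ and $X_i$ identified). (3) Let $\rho$ be as in (1). The trivial bundles $\mathcal O_U\otimes_K W$ on the étale charts, glued by $g(x)\,w\mapsto g(G(y))\,\rho(\varphi_G)w$, form a sheaf of $\mathcal O$-modules $\mathcal J^W$ that restricts to $\mathcal O_U\otimes_K W$ on each étale chart $U$; thus $\mathcal J^W$ is a vector bundle with fibre $W$. (4) $\mathcal J^W$ has a structure of a sheaf of $AV$-modules such that in every étale chart $U$ with uniformizing parameters $(x_1,\dots,x_n)$ the action of vector fields is $$f\frac{\partial}{\partial x_i}(g\otimes w)=f\frac{\partial g}{\partial x_i}\otimes w+\sum_{s\in\mathbb Z^n_+\setminus\{0\}}\frac1{s!}\,g\,\frac{\partial^s f}{\partial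 x^s}\otimes\Big(X^s\frac{\partial}{\partial X_i}\Big)w = f\frac{\partial g}{\partial x_i}\otimes w+g(x)\big(f(x+X)-f(x)\big)\frac{\partial}{\partial X_i}w$$ for all $f,g\in\mathcal O(U)$ and $w\in W$. -/

import Mathlib

open CategoryTheory AlgebraicGeometry TopologicalSpace Opposite
open scoped TensorProduct

universe u

noncomputable section

namespace AVSheaf

section PowerSeries

variable (K : Type u) [Field K] (n : ℕ)

/-- The Lie algebra `L̂₊` of derivations of `K[[X₁, …, Xₙ]]` which vanish at `0`. -/
def LPlus : LieSubalgebra K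
    (Derivation K (MvPowerSeries (Fin n) K) (MvPowerSeries (Fin n) K)) where
  carrier := {D | ∀ f, MvPowerSeries.constantCoeff (D f) = 0}
  add_mem' := fun {a b} ha hb f => by
    rw [Derivation.add_apply, map_add, ha f, hb f, add_zero]
  zero_mem' := fun f => by simp
  smul_mem' := fun c D hD f => by
    rw [Derivation.smul_apply, MvPowerSeries.smul_eq_C_mul, map_mul, hD f, mul_zero]
  lie_mem' := fun {a b} ha hb f => by
    rw [Derivation.commutator_apply, map_sub, ha, hb, sub_zero]

variable {n} in
/-- The derivation `X^s ∂/∂X_i`, for a multi-index `s ≠ 0`, as an element of `L̂₊`. -/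
def LPlus.monomial (s : {s : Fin n →₀ ℕ // s ≠ 0}) (i : Fin n) : LPlus K n :=
  ⟨MvPowerSeries.monomial s.1 (1 : K) • MvPowerSeries.pderiv K i, fun f => by
    rw [Derivation.smul_apply, smul_eq_mul, map_mul]
    classical
    rw [← MvPowerSeries.coeff_zero_eq_constantCoeff_apply, MvPowerSeries.coeff_monomial,
      if_neg (Ne.symm s.2), zero_mul]⟩

/-- The group of `R`-points of the group scheme `Aut K[[X₁, …, Xₙ]]`: the `R`-algebra
automorphisms `X_i ↦ F_i` of `R[[X₁, …, Xₙ]]` where the `F_i` have no constant term, that is, the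
automorphisms that preserve the augmentation `f ↦ f(0)`. -/
def PowAut (R : Type u) [CommRing R] :
    Subgroup (MvPowerSeries (Fin n) R ≃ₐ[R] MvPowerSeries (Fin n) R) where
  carrier := {φ | ∀ f, MvPowerSeries.constantCoeff (φ f) = MvPowerSeries.constantCoeff f}
  mul_mem' := fun {a b} ha hb f => by
    rw [AlgEquiv.mul_apply, ha, hb]
  one_mem' := fun f => rfl
  inv_mem' := fun {a} ha f => by
    rw [← ha (a⁻¹ f), ← AlgEquiv.mul_apply, mul_inv_cancel, AlgEquiv.one_apply]

variable (W : Type u) [AddCommGroup W] [Module K W]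

/-- A rational representation of the group scheme `GLₙ` on `W`, as a natural family of
representations of the groups `GLₙ(R)` on `R ⊗ W`, for commutative `K`-algebras `R`. -/
structure GLRep where
  act (R : Type u) [CommRing R] [Algebra K R] : GL (Fin n) R →* Module.End R (R ⊗[K] W)
  act_baseChange {R S : Type u} [CommRing R] [Algebra K R] [CommRing S] [Algebra K S]
    (h : R →ₐ[K] S) (g : GL (Fin n) R) (z : R ⊗[K] W) :
    act S (Matrix.GeneralLinearGroup.map h.toRingHom g) (h.toLinearMap.rTensor W z) =
      h.toLinearMap.rTensor W (act R g z)

/-- A representation of the group scheme `Aut K[[X₁, …, Xₙ]]` on `W`, as a natural family of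
representations of its groups of `R`-points on `R ⊗ W`, for commutative `K`-algebras `R`. An
`S`-point `ψ` is the base change of an `R`-point `φ` along `h : R → S` if `ψ` is given by
`X_i ↦ h(F_i)` where `φ` is given by `X_i ↦ F_i`. -/
structure PowAutRep where
  act (R : Type u) [CommRing R] [Algebra K R] : PowAut n R →* Module.End R (R ⊗[K] W)
  act_baseChange {R S : Type u} [CommRing R] [Algebra K R] [CommRing S] [Algebra K S]
    (h : R →ₐ[K] S) (φ : PowAut n R) (ψ : PowAut n S)
    (hψ : ∀ i, ψ.1 (MvPowerSeries.X i) = MvPowerSeries.map h.toRingHom (φ.1 (MvPowerSeries.X i)))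
    (z : R ⊗[K] W) :
    act S ψ (h.toLinearMap.rTensor W z) = h.toLinearMap.rTensor W (act R φ z)


/-- An `L̂₊`-module `W` is rational if the action of its subalgebra
`L₀ = span {X_j ∂/∂X_i} ≅ glₙ` is the differential of a rational representation of `GLₙ`. The
matrix `E` corresponds to the derivation `X_i ↦ ∑ j, E j i X_j`, and the differential of a
representation is computed on the points `1 + ε E` with values in the dual numbers `K[ε]`. -/
def IsRational [LieRingModule (LPlus K n) W] : Prop :=
  ∃ τ : GLRep K n W, ∀ (E : Matrix (Fin n) (Fin n) K) (η : LPlus K n)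
    (g : GL (Fin n) (DualNumber K)),
    (∀ i, η.1 (MvPowerSeries.X i) = ∑ j, E j i • MvPowerSeries.X j) →
    (∀ i j, g.1 i j = (1 : Matrix (Fin n) (Fin n) (DualNumber K)) i j + E i j • DualNumber.eps) →
    ∀ w : W, τ.act (DualNumber K) g (1 ⊗ₜ[K] w) = 1 ⊗ₜ[K] w + DualNumber.eps ⊗ₜ[K] ⁅η, w⁆

variable {K n W} in
/-- The representation `P` of the group scheme `Aut K[[X₁, …, Xₙ]]` integrates the action on `W`
of its Lie algebra `L̂₊`: the point `X_i ↦ X_i + ε η(X_i)` with values in the dual numbers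
acts by `w ↦ w + ε η(w)`. -/
def PowAutRep.Integrates [LieRingModule (LPlus K n) W] (P : PowAutRep K n W) : Prop :=
  ∀ (η : LPlus K n) (φ : PowAut n (DualNumber K)),
    (∀ i, φ.1 (MvPowerSeries.X i) = MvPowerSeries.X i + (DualNumber.eps : DualNumber K) •
      MvPowerSeries.map (algebraMap K (DualNumber K)) (η.1 (MvPowerSeries.X i))) →
    ∀ w : W, P.act (DualNumber K) φ (1 ⊗ₜ[K] w) = 1 ⊗ₜ[K] w + DualNumber.eps ⊗ₜ[K] ⁅η, w⁆

variable {K n}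

/-- The operator `∂^s = ∂₁^{s₁} ⋯ ∂ₙ^{sₙ}`. -/
def iterDer {A : Type*} [CommRing A] [Algebra K A] (d : Fin n → Derivation K A A)
    (s : Fin n →₀ ℕ) : Module.End K A :=
  (List.ofFn fun i => (d i : Module.End K A) ^ s i).prod

/-- The coefficient `(1 / s!) ∂^s f` of the Taylor expansion of `f`. -/
def taylorCoeff {A : Type*} [CommRing A] [Algebra K A] (d : Fin n → Derivation K A A)
    (s : Fin n →₀ ℕ) (f : A) : A :=
  ((∏ i, (s i).factorial : ℕ) : K)⁻¹ • iterDer d s f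

/-- The Taylor expansion `f(x + X) = ∑ s, (1 / s!) ∂^s f X^s`. -/
def taylor {A : Type*} [CommRing A] [Algebra K A] (d : Fin n → Derivation K A A) (f : A) :
    MvPowerSeries (Fin n) A :=
  fun s => taylorCoeff d s f

end PowerSeries

section Enveloping

variable (K : Type*) [CommRing K] (A : Type*) [CommRing A] [Algebra K A]
  (L : Type*) [AddCommGroup L] [Module A L] [Bracket L L] (anchor : L → A → A)

/-- The defining relations of the strong enveloping algebra of a Lie-Rinehart pair `(A, L)`:
`A` is a subalgebra, the bracket of `L` is the commutator, the commutator of `ξ ∈ L` with `f ∈ A`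
is the derivative of `f` along `ξ`, and `f · ξ = fξ`. -/
inductive StrongRel : FreeAlgebra K (A ⊕ L) → FreeAlgebra K (A ⊕ L) → Prop
  | algebraMap (c : K) : StrongRel (FreeAlgebra.ι K (Sum.inl (algebraMap K A c)))
      (algebraMap K (FreeAlgebra K (A ⊕ L)) c)
  | add_left (f g : A) : StrongRel (FreeAlgebra.ι K (Sum.inl (f + g)))
      (FreeAlgebra.ι K (Sum.inl f) + FreeAlgebra.ι K (Sum.inl g))
  | mul_left (f g : A) : StrongRel (FreeAlgebra.ι K (Sum.inl (f * g)))
      (FreeAlgebra.ι K (Sum.inl f) * FreeAlgebra.ι K (Sum.inl g))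
  | add_right (ξ ζ : L) : StrongRel (FreeAlgebra.ι K (Sum.inr (ξ + ζ)))
      (FreeAlgebra.ι K (Sum.inr ξ) + FreeAlgebra.ι K (Sum.inr ζ))
  | smul_right (f : A) (ξ : L) : StrongRel (FreeAlgebra.ι K (Sum.inr (f • ξ)))
      (FreeAlgebra.ι K (Sum.inl f) * FreeAlgebra.ι K (Sum.inr ξ))
  | lie (ξ ζ : L) : StrongRel (FreeAlgebra.ι K (Sum.inr ⁅ξ, ζ⁆))
      (FreeAlgebra.ι K (Sum.inr ξ) * FreeAlgebra.ι K (Sum.inr ζ) -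
        FreeAlgebra.ι K (Sum.inr ζ) * FreeAlgebra.ι K (Sum.inr ξ))
  | anchor (ξ : L) (f : A) : StrongRel (FreeAlgebra.ι K (Sum.inl (anchor ξ f)))
      (FreeAlgebra.ι K (Sum.inr ξ) * FreeAlgebra.ι K (Sum.inl f) -
        FreeAlgebra.ι K (Sum.inl f) * FreeAlgebra.ι K (Sum.inr ξ))

/-- The strong enveloping algebra of a Lie-Rinehart pair `(A, L)`. -/
abbrev StrongEnv : Type _ := RingQuot (StrongRel K A L anchor)

/-- The image of an element of `A` in the strong enveloping algebra. -/
def StrongEnv.ofFun (f : A) : StrongEnv K A L anchor :=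
  RingQuot.mkAlgHom K (StrongRel K A L anchor) (FreeAlgebra.ι K (Sum.inl f))

/-- The image of an element of `L` in the strong enveloping algebra. -/
def StrongEnv.ofLie (ξ : L) : StrongEnv K A L anchor :=
  RingQuot.mkAlgHom K (StrongRel K A L anchor) (FreeAlgebra.ι K (Sum.inr ξ))

end Enveloping

section Jets

variable (K : Type*) [CommRing K] (A : Type*) [CommRing A] [Algebra K A]
  (V : Type*) [LieRing V] [LieAlgebra K V] [Module A V] [LieRingModule V A]
  [LieRinehartRing A V] [LieRinehartAlgebra K A V]

/-- The bracket `[f # η, g # μ] = f η(g) # μ - g μ(f) # η + f g # [η, μ]` on `A # V = A ⊗ V`. -/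
def smashBracket : A ⊗[K] V →ₗ[K] A ⊗[K] V →ₗ[K] A ⊗[K] V :=
  TensorProduct.lift (LinearMap.mk₂ K (fun f η =>
    TensorProduct.lift (LinearMap.mk₂ K (fun g μ =>
      (f * ⁅η, g⁆) ⊗ₜ[K] μ - (g * ⁅μ, f⁆) ⊗ₜ[K] η + (f * g) ⊗ₜ[K] ⁅η, μ⁆)
      (fun g g' μ => by
        simp only [lie_add, mul_add, add_mul, TensorProduct.add_tmul]; abel)
      (fun c g μ => by
        simp only [lie_smul, mul_smul_comm, smul_mul_assoc, ← TensorProduct.smul_tmul', smul_add,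
          smul_sub])
      (fun g μ μ' => by
        simp only [lie_add, add_lie, mul_add, TensorProduct.add_tmul, TensorProduct.tmul_add]; abel)
      (fun c g μ => by
        simp only [lie_smul, smul_lie, mul_smul_comm, TensorProduct.tmul_smul,
          ← TensorProduct.smul_tmul', smul_add, smul_sub])))
    (fun f f' η => by
      ext g μ
      simp only [lie_add, mul_add, add_mul, TensorProduct.add_tmul,
        TensorProduct.AlgebraTensorModule.curry_apply, LinearMap.restrictScalars_self,
        TensorProduct.curry_apply, TensorProduct.lift.tmul, LinearMap.mk₂_apply,
        LinearMap.add_apply]; abel)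
    (fun c f η => by
      ext g μ
      simp only [lie_smul, mul_smul_comm, smul_mul_assoc, ← TensorProduct.smul_tmul', smul_add,
          smul_sub,
        TensorProduct.AlgebraTensorModule.curry_apply, LinearMap.restrictScalars_self,
        TensorProduct.curry_apply, TensorProduct.lift.tmul, LinearMap.mk₂_apply,
        LinearMap.smul_apply])
    (fun f η η' => by
      ext g μ
      simp only [add_lie, mul_add, TensorProduct.add_tmul, TensorProduct.tmul_add,
        TensorProduct.AlgebraTensorModule.curry_apply, LinearMap.restrictScalars_self,
        TensorProduct.curry_apply, TensorProduct.lift.tmul, LinearMap.mk₂_apply,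
        LinearMap.add_apply]; abel)
    (fun c f η => by
      ext g μ
      simp only [smul_lie, mul_smul_comm, TensorProduct.tmul_smul,
          ← TensorProduct.smul_tmul', smul_add, smul_sub,
        TensorProduct.AlgebraTensorModule.curry_apply, LinearMap.restrictScalars_self,
        TensorProduct.curry_apply, TensorProduct.lift.tmul, LinearMap.mk₂_apply,
        LinearMap.smul_apply]))

variable {K A V} in
/-- The map `A ⊗ A → A # V`, `g ⊗ f ↦ g # f η`. -/
def smear (η : V) : A ⊗[K] A →ₗ[K] A ⊗[K] V :=
  LinearMap.lTensor A ((LinearMap.toSpanSingleton A V η).restrictScalars K)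

/-- The submodule `Δ^m ⊗_A V` of `A # V = (A ⊗ A) ⊗_A V`, where `Δ` is the kernel of the
multiplication `A ⊗ A → A`. -/
def jetFilt (m : ℕ) : Submodule A (A ⊗[K] V) :=
  Submodule.span A {z | ∃ η : V, ∃ t ∈ KaehlerDifferential.ideal K A ^ m, smear η t = z}

variable {K A V}

theorem smashBracket_tmul (f g : A) (η μ : V) :
    smashBracket K A V (f ⊗ₜ η) (g ⊗ₜ μ) =
      (f * ⁅η, g⁆) ⊗ₜ[K] μ - (g * ⁅μ, f⁆) ⊗ₜ[K] η + (f * g) ⊗ₜ[K] ⁅η, μ⁆ := rfl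

theorem smear_tmul (g f : A) (η : V) : smear η (g ⊗ₜ[K] f) = g ⊗ₜ[K] (f • η) := rfl

theorem smashBracket_swap (x y : A ⊗[K] V) :
    smashBracket K A V x y = - smashBracket K A V y x := by
  induction x using TensorProduct.induction_on with
  | zero => simp
  | add a b ha hb => simp only [map_add, LinearMap.add_apply, ha, hb, neg_add]
  | tmul f η =>
    induction y using TensorProduct.induction_on with
    | zero => simp
    | add a b ha hb => simp only [map_add, LinearMap.add_apply, ha, hb, neg_add]
    | tmul g μ =>
      rw [smashBracket_tmul, smashBracket_tmul, ← lie_skew η μ, TensorProduct.tmul_neg, mul_comm g f]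
      abel

/-- The derivation `η ⊗ 1 + 1 ⊗ η` of `A ⊗ A`. -/
def diagDer (η : V) : A ⊗[K] A →ₗ[K] A ⊗[K] A :=
  LinearMap.rTensor A (LieModule.toEnd K V A η) + LinearMap.lTensor A (LieModule.toEnd K V A η)

theorem diagDer_tmul (η : V) (a b : A) :
    diagDer η (a ⊗ₜ[K] b) = ⁅η, a⁆ ⊗ₜ b + a ⊗ₜ ⁅η, b⁆ := rfl

theorem diagDer_mul (η : V) (s t : A ⊗[K] A) :
    diagDer η (s * t) = s * diagDer η t + diagDer η s * t := by
  induction s using TensorProduct.induction_on with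
  | zero => simp
  | add a b ha hb => simp only [add_mul, map_add, ha, hb]; abel
  | tmul a b =>
    induction t using TensorProduct.induction_on with
    | zero => simp
    | add a b ha hb => simp only [mul_add, map_add, ha, hb]; abel
    | tmul c d =>
      simp only [Algebra.TensorProduct.tmul_mul_tmul, diagDer_tmul,
        LieRinehartRing.leibniz_mul_right, smul_eq_mul, TensorProduct.add_tmul,
        TensorProduct.tmul_add, mul_add, add_mul]
      abel

theorem mul'_diagDer (η : V) (t : A ⊗[K] A) :
    Algebra.TensorProduct.lmul' K (diagDer η t) = ⁅η, Algebra.TensorProduct.lmul' K t⁆ := by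
  induction t using TensorProduct.induction_on with
  | zero => simp
  | add a b ha hb => simp only [map_add, ha, hb, lie_add]
  | tmul a b =>
    simp only [diagDer_tmul, map_add, Algebra.TensorProduct.lmul'_apply_tmul,
      LieRinehartRing.leibniz_mul_right, smul_eq_mul]
    ring

theorem diagDer_mem (η : V) (m : ℕ) {t : A ⊗[K] A}
    (ht : t ∈ KaehlerDifferential.ideal K A ^ m) :
    diagDer η t ∈ KaehlerDifferential.ideal K A ^ m := by
  induction m generalizing t with
  | zero => simp
  | succ m ih =>
    rw [pow_succ] at ht ⊢
    induction ht using Submodule.mul_induction_on' with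
    | mem_mul_mem a ha b hb =>
      rw [diagDer_mul]
      refine add_mem (Ideal.mul_mem_mul ha ?_) (Ideal.mul_mem_mul (ih ha) hb)
      rw [KaehlerDifferential.ideal, RingHom.mem_ker] at hb ⊢
      exact (mul'_diagDer η b).trans ((congrArg (⁅η, ·⁆) hb).trans (lie_zero _))
    | add x hx y hy hx' hy' => rw [map_add]; exact add_mem hx' hy'

theorem smashBracket_smul (f a : A) (η : V) (z : A ⊗[K] V) :
    smashBracket K A V (f ⊗ₜ η) (a • z) =
      a • smashBracket K A V (f ⊗ₜ η) z + (f * ⁅η, a⁆) • z := by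
  induction z using TensorProduct.induction_on with
  | zero => simp
  | add x y hx hy => simp only [smul_add, map_add, hx, hy]; abel
  | tmul g μ =>
    simp only [TensorProduct.smul_tmul', smashBracket_tmul, smul_eq_mul, smul_add, smul_sub,
      LieRinehartRing.leibniz_mul_right, mul_add, TensorProduct.add_tmul, mul_assoc]
    rw [mul_left_comm f a, mul_left_comm f a]
    abel

theorem smashBracket_smear (f : A) (η μ : V) (t : A ⊗[K] A) :
    smashBracket K A V (f ⊗ₜ η) (smear μ t) =
      f • smear μ (diagDer η t) + f • smear ⁅η, μ⁆ t -
        (Algebra.TensorProduct.lmul' K t * ⁅μ, f⁆) ⊗ₜ[K] η := by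
  induction t using TensorProduct.induction_on with
  | zero => simp
  | add a b ha hb =>
    simp only [map_add, ha, hb, smul_add, add_mul, TensorProduct.add_tmul]; abel
  | tmul a b =>
    simp only [smear_tmul, smashBracket_tmul, diagDer_tmul, map_add,
      Algebra.TensorProduct.lmul'_apply_tmul, TensorProduct.smul_tmul', smul_add, smul_eq_mul,
      LieRinehartRing.leibniz_smul_right, LieRinehartRing.lie_smul_eq_mul, TensorProduct.tmul_add,
      mul_assoc]
    abel

/-- `A ⊗ V → V`, `g # η ↦ g η`. -/
def smashAnchor : A ⊗[K] V →ₗ[A] V := LinearMap.liftBaseChange A (LinearMap.id : V →ₗ[K] V)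

theorem smashAnchor_tmul (g : A) (η : V) : smashAnchor (g ⊗ₜ[K] η) = g • η := by
  simp [smashAnchor]

theorem smashAnchor_smear (η : V) (t : A ⊗[K] A) :
    smashAnchor (smear η t) = Algebra.TensorProduct.lmul' K t • η := by
  induction t using TensorProduct.induction_on with
  | zero => simp
  | add a b ha hb => simp only [map_add, ha, hb, add_smul]
  | tmul a b => simp [smear_tmul, smashAnchor_tmul, mul_smul]

theorem jetFilt_one_le : jetFilt K A V 1 ≤ LinearMap.ker (smashAnchor (K := K) (A := A) (V := V)) := by
  refine Submodule.span_le.2 ?_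
  rintro _ ⟨η, t, ht, rfl⟩
  rw [pow_one, KaehlerDifferential.ideal, RingHom.mem_ker] at ht
  exact (smashAnchor_smear η t).trans (by erw [ht]; simp)

theorem smashBracket_mem (m : ℕ) (x : A ⊗[K] V) {z : A ⊗[K] V} (hz : z ∈ jetFilt K A V m) :
    smashBracket K A V x z ∈ jetFilt K A V m := by
  rcases Nat.eq_zero_or_pos m with rfl | hm
  · have h : jetFilt K A V 0 = ⊤ := by
      refine top_le_iff.1 fun y _ => ?_
      induction y using TensorProduct.induction_on with
      | zero => exact zero_mem _
      | add a b ha hb => exact add_mem (ha trivial) (hb trivial)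
      | tmul f η =>
        exact Submodule.subset_span ⟨η, f ⊗ₜ 1, by simp, by rw [smear_tmul, one_smul]⟩
    rw [h]; trivial
  · induction x using TensorProduct.induction_on with
    | zero => simp
    | add a b ha hb => rw [map_add, LinearMap.add_apply]; exact add_mem ha hb
    | tmul f η =>
      induction hz using Submodule.span_induction with
      | zero => simp
      | add a b _ _ ha hb => rw [map_add]; exact add_mem ha hb
      | smul a z hz ih =>
        rw [smashBracket_smul]
        exact add_mem (Submodule.smul_mem _ _ ih) (Submodule.smul_mem _ _ hz)
      | mem z hz =>
        obtain ⟨μ, t, ht, rfl⟩ := hz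
        have h0 : Algebra.TensorProduct.lmul' K t = 0 :=
          RingHom.mem_ker.1 (Ideal.pow_le_self hm.ne' ht)
        rw [smashBracket_smear, h0, zero_mul, TensorProduct.zero_tmul, sub_zero]
        exact add_mem
          (Submodule.smul_mem _ _ (Submodule.subset_span ⟨μ, _, diagDer_mem η m ht, rfl⟩))
          (Submodule.smul_mem _ _ (Submodule.subset_span ⟨_, t, ht, rfl⟩))

theorem jetFilt_anti (m : ℕ) : jetFilt K A V (m + 1) ≤ jetFilt K A V m := by
  refine Submodule.span_mono ?_
  rintro _ ⟨η, t, ht, rfl⟩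
  exact ⟨η, t, Ideal.pow_le_pow_right (Nat.le_succ m) ht, rfl⟩

variable (K A V) in
/-- The space `A #̂ V = lim (A # V) / (Δ^m ⊗_A V)` of jets of vector fields. -/
def Jets : Submodule A (∀ m, (A ⊗[K] V) ⧸ jetFilt K A V m) where
  carrier := {ξ | ∀ m, Submodule.factor (jetFilt_anti m) (ξ (m + 1)) = ξ m}
  add_mem' := fun {a b} ha hb m => by rw [Pi.add_apply, map_add, ha m, hb m, Pi.add_apply]
  zero_mem' := fun m => by simp
  smul_mem' := fun c a ha m => by rw [Pi.smul_apply, map_smul, ha m, Pi.smul_apply]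

/-- The image of an element of `A # V` in the completion. -/
def Jets.of (z : A ⊗[K] V) : Jets K A V := ⟨fun _ => Submodule.Quotient.mk z, fun _ => rfl⟩

/-- The bracket induced on `(A # V) / (Δ^m ⊗_A V)`. -/
def quotBracket (m : ℕ) (x y : (A ⊗[K] V) ⧸ jetFilt K A V m) : (A ⊗[K] V) ⧸ jetFilt K A V m :=
  Quotient.liftOn₂' x y (fun a b => Submodule.Quotient.mk (smashBracket K A V a b))
    fun a b a' b' ha hb => (Submodule.Quotient.eq _).2 (by
      rw [Submodule.quotientRel_def] at ha hb
      have e : smashBracket K A V a b - smashBracket K A V a' b' =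
          smashBracket K A V a (b - b') - smashBracket K A V b' (a - a') := by
        rw [← neg_eq_iff_eq_neg.2 (smashBracket_swap (a - a') b')]
        simp only [map_sub, LinearMap.sub_apply]; abel
      rw [e]
      exact sub_mem (smashBracket_mem m _ hb) (smashBracket_mem m _ ha))

/-- The Lie bracket of the completion `A #̂ V`, induced by the bracket of `A # V`. -/
instance : Bracket (Jets K A V) (Jets K A V) where
  bracket ξ ζ := ⟨fun m => quotBracket m (ξ.1 m) (ζ.1 m), fun m => by
    beta_reduce
    rw [← ξ.2 m, ← ζ.2 m]
    induction ξ.1 (m + 1) using Submodule.Quotient.induction_on with | _ a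
    induction ζ.1 (m + 1) using Submodule.Quotient.induction_on with | _ b
    rfl⟩

/-- The anchor map `A #̂ V → V` extending `g # η ↦ g η`. -/
def Jets.anchor : Jets K A V →ₗ[A] V :=
  (Submodule.liftQ (jetFilt K A V 1) smashAnchor jetFilt_one_le) ∘ₗ
    LinearMap.proj 1 ∘ₗ (Jets K A V).subtype

section Map

variable {B : Type*} [CommRing B] [Algebra K B]
  {V' : Type*} [LieRing V'] [LieAlgebra K V'] [Module B V'] [LieRingModule V' B]
  [LieRinehartRing B V'] [LieRinehartAlgebra K B V'] (r : A →ₐ[K] B)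
  (F : LieRinehartAlgebra.Hom r V V')

/-- The map `A # V → B # V'` induced by a morphism `(A, V) → (B, V')`. -/
def smashMap : A ⊗[K] V →ₗ[K] B ⊗[K] V' :=
  TensorProduct.map r.toLinearMap (F.toLieHom : V →ₗ[K] V')

theorem smashMap_smul (a : A) (z : A ⊗[K] V) : smashMap r F (a • z) = r a • smashMap r F z := by
  induction z using TensorProduct.induction_on with
  | zero => simp
  | add x y hx hy => simp only [smul_add, map_add, hx, hy]
  | tmul f η => simp [smashMap, TensorProduct.smul_tmul']

theorem smashMap_smear (η : V) (t : A ⊗[K] A) :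
    smashMap r F (smear η t) = smear (F.toLieHom η) (Algebra.TensorProduct.map r r t) := by
  induction t using TensorProduct.induction_on with
  | zero => simp
  | add x y hx hy => simp only [map_add, hx, hy]
  | tmul a b =>
    simp only [smear_tmul, Algebra.TensorProduct.map_tmul, smashMap, TensorProduct.map_tmul]
    exact congrArg _ (F.map_smul_apply b η)

theorem map_ideal_pow_le (m : ℕ) : (KaehlerDifferential.ideal K A ^ m) ≤
    (KaehlerDifferential.ideal K B ^ m).comap (Algebra.TensorProduct.map r r) := by
  rw [← Ideal.map_le_iff_le_comap, Ideal.map_pow]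
  refine Ideal.pow_right_mono (Ideal.map_le_iff_le_comap.2 fun t ht => ?_) m
  have e : ∀ t : A ⊗[K] A, Algebra.TensorProduct.lmul' K (Algebra.TensorProduct.map r r t) =
      r (Algebra.TensorProduct.lmul' K t) := fun t => by
    induction t using TensorProduct.induction_on with
    | zero => simp
    | add x y hx hy => simp only [map_add, hx, hy]
    | tmul a b => simp
  have h0 : Algebra.TensorProduct.lmul' K t = 0 := RingHom.mem_ker.1 ht
  exact RingHom.mem_ker.2 ((e t).trans (by rw [h0, map_zero]))

theorem smashMap_mem (m : ℕ) {z : A ⊗[K] V} (hz : z ∈ jetFilt K A V m) :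
    smashMap r F z ∈ jetFilt K B V' m := by
  induction hz using Submodule.span_induction with
  | zero => simp
  | add a b _ _ ha hb => rw [map_add]; exact add_mem ha hb
  | smul a z hz ih => rw [smashMap_smul]; exact Submodule.smul_mem _ _ ih
  | mem z hz =>
    obtain ⟨μ, t, ht, rfl⟩ := hz
    rw [smashMap_smear]
    exact Submodule.subset_span ⟨_, _, map_ideal_pow_le r m ht, rfl⟩

/-- The map of completions `A #̂ V → B #̂ V'` induced by a morphism `(A, V) → (B, V')`. -/
def Jets.map (ξ : Jets K A V) : Jets K B V' :=
  ⟨fun m => Quotient.map' (smashMap r F) (fun a b h => by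
      rw [Submodule.quotientRel_def] at h ⊢
      rw [← map_sub]; exact smashMap_mem r F m h) (ξ.1 m), fun m => by
    beta_reduce
    rw [← ξ.2 m]
    induction ξ.1 (m + 1) using Submodule.Quotient.induction_on with | _ a
    rfl⟩

end Map

end Jets
section Geometry

variable (K : Type u) [Field K] {X : Scheme.{u}} [X.Over (Spec (CommRingCat.of K))]

/-- The sections of the structure sheaf of a scheme over `Spec K` are `K`-algebras. -/
instance sectionsAlgebra (U : X.Opens) : Algebra K Γ(X, U) :=
  ((X ↘ Spec (CommRingCat.of K)).appLE ⊤ U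
    (le_top.trans_eq (Scheme.Hom.preimage_top _).symm) |>.hom.comp
    (Scheme.ΓSpecIso (CommRingCat.of K)).inv.hom).toAlgebra

/-- Restriction of functions. -/
def res {U V : X.Opens} (h : V ≤ U) : Γ(X, U) →ₐ[K] Γ(X, V) where
  __ := (X.presheaf.map (homOfLE h).op).hom
  commutes' c := by
    change ((X ↘ Spec (CommRingCat.of K)).appLE ⊤ U
      (le_top.trans_eq (Scheme.Hom.preimage_top _).symm) ≫
      X.presheaf.map (homOfLE h).op).hom _ = _
    rw [Scheme.Hom.appLE_map]
    rfl

theorem res_res {U V V' : X.Opens} (h : V ≤ U) (h' : V' ≤ V) (f : Γ(X, U)) :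
    res K h' (res K h f) = res K (h'.trans h) f := by
  change (X.presheaf.map _ ≫ X.presheaf.map _).hom f = _
  rw [← Functor.map_comp]; rfl

theorem res_self {U : X.Opens} (f : Γ(X, U)) : res K (le_refl U) f = f := by
  change (X.presheaf.map (𝟙 _)).hom f = f
  rw [X.presheaf.map_id]; rfl

/-- The compatible families of derivations that define the vector fields on `U`. -/
def vectorFieldSubmodule (U : X.Opens) :
    Submodule K (∀ V : {V : X.Opens // V ≤ U}, Derivation K Γ(X, V.1) Γ(X, V.1)) where
  carrier := {η | ∀ (V V' : {V : X.Opens // V ≤ U}) (h : V'.1 ≤ V.1) (f : Γ(X, V.1)),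
    res K h (η V f) = η V' (res K h f)}
  add_mem' := fun {a b} ha hb V V' h f => by simp [ha V V' h f, hb V V' h f]
  zero_mem' := fun V V' h f => by simp
  smul_mem' := fun c a ha V V' h f => by simp [ha V V' h f]

/-- The Lie algebra `Θ(U)` of vector fields on `U`, the `K`-linear derivations of the sheaf of
functions on `U`: families of derivations of the rings `𝒪(V)`, `V ⊆ U`, which commute with
restrictions. -/
def VectorField (U : X.Opens) : Type u := vectorFieldSubmodule K U

namespace VectorField

variable {U : X.Opens}

instance : AddCommGroup (VectorField K U) :=
  inferInstanceAs (AddCommGroup (vectorFieldSubmodule K U))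

instance : Module K (VectorField K U) := inferInstanceAs (Module K (vectorFieldSubmodule K U))

variable {K} in
/-- The derivation of `𝒪(V)` given by a vector field on `U`, for `V ⊆ U`. -/
def der (η : VectorField K U) {V : X.Opens} (h : V ≤ U) : Derivation K Γ(X, V) Γ(X, V) :=
  η.1 ⟨V, h⟩

variable {K} in
theorem ext' {η μ : VectorField K U}
    (e : ∀ (V : X.Opens) (h : V ≤ U) (f : Γ(X, V)), η.der h f = μ.der h f) : η = μ :=
  Subtype.ext (funext fun V => Derivation.ext fun f => e V.1 V.2 f)

variable {K} in
theorem res_der (η : VectorField K U) {V V' : X.Opens} (h : V ≤ U) (h' : V' ≤ V) (f : Γ(X, V)) :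
    res K h' (η.der h f) = η.der (h'.trans h) (res K h' f) :=
  η.2 ⟨V, h⟩ ⟨V', h'.trans h⟩ h' f

instance : Bracket (VectorField K U) (VectorField K U) where
  bracket η μ := ⟨fun V => ⁅η.1 V, μ.1 V⁆, fun V V' h f => by
    simp only [Derivation.commutator_apply, map_sub, η.2 V V' h, μ.2 V V' h]⟩

instance : SMul Γ(X, U) (VectorField K U) where
  smul f η := ⟨fun V => res K V.2 f • η.1 V, fun V V' h g => by
    have := η.2 V V' h g
    simp only [Derivation.smul_apply, smul_eq_mul, map_mul, res_res, this]⟩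

section

variable {K} {V : X.Opens} (h : V ≤ U) (g : Γ(X, V)) (η μ : VectorField K U)

theorem add_der : (η + μ).der h g = η.der h g + μ.der h g := rfl
theorem zero_der : (0 : VectorField K U).der h g = 0 := rfl
theorem smul_der (f : Γ(X, U)) : (f • η).der h g = res K h f * η.der h g := rfl
theorem csmul_der (c : K) : (c • η).der h g = c • η.der h g := rfl
theorem lie_der : ⁅η, μ⁆.der h g = η.der h (μ.der h g) - μ.der h (η.der h g) := rfl

end

instance : LieRing (VectorField K U) where
  add_lie _ _ _ := ext' fun V h g => by simp only [lie_der, add_der, map_add]; abel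
  lie_add _ _ _ := ext' fun V h g => by simp only [lie_der, add_der, map_add]; abel
  lie_self _ := ext' fun V h g => by rw [lie_der, zero_der, sub_self]
  leibniz_lie _ _ _ := ext' fun V h g => by simp only [lie_der, add_der, map_sub]; abel

instance : LieAlgebra K (VectorField K U) where
  lie_smul _ _ _ := ext' fun V h g => by
    simp only [lie_der, csmul_der, Derivation.map_smul, smul_sub]

instance : Module Γ(X, U) (VectorField K U) where
  one_smul η := ext' fun V h g => by rw [smul_der, map_one, one_mul]
  mul_smul a b η := ext' fun V h g => by simp only [smul_der, map_mul, mul_assoc]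
  smul_zero a := ext' fun V h g => by simp only [smul_der, zero_der, mul_zero]
  smul_add a η μ := ext' fun V h g => by simp only [smul_der, add_der, mul_add]
  add_smul a b η := ext' fun V h g => by simp only [smul_der, add_der, map_add, add_mul]
  zero_smul η := ext' fun V h g => by simp only [smul_der, zero_der, map_zero, zero_mul]

/-- Vector fields on `U` act on functions on `U`. -/
instance : LieRingModule (VectorField K U) Γ(X, U) where
  bracket η f := η.der le_rfl f
  add_lie _ _ _ := rfl
  lie_add η f g := map_add (η.der le_rfl) f g
  leibniz_lie η μ f := by
    change η.der le_rfl (μ.der le_rfl f) =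
      ⁅η, μ⁆.der le_rfl f + μ.der le_rfl (η.der le_rfl f)
    rw [lie_der, sub_add_cancel]

variable {K} in
theorem lie_fun (η : VectorField K U) (f : Γ(X, U)) : ⁅η, f⁆ = η.der le_rfl f := rfl

instance : LieRinehartRing Γ(X, U) (VectorField K U) where
  lie_smul_eq_mul' a b η := by rw [lie_fun, smul_der, res_self, lie_fun]
  leibniz_mul_right' η a b := by
    simp only [lie_fun, Derivation.leibniz, smul_eq_mul, mul_comm b]
  leibniz_smul_right' η μ a := ext' fun V h g => by
    simp only [lie_der, smul_der, add_der, Derivation.leibniz, smul_eq_mul, lie_fun, res_der]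
    ring

instance : LieRinehartAlgebra K Γ(X, U) (VectorField K U) where
  smul_assoc c a η := ext' fun V h g => by
    simp only [smul_der, csmul_der, map_smul, smul_mul_assoc]
  smul_lie c η f := rfl
  lie_smul c η f := (η.der le_rfl).map_smul c f

/-- Restriction of vector fields, as a morphism of Lie-Rinehart pairs. -/
def restrict {V : X.Opens} (h : V ≤ U) :
    LieRinehartAlgebra.Hom (res K h) (VectorField K U) (VectorField K V) where
  toFun η := ⟨fun V' => η.1 ⟨V'.1, V'.2.trans h⟩, fun V' V'' h' f =>
    η.2 ⟨V'.1, V'.2.trans h⟩ ⟨V''.1, V''.2.trans h⟩ h' f⟩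
  map_add' _ _ := rfl
  map_smul' _ _ := rfl
  map_lie' := rfl
  map_smul_apply' a η := ext' fun V' h' g => by
    rw [smul_der, res_res]; rfl
  apply_lie' f η := res_der η le_rfl h f

end VectorField

variable (X) in
/-- An étale chart on `X`: an affine open set `U` with uniformizing parameters `x₁, …, xₙ`, that
is, algebraically independent functions on `U` over which all functions on `U` are algebraic, and
such that the derivations `∂/∂x_i` of `K[x₁, …, xₙ]` extend to derivations of `𝒪(U)`. As `U` is
affine, derivations of `𝒪(U)` are the same as vector fields on `U`. -/
structure EtaleChart (n : ℕ) where
  U : X.Opens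
  isAffineOpen : IsAffineOpen U
  x : Fin n → Γ(X, U)
  algebraicIndependent : AlgebraicIndependent K x
  isAlgebraic : Algebra.IsAlgebraic (Algebra.adjoin K (Set.range x)) Γ(X, U)
  /-- The vector fields `∂/∂x_i` on `U`; they are determined by the `x_j`. -/
  pd : Fin n → VectorField K U
  pd_x : ∀ i j, ⁅pd i, x j⁆ = if i = j then 1 else 0

/-- The Lie algebra `𝒪(U) #̂ Θ(U)` of jets of vector fields on `U`. -/
abbrev JetField (U : X.Opens) : Type u := Jets K Γ(X, U) (VectorField K U)

/-- The algebra `𝒜𝒱(U)`, the strong enveloping algebra of the pair `(𝒪(U), 𝒪(U) #̂ Θ(U))`. -/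
abbrev AVAlg (U : X.Opens) : Type u :=
  StrongEnv K Γ(X, U) (JetField K U) fun ξ f => ⁅Jets.anchor ξ, f⁆

/-- A structure of a sheaf of `AV`-modules on a sheaf of `𝒪`-modules `M`: an action of `𝒜𝒱(U)`
on `M(U)` for all affine open sets `U`, extending the action of `𝒪(U)`, and compatible with
restrictions. -/
structure AVModuleStructure (M : X.Modules) where
  act (U : X.affineOpens) : AVAlg K U.1 →+* AddMonoid.End Γ(M, U.1)
  act_ofFun (U : X.affineOpens) (f : Γ(X, U.1)) (s : Γ(M, U.1)) :
    act U (StrongEnv.ofFun K _ _ _ f) s = f • s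
  act_res {U V : X.affineOpens} (h : V.1 ≤ U.1) (ξ : JetField K U.1) (s : Γ(M, U.1)) :
    M.presheaf.map (homOfLE h).op (act U (StrongEnv.ofLie K _ _ _ ξ) s) =
      act V (StrongEnv.ofLie K _ _ _ (Jets.map _ (VectorField.restrict K h) ξ))
        (M.presheaf.map (homOfLE h).op s)

variable {K} in
/-- The action of a vector field `η` on the sections of a sheaf of `AV`-modules, that is, of the
element `1 # η` of `𝒜𝒱(U)`. -/
def AVModuleStructure.lieAct {M : X.Modules} (S : AVModuleStructure K M) (U : X.affineOpens)
    (η : VectorField K U.1) (s : Γ(M, U.1)) : Γ(M, U.1) :=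
  S.act U (StrongEnv.ofLie K _ _ _ (Jets.of (1 ⊗ₜ η))) s

variable {K} {n : ℕ}

namespace EtaleChart

/-- The derivations `∂/∂x_i` of `𝒪(V)`, for `V ⊆ U`. -/
def der (C : EtaleChart K X n) {V : X.Opens} (h : V ≤ C.U) (i : Fin n) :
    Derivation K Γ(X, V) Γ(X, V) :=
  (C.pd i).der h

/-- For étale charts with parameters `x_i = G_i(y)` and `y_j`, over an open set `V` contained in
both charts, `φ` is the automorphism `φ_G : X_i ↦ G_i(y + Y) - G_i(y)` of the algebra of power
series with coefficients in `𝒪(V)`. -/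
def IsTransition (C₁ C₂ : EtaleChart K X n) {V : X.Opens} (h₁ : V ≤ C₁.U) (h₂ : V ≤ C₂.U)
    (φ : PowAut n Γ(X, V)) : Prop :=
  ∀ i, φ.1 (MvPowerSeries.X i) =
    taylor (C₂.der h₂) (res K h₁ (C₁.x i)) - MvPowerSeries.C (res K h₁ (C₁.x i))

end EtaleChart

variable {W : Type u} [AddCommGroup W] [Module K W]

/-- Restriction of sections of `𝒪 ⊗ W`. -/
def resW {V V' : X.Opens} (h : V' ≤ V) : Γ(X, V) ⊗[K] W →ₗ[K] Γ(X, V') ⊗[K] W :=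
  (res K h).toLinearMap.rTensor W

theorem resW_smul {V V' : X.Opens} (h : V' ≤ V) (f : Γ(X, V)) (z : Γ(X, V) ⊗[K] W) :
    resW h (f • z) = res K h f • resW h z := by
  induction z using TensorProduct.induction_on with
  | zero => simp
  | add x y hx hy => simp only [smul_add, map_add, hx, hy]
  | tmul g w => simp [resW, TensorProduct.smul_tmul']

/-- The sections over `V` of the bundle glued from the trivial bundles `𝒪 ⊗ W` on étale charts by
the transition maps `g(x) w ↦ g(G(y)) ρ(φ_G) w`, where `ρ` is the representation
`P`: a section is a family of its expressions in all étale charts over all open sets `V' ⊆ V` contained in the chart. -/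
def jetSubgroup (P : PowAutRep K n W) (V : X.Opens) :
    AddSubgroup (∀ (C : EtaleChart K X n) (V' : {V' : X.Opens // V' ≤ V ∧ V' ≤ C.U}),
      Γ(X, V'.1) ⊗[K] W) where
  carrier := {s |
    (∀ (C : EtaleChart K X n) (V' V'' : {V' : X.Opens // V' ≤ V ∧ V' ≤ C.U}) (h : V''.1 ≤ V'.1),
      resW h (s C V') = s C V'') ∧
    (∀ (C₁ C₂ : EtaleChart K X n) (V' : X.Opens) (h : V' ≤ V) (h₁ : V' ≤ C₁.U) (h₂ : V' ≤ C₂.U)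
      (φ : PowAut n Γ(X, V')), C₁.IsTransition C₂ h₁ h₂ φ →
      s C₂ ⟨V', h, h₂⟩ = P.act Γ(X, V') φ (s C₁ ⟨V', h, h₁⟩))}
  add_mem' := fun {a b} ha hb => ⟨fun C V' V'' h => by
      simp only [Pi.add_apply, map_add, ha.1 C V' V'' h, hb.1 C V' V'' h],
    fun C₁ C₂ V' h h₁ h₂ φ hφ => by
      simp only [Pi.add_apply, map_add, ha.2 C₁ C₂ V' h h₁ h₂ φ hφ, hb.2 C₁ C₂ V' h h₁ h₂ φ hφ]⟩
  zero_mem' := ⟨fun C V' V'' h => by simp, fun C₁ C₂ V' h h₁ h₂ φ hφ => by simp⟩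
  neg_mem' := fun {a} ha => ⟨fun C V' V'' h => by
      simp only [Pi.neg_apply, map_neg, ha.1 C V' V'' h],
    fun C₁ C₂ V' h h₁ h₂ φ hφ => by
      simp only [Pi.neg_apply, map_neg, ha.2 C₁ C₂ V' h h₁ h₂ φ hφ]⟩

/-- The sections of `𝒥^W` over `V`. -/
def JetSections (P : PowAutRep K n W) (V : X.Opens) : Type u := jetSubgroup P V

namespace JetSections

variable (P : PowAutRep K n W) {V : X.Opens}

instance : AddCommGroup (JetSections P V) := inferInstanceAs (AddCommGroup (jetSubgroup P V))

instance : SMul Γ(X, V) (JetSections P V) where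
  smul f s := ⟨fun C V' => res K V'.2.1 f • s.1 C V', fun C V' V'' h => by
      rw [resW_smul, res_res, s.2.1 C V' V'' h],
    fun C₁ C₂ V' h h₁ h₂ φ hφ =>
      (congrArg _ (s.2.2 C₁ C₂ V' h h₁ h₂ φ hφ)).trans (map_smul _ _ _).symm⟩

instance : Module Γ(X, V) (JetSections P V) where
  one_smul s := Subtype.ext <| funext fun C => funext fun V' =>
    (congrArg (· • s.1 C V') (map_one (res K V'.2.1))).trans (one_smul _ _)
  mul_smul a b s := Subtype.ext <| funext fun C => funext fun V' =>
    (congrArg (· • s.1 C V') (map_mul (res K V'.2.1) a b)).trans (mul_smul _ _ _)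
  smul_zero a := Subtype.ext <| funext fun C => funext fun V' => smul_zero _
  smul_add a s t := Subtype.ext <| funext fun C => funext fun V' => smul_add _ _ _
  add_smul a b s := Subtype.ext <| funext fun C => funext fun V' =>
    (congrArg (· • s.1 C V') (map_add (res K V'.2.1) a b)).trans (add_smul _ _ _)
  zero_smul s := Subtype.ext <| funext fun C => funext fun V' =>
    (congrArg (· • s.1 C V') (map_zero (res K V'.2.1))).trans (zero_smul _ _)

/-- Restriction of sections of `𝒥^W`. -/
def restrict {V V' : X.Opens} (h : V' ≤ V) : JetSections P V →+ JetSections P V' where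
  toFun s := ⟨fun C V'' => s.1 C ⟨V''.1, V''.2.1.trans h, V''.2.2⟩,
    fun C V₁ V₂ h' => s.2.1 C ⟨V₁.1, V₁.2.1.trans h, V₁.2.2⟩ ⟨V₂.1, V₂.2.1.trans h, V₂.2.2⟩ h',
    fun C₁ C₂ V₁ h' => s.2.2 C₁ C₂ V₁ (h'.trans h)⟩
  map_zero' := rfl
  map_add' _ _ := rfl

variable {P} in
/-- The expression of a section of `𝒥^W` over `V` in an étale chart that contains `V`. -/
def triv (C : EtaleChart K X n) (h : V ≤ C.U) : JetSections P V →ₗ[Γ(X, V)] Γ(X, V) ⊗[K] W where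
  toFun s := s.1 C ⟨V, le_rfl, h⟩
  map_add' _ _ := rfl
  map_smul' f s := congrArg (· • s.1 C ⟨V, le_rfl, h⟩) (res_self K f)

end JetSections

/-- The abelian presheaf underlying `𝒥^W`. -/
def jetAbPresheaf (P : PowAutRep K n W) : TopCat.Presheaf Ab.{u} X where
  obj V := AddCommGrpCat.of (JetSections P (X := X) V.unop)
  map h := AddCommGrpCat.ofHom (JetSections.restrict P h.unop.le)

instance (P : PowAutRep K n W) (V : X.Opensᵒᵖ) :
    Module (X.ringCatSheaf.obj.obj V) ((jetAbPresheaf (X := X) P).obj V) :=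
  inferInstanceAs (Module Γ(X, V.unop) (JetSections P V.unop))

/-- The presheaf of `𝒪`-modules `𝒥^W`. -/
def jetPresheaf (P : PowAutRep K n W) : X.PresheafOfModules :=
  PresheafOfModules.ofPresheaf (R := X.ringCatSheaf.obj) (jetAbPresheaf P) (fun U V h f s =>
    Subtype.ext <| funext fun C => funext fun V' =>
      congrArg (· • s.1 C _) (res_res K h.unop.le V'.2.1 f).symm)

/-- The sheaf of `𝒪`-modules `𝒥^W`, given that the presheaf defined above is a sheaf. -/
def jetSheaf (P : PowAutRep K n W)
    (hP : Presheaf.IsSheaf (Opens.grothendieckTopology X) (jetPresheaf (X := X) P).presheaf) :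
    X.Modules :=
  ⟨jetPresheaf P, hP⟩

/-- The trivialization of the sheaf `𝒥^W` over an étale chart. -/
def jetSheaf.triv {P : PowAutRep K n W}
    (hP : Presheaf.IsSheaf (Opens.grothendieckTopology X) (jetPresheaf (X := X) P).presheaf)
    (C : EtaleChart K X n) {V : X.Opens} (h : V ≤ C.U) :
    Γ(jetSheaf P hP, V) →ₗ[Γ(X, V)] Γ(X, V) ⊗[K] W where
  toFun s := JetSections.triv (P := P) C h s
  map_add' s t := map_add (JetSections.triv (P := P) C h) s t
  map_smul' f s := map_smul (JetSections.triv (P := P) C h) f s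

end Geometry

end AVSheaf

end

open AVSheaf

/-! Weights make everything finite. The Euler derivation `E = ∑ X_i ∂/∂X_i` satisfies `[E, X^s
∂/∂X_i] = (|s| - 1) X^s ∂/∂X_i`. Since `End W` is finite-dimensional, commutation with `E` has only
finitely many eigenvalues on it. So derivations of high order act on `W` by zero (`actEnd_eq_zero`),
and over any `K`-algebra `R` an operator on `R ⊗ W` of high weight is zero (`eq_zero_of_weight`).
Hence a derivation `D` of `R[[X]]` without constant terms acts on `R ⊗ W` by a finite sum `ρ(D) = ∑
ρ_k(D)` over weights `k`.

Integration. The operator `P` of an automorphism `φ` has to satisfy `P ρ(D) = ρ(φ D φ⁻¹) P`. For `D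
= E` this reads `[E, P] = -ρ(φ E φ⁻¹ - E) P`. With a formal variable `t` recording weights it
becomes `t dP/dt = -ρ_t(φ E φ⁻¹ - E) P`. The derivation `φ E φ⁻¹ - E` has only terms of positive
weight, because linear automorphisms fix `E`; so there is exactly one solution for each value of `P`
at `t = 0`. That value is taken to be `τ(g)`, where `g` is the linear part of `φ` and `τ` is the
given representation of `GLₙ`. Uniqueness of solutions gives the intertwining relation
(`autT_mul_rhoT`), multiplicativity (`autT_mul`), naturality in `R` (`autT_map`) and the
differential (`autT_infAut`). The weight bound makes `P` a polynomial in `t`, which is evaluated at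
`t = 1`. The only resonance of the equation requires `τ(g) ρ_k(D) = ρ_k(g D g⁻¹) τ(g)`
(`GLRep.Integrates.op_mul`); this follows from its infinitesimal form by differentiating along the
path `1 + T (g - 1)`.

Differential over all rings. A representation that integrates the action is tested only on
derivations over `K`. The point `1 + εη` nevertheless acts by `1 + ερ(η)` for every `η` over every
`R` (`PowAutRep.Integrates.op_infAut`): it is enough to treat the universal derivation over a
polynomial ring, and a given vector in the image involves finitely many of its variables.

Geometry. In coordinates `x` a vector field `η` acts on `B ⊗ W` by `η ⊗ 1 + ρ(η^v)`, where `η^v = ∑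
(η_i(x + X) - η_i(x)) ∂/∂X_i`. The Taylor expansion turns `η` into `η + η^v`, with `η` acting on
coefficients (`coeffDer_add_vert_taylorHom`). Therefore the formula respects brackets
(`vecAct_lie`). The transition automorphisms carry one Taylor expansion to another, so they form a
cocycle, and differentiating them along `η` shows that the action commutes with the gluing
(`op_trans_vecAct`). Elements of a high power of `Δ` have Taylor series of high order, so the action
passes to jets (`jetAct_eq_zero`).

Charts. On a standard smooth affine open set there are functions whose differentials form a basis,
and the dual derivations make them uniformizing parameters. Derivations on any open subset of a
chart are determined by their values on the parameters (`derivation_eq_zero_of_chart`), which gives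
commuting derivations and well-defined transitions. Finally, `𝒪 ⊗ W` is a finite power of `𝒪`, so
sections glue. -/

noncomputable section

namespace AVSheaf

/-! ### Order filtration on power series; homomorphisms and derivations are determined by the
variables. -/

section PowerSeriesTools

open MvPowerSeries

variable {n : ℕ} {R S T : Type*} [CommRing R] [CommRing S] [CommRing T]

variable (n R) in
/-- The ideal of power series without terms of total degree less than `k`. -/
def ordIdeal (k : ℕ) : Ideal (MvPowerSeries (Fin n) R) where
  carrier := {f | ∀ s : Fin n →₀ ℕ, s.degree < k → coeff s f = 0}
  add_mem' ha hb s hs := by rw [map_add, ha s hs, hb s hs, add_zero]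
  zero_mem' s _ := by simp
  smul_mem' c f hf s hs := by
    classical
    rw [smul_eq_mul, coeff_mul]
    refine Finset.sum_eq_zero fun p hp => ?_
    rw [hf p.2, mul_zero]
    rw [← Finset.HasAntidiagonal.mem_antidiagonal.1 hp, map_add] at hs
    omega

theorem mem_ordIdeal {k : ℕ} {f : MvPowerSeries (Fin n) R} :
    f ∈ ordIdeal n R k ↔ ∀ s : Fin n →₀ ℕ, s.degree < k → coeff s f = 0 := Iff.rfl

theorem mem_ordIdeal_one {f : MvPowerSeries (Fin n) R} :
    f ∈ ordIdeal n R 1 ↔ constantCoeff f = 0 := by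
  rw [mem_ordIdeal]
  refine ⟨fun h => h 0 (by simp), fun h s hs => ?_⟩
  obtain rfl : s = 0 := by
    rw [Nat.lt_one_iff, Finsupp.degree_eq_zero_iff] at hs; exact hs
  exact h

theorem ordIdeal_anti {k l : ℕ} (h : k ≤ l) : ordIdeal n R l ≤ ordIdeal n R k :=
  fun _ hf s hs => hf s (hs.trans_le h)

theorem mem_ordIdeal_zero (f : MvPowerSeries (Fin n) R) : f ∈ ordIdeal n R 0 :=
  fun _ hs => absurd hs (Nat.not_lt_zero _)

theorem mul_mem_ordIdeal {k l : ℕ} {f g : MvPowerSeries (Fin n) R} (hf : f ∈ ordIdeal n R k)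
    (hg : g ∈ ordIdeal n R l) : f * g ∈ ordIdeal n R (k + l) := by
  classical
  intro s hs
  rw [coeff_mul]
  refine Finset.sum_eq_zero fun p hp => ?_
  rw [← Finset.HasAntidiagonal.mem_antidiagonal.1 hp, map_add] at hs
  rcases lt_or_ge p.1.degree k with h | h
  · rw [hf _ h, zero_mul]
  · rw [hg _ (by omega), mul_zero]

theorem X_mem_ordIdeal (i : Fin n) : (X i : MvPowerSeries (Fin n) R) ∈ ordIdeal n R 1 :=
  mem_ordIdeal_one.2 (constantCoeff_X i)

theorem eq_zero_of_forall_mem_ordIdeal {f : MvPowerSeries (Fin n) R}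
    (h : ∀ k, f ∈ ordIdeal n R k) : f = 0 := by
  ext s
  exact h (s.degree + 1) s (Nat.lt_succ_self _)

/-- A power series of order at least `k + 1` is a combination of the variables with coefficients
of order at least `k`. -/
theorem exists_eq_sum_X_mul {k : ℕ} {f : MvPowerSeries (Fin n) R} (hf : f ∈ ordIdeal n R (k + 1)) :
    ∃ g : Fin n → MvPowerSeries (Fin n) R, (∀ i, g i ∈ ordIdeal n R k) ∧ f = ∑ i, X i * g i := by
  classical
  -- Each monomial is assigned to the first variable that occurs in it, so that no monomial is
  -- counted twice in the sum.
  let P (s : Fin n →₀ ℕ) (i : Fin n) : Prop := s i ≠ 0 ∧ ∀ j < i, s j = 0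
  let g (i : Fin n) : MvPowerSeries (Fin n) R := fun s =>
    if P (s + Finsupp.single i 1) i then coeff (s + Finsupp.single i 1) f else 0
  have hg (i s) : coeff s (g i) =
      if P (s + Finsupp.single i 1) i then coeff (s + Finsupp.single i 1) f else 0 := rfl
  refine ⟨g, fun i s hs => ?_, ?_⟩
  · rw [hg]
    split_ifs
    · exact hf _ (by rw [map_add, Finsupp.degree_single]; omega)
    · rfl
  · ext s
    have hX (i : Fin n) : coeff s (X i * g i) = if P s i then coeff s f else 0 := by
      rw [X, coeff_monomial_mul]
      by_cases hi : s i = 0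
      · rw [if_neg, if_neg (fun h => h.1 hi)]
        intro h
        have := h i
        rw [Finsupp.single_eq_same] at this
        omega
      · have hle : Finsupp.single i 1 ≤ s := Finsupp.single_le_iff.2 (Nat.one_le_iff_ne_zero.2 hi)
        rw [if_pos hle, one_mul, hg, tsub_add_cancel_of_le hle]
    rw [map_sum]
    simp_rw [hX]
    by_cases hs : s = 0
    · rw [hf s (by rw [hs, map_zero]; omega)]
      simp
    · obtain ⟨i₀, hi₀⟩ := Finsupp.ne_iff.1 hs
      have hne : (Finset.univ.filter fun i => s i ≠ 0).Nonempty := ⟨i₀, by simpa using hi₀⟩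
      set i := (Finset.univ.filter fun i => s i ≠ 0).min' hne with hi
      have hmem := Finset.min'_mem _ hne
      rw [← hi, Finset.mem_filter] at hmem
      have hP : P s i := ⟨hmem.2, fun j hj => by
        by_contra hj'
        exact absurd (Finset.min'_le (Finset.univ.filter fun i => s i ≠ 0) j (by simp [hj']))
          (not_le.2 hj)⟩
      rw [Finset.sum_eq_single i, if_pos hP]
      · intro j _ hj
        refine if_neg fun hPj => ?_
        rcases lt_or_gt_of_ne hj with h | h
        · exact hPj.1 (hP.2 j h)
        · exact hP.1 (hPj.2 i h)
      · simp

theorem sub_truncTotal_mem_ordIdeal (k : ℕ) (f : MvPowerSeries (Fin n) R) :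
    f - (truncTotal k f : MvPolynomial (Fin n) R) ∈ ordIdeal n R k := fun s hs => by
  rw [map_sub, MvPolynomial.coeff_coe, coeff_truncTotal _ hs, sub_self]

/-- A homomorphism which maps the variables to power series without constant term is
continuous. -/
theorem ringHom_mem_ordIdeal {α : MvPowerSeries (Fin n) R →+* MvPowerSeries (Fin n) S}
    (hα : ∀ i, constantCoeff (α (X i)) = 0) {k : ℕ} {f : MvPowerSeries (Fin n) R}
    (hf : f ∈ ordIdeal n R k) : α f ∈ ordIdeal n S k := by
  induction k generalizing f with
  | zero => exact mem_ordIdeal_zero _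
  | succ k ih =>
    obtain ⟨g, hg, rfl⟩ := exists_eq_sum_X_mul hf
    rw [map_sum]
    refine Ideal.sum_mem _ fun i _ => ?_
    rw [map_mul, add_comm]
    exact mul_mem_ordIdeal (mem_ordIdeal_one.2 (hα i)) (ih (hg i))

/-- Two homomorphisms which agree on constants and variables, and map the variables to power series
without constant term, are equal. -/
theorem ringHom_ext {α β : MvPowerSeries (Fin n) R →+* MvPowerSeries (Fin n) S}
    (hα : ∀ i, constantCoeff (α (X i)) = 0) (hC : ∀ r, α (C r) = β (C r))
    (hX : ∀ i, α (X i) = β (X i)) : α = β := by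
  have hβ : ∀ i, constantCoeff (β (X i)) = 0 := fun i => by rw [← hX, hα]
  have hpol : α.comp MvPolynomial.coeToMvPowerSeries.ringHom =
      β.comp MvPolynomial.coeToMvPowerSeries.ringHom := by
    refine MvPolynomial.ringHom_ext (fun r => ?_) fun i => ?_
    · simpa using hC r
    · simpa using hX i
  ext1 f
  refine sub_eq_zero.1 (eq_zero_of_forall_mem_ordIdeal fun k => ?_)
  have hp := RingHom.congr_fun hpol (truncTotal k f)
  simp only [RingHom.comp_apply, MvPolynomial.coeToMvPowerSeries.ringHom_apply] at hp
  -- The maps agree on the polynomial truncation of `f`, so their difference only sees the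
  -- remainder, which has order at least `k` for arbitrary `k`.
  have e : α f - β f = α (f - (truncTotal k f : MvPolynomial (Fin n) R)) -
      β (f - (truncTotal k f : MvPolynomial (Fin n) R)) := by
    rw [map_sub, map_sub, hp]; abel
  rw [e]
  exact sub_mem (ringHom_mem_ordIdeal hα (sub_truncTotal_mem_ordIdeal k f))
    (ringHom_mem_ordIdeal hβ (sub_truncTotal_mem_ordIdeal k f))

/-- A derivation along a continuous homomorphism lowers the order at most by one. -/
theorem leibniz_mem_ordIdeal {α : MvPowerSeries (Fin n) R →+* MvPowerSeries (Fin n) S}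
    (hα : ∀ i, constantCoeff (α (X i)) = 0)
    (D : MvPowerSeries (Fin n) R →+ MvPowerSeries (Fin n) S)
    (hD : ∀ f g, D (f * g) = α f * D g + α g * D f)
    {k : ℕ} {f : MvPowerSeries (Fin n) R}
    (hf : f ∈ ordIdeal n R (k + 1)) : D f ∈ ordIdeal n S k := by
  induction k generalizing f with
  | zero => exact mem_ordIdeal_zero _
  | succ k ih =>
    obtain ⟨g, hg, rfl⟩ := exists_eq_sum_X_mul hf
    rw [map_sum]
    refine Ideal.sum_mem _ fun i _ => ?_
    rw [hD]
    refine add_mem ?_ (Ideal.mul_mem_right _ _ (ringHom_mem_ordIdeal hα (hg i)))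
    rw [add_comm]
    exact mul_mem_ordIdeal (mem_ordIdeal_one.2 (hα i)) (ih (hg i))

/-- The Leibniz rule gives the vanishing on polynomials. Since `D` lowers the order by at most one,
the truncation at order `k + 1` leaves a value of order at least `k`, for all `k`. -/
theorem leibniz_eq_zero {α : MvPowerSeries (Fin n) R →+* MvPowerSeries (Fin n) S}
    (hα : ∀ i, constantCoeff (α (X i)) = 0)
    (D : MvPowerSeries (Fin n) R →+ MvPowerSeries (Fin n) S)
    (hD : ∀ f g, D (f * g) = α f * D g + α g * D f)
    (hC : ∀ r, D (C r) = 0) (hX : ∀ i, D (X i) = 0)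
    (f : MvPowerSeries (Fin n) R) : D f = 0 := by
  have hpol : ∀ p : MvPolynomial (Fin n) R, D (p : MvPowerSeries (Fin n) R) = 0 := fun p => by
    induction p using MvPolynomial.induction_on with
    | C r => simpa using hC r
    | add p q hp hq => rw [MvPolynomial.coe_add, map_add, hp, hq, add_zero]
    | mul_X p i hp => rw [MvPolynomial.coe_mul, hD, hp, MvPolynomial.coe_X, hX]; simp
  refine eq_zero_of_forall_mem_ordIdeal fun k => ?_
  have e : D f = D (f - (truncTotal (k + 1) f : MvPolynomial (Fin n) R)) := by
    rw [map_sub, hpol, sub_zero]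
  rw [e]
  exact leibniz_mem_ordIdeal hα D hD (sub_truncTotal_mem_ordIdeal _ f)

/-- Subtracting the right-hand side from `D` leaves an `α`-derivation that kills constants and
variables. With `α` the identity this expands a derivation in the partial derivatives; with `α` a
substitution it is the chain rule. -/
theorem leibniz_eq_sum {α : MvPowerSeries (Fin n) R →+* MvPowerSeries (Fin n) S}
    (hα : ∀ i, constantCoeff (α (X i)) = 0)
    (D : MvPowerSeries (Fin n) R →+ MvPowerSeries (Fin n) S)
    (hD : ∀ f g, D (f * g) = α f * D g + α g * D f)
    (hC : ∀ r, D (C r) = 0) (f : MvPowerSeries (Fin n) R) :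
    D f = ∑ i, D (X i) * α (pderiv R i f) := by
  let D' : MvPowerSeries (Fin n) R →+ MvPowerSeries (Fin n) S :=
    D - ∑ i, (AddMonoidHom.mulLeft (D (X i))).comp
      (α.toAddMonoidHom.comp (pderiv R i).toLinearMap.toAddMonoidHom)
  have hD' (f) : D' f = D f - ∑ i, D (X i) * α (pderiv R i f) := by
    simp [D', AddMonoidHom.finsetSum_apply]
  refine sub_eq_zero.1 ((hD' f).symm.trans (leibniz_eq_zero hα D' (fun f g => ?_) (fun r => ?_)
    (fun j => ?_) f))
  · simp only [hD', hD, Derivation.leibniz, smul_eq_mul, map_add, map_mul, mul_add,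
      Finset.sum_add_distrib, mul_sub, Finset.mul_sum]
    simp only [mul_left_comm]
    ring
  · simp [hD', hC]
  · classical
    simp [hD', pderiv_X, Pi.single_apply, apply_ite α]

theorem pderiv_mem_ordIdeal {k : ℕ} (i : Fin n) {f : MvPowerSeries (Fin n) R}
    (hf : f ∈ ordIdeal n R (k + 1)) : pderiv R i f ∈ ordIdeal n R k := fun s hs => by
  rw [coeff_pderiv, hf _ (by rw [map_add, Finsupp.degree_single]; omega), zero_mul]

section Derivation

variable (D D' : Derivation R (MvPowerSeries (Fin n) R) (MvPowerSeries (Fin n) R))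

theorem derivation_eq_sum (f : MvPowerSeries (Fin n) R) : D f = ∑ i, D (X i) * pderiv R i f :=
  leibniz_eq_sum (α := RingHom.id _) (fun i => constantCoeff_X i) D.toLinearMap.toAddMonoidHom
    (fun f g => D.leibniz f g) (fun r => D.map_algebraMap r) f

variable {D D'} in
theorem derivation_ext (h : ∀ i, D (X i) = D' (X i)) : D = D' := by
  ext1 f
  rw [derivation_eq_sum D, derivation_eq_sum D']
  simp only [h]

variable {D} in
theorem derivation_mem_ordIdeal {k l : ℕ} (h : ∀ i, D (X i) ∈ ordIdeal n R l)
    {f : MvPowerSeries (Fin n) R} (hf : f ∈ ordIdeal n R (k + 1)) : D f ∈ ordIdeal n R (l + k) := by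
  rw [derivation_eq_sum D]
  exact Ideal.sum_mem _ fun i _ => mul_mem_ordIdeal (h i) (pderiv_mem_ordIdeal i hf)

variable {D} in
theorem derivation_mem_ordIdeal' {k : ℕ} (h : ∀ i, constantCoeff (D (X i)) = 0)
    {f : MvPowerSeries (Fin n) R} (hf : f ∈ ordIdeal n R k) : D f ∈ ordIdeal n R k := by
  cases k with
  | zero => exact mem_ordIdeal_zero _
  | succ k =>
    rw [add_comm]
    exact derivation_mem_ordIdeal (fun i => mem_ordIdeal_one.2 (h i)) hf

/-- The derivation with prescribed values on the variables. -/
def vecField (v : Fin n → MvPowerSeries (Fin n) R) :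
    Derivation R (MvPowerSeries (Fin n) R) (MvPowerSeries (Fin n) R) :=
  ∑ i, v i • pderiv R i

theorem vecField_apply (v : Fin n → MvPowerSeries (Fin n) R) (f : MvPowerSeries (Fin n) R) :
    vecField v f = ∑ i, v i * pderiv R i f := by
  rw [vecField, ← Derivation.coeFnAddMonoidHom_apply, map_sum, Finset.sum_apply]
  rfl

@[simp]
theorem vecField_X (v : Fin n → MvPowerSeries (Fin n) R) (i : Fin n) : vecField v (X i) = v i := by
  classical
  simp [vecField_apply, pderiv_X, Pi.single_apply]

end Derivation

theorem pderiv_map (h : R →+* S) (i : Fin n) (f : MvPowerSeries (Fin n) R) :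
    pderiv S i (MvPowerSeries.map h f) = MvPowerSeries.map h (pderiv R i f) := by
  ext s
  simp [coeff_pderiv]

theorem derivation_map (h : R →+* S)
    {D : Derivation R (MvPowerSeries (Fin n) R) (MvPowerSeries (Fin n) R)}
    {D' : Derivation S (MvPowerSeries (Fin n) S) (MvPowerSeries (Fin n) S)}
    (hD : ∀ i, D' (X i) = MvPowerSeries.map h (D (X i))) (f : MvPowerSeries (Fin n) R) :
    D' (MvPowerSeries.map h f) = MvPowerSeries.map h (D f) := by
  rw [derivation_eq_sum D, derivation_eq_sum D', map_sum]
  simp only [hD, pderiv_map, map_mul]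

/-! ### Substitutions, automorphisms, base change and conjugation. -/

section Substitution

/-- The endomorphism with prescribed values on the variables. -/
def substHom (F : Fin n → MvPowerSeries (Fin n) R) (hF : ∀ i, constantCoeff (F i) = 0) :
    MvPowerSeries (Fin n) R →ₐ[R] MvPowerSeries (Fin n) R :=
  substAlgHom (hasSubst_of_constantCoeff_zero hF)

@[simp]
theorem substHom_X (F : Fin n → MvPowerSeries (Fin n) R) (hF : ∀ i, constantCoeff (F i) = 0)
    (i : Fin n) : substHom F hF (X i) = F i := substAlgHom_X _ i

theorem constantCoeff_algHom (α : MvPowerSeries (Fin n) R →ₐ[R] MvPowerSeries (Fin n) R)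
    (hα : ∀ i, constantCoeff (α (X i)) = 0) (f : MvPowerSeries (Fin n) R) :
    constantCoeff (α f) = constantCoeff f := by
  have h : f - C (constantCoeff f) ∈ ordIdeal n R 1 := mem_ordIdeal_one.2 (by simp)
  have h' := mem_ordIdeal_one.1 (ringHom_mem_ordIdeal (α := α.toRingHom) hα h)
  have hC : α (C (constantCoeff f)) = C (constantCoeff f) := α.commutes _
  have h'' : constantCoeff (α (f - C (constantCoeff f))) = 0 := h'
  rw [map_sub, hC, map_sub, constantCoeff_C, sub_eq_zero] at h''
  exact h''

theorem algHom_ext_X {α β : MvPowerSeries (Fin n) R →ₐ[R] MvPowerSeries (Fin n) R}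
    (hα : ∀ i, constantCoeff (α (X i)) = 0) (hX : ∀ i, α (X i) = β (X i)) : α = β := by
  have := ringHom_ext (α := α.toRingHom) (β := β.toRingHom) hα
    (fun r => (α.commutes r).trans (β.commutes r).symm) hX
  exact AlgHom.ext fun f => RingHom.congr_fun this f

namespace PowAut

theorem constCoeff_X (φ : PowAut n R) (i : Fin n) : constantCoeff (φ.1 (X i)) = 0 :=
  (φ.2 _).trans (constantCoeff_X i)

theorem apply_C (φ : PowAut n R) (r : R) : φ.1 (C r) = C r := φ.1.commutes r

theorem mem_ordIdeal (φ : PowAut n R) {k : ℕ} {f : MvPowerSeries (Fin n) R}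
    (hf : f ∈ ordIdeal n R k) : φ.1 f ∈ ordIdeal n R k :=
  ringHom_mem_ordIdeal (α := (φ.1 : MvPowerSeries (Fin n) R →+* MvPowerSeries (Fin n) R))
    (constCoeff_X φ) hf

theorem ext_X {φ ψ : PowAut n R} (h : ∀ i, φ.1 (X i) = ψ.1 (X i)) : φ = ψ := by
  have := algHom_ext_X (α := φ.1.toAlgHom) (β := ψ.1.toAlgHom) (constCoeff_X φ) h
  exact Subtype.ext (AlgEquiv.ext fun f => AlgHom.congr_fun this f)

theorem mul_apply (φ ψ : PowAut n R) (f : MvPowerSeries (Fin n) R) :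
    (φ * ψ).1 f = φ.1 (ψ.1 f) := rfl

theorem one_apply (f : MvPowerSeries (Fin n) R) : (1 : PowAut n R).1 f = f := rfl

theorem inv_apply_apply (φ : PowAut n R) (f : MvPowerSeries (Fin n) R) :
    (φ⁻¹).1 (φ.1 f) = f := by rw [← mul_apply, inv_mul_cancel, one_apply]

theorem apply_inv_apply (φ : PowAut n R) (f : MvPowerSeries (Fin n) R) :
    φ.1 ((φ⁻¹).1 f) = f := by rw [← mul_apply, mul_inv_cancel, one_apply]

/-- The automorphism with prescribed values on the variables, given an inverse substitution. -/
def ofSubst (F G : Fin n → MvPowerSeries (Fin n) R) (hF : ∀ i, constantCoeff (F i) = 0)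
    (hG : ∀ i, constantCoeff (G i) = 0) (hFG : ∀ i, substHom F hF (G i) = X i)
    (hGF : ∀ i, substHom G hG (F i) = X i) : PowAut n R :=
  ⟨AlgEquiv.ofAlgHom (substHom F hF) (substHom G hG)
    (algHom_ext_X (fun i => by simp [hFG]) fun i => by simp [hFG])
    (algHom_ext_X (fun i => by simp [hGF]) fun i => by simp [hGF]),
    fun f => constantCoeff_algHom (substHom F hF) (fun i => by simp [hF]) f⟩

@[simp]
theorem ofSubst_X (F G : Fin n → MvPowerSeries (Fin n) R) (hF hG hFG hGF) (i : Fin n) :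
    (ofSubst F G hF hG hFG hGF).1 (X i) = F i := substHom_X F hF i

theorem map_apply {h : R →+* S} {φ : PowAut n R} {ψ : PowAut n S}
    (hψ : ∀ i, ψ.1 (X i) = MvPowerSeries.map h (φ.1 (X i))) (f : MvPowerSeries (Fin n) R) :
    ψ.1 (MvPowerSeries.map h f) = MvPowerSeries.map h (φ.1 f) := by
  have := ringHom_ext (α := (ψ.1 : MvPowerSeries (Fin n) S →+* _).comp (MvPowerSeries.map h))
    (β := (MvPowerSeries.map h).comp (φ.1 : MvPowerSeries (Fin n) R →+* _))
    (fun i => by simpa using constCoeff_X ψ i) (fun r => ?_) (fun i => by simpa using hψ i)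
  · exact RingHom.congr_fun this f
  · simp only [RingHom.comp_apply, map_C, RingHom.coe_coe, apply_C]

theorem substHom_map (h : R →+* S) (F : Fin n → MvPowerSeries (Fin n) R)
    (hF : ∀ i, constantCoeff (F i) = 0) (hF' : ∀ i, constantCoeff (MvPowerSeries.map h (F i)) = 0)
    (f : MvPowerSeries (Fin n) R) :
    substHom (fun i => MvPowerSeries.map h (F i)) hF' (MvPowerSeries.map h f) =
      MvPowerSeries.map h (substHom F hF f) := by
  have := ringHom_ext
    (α := (substHom (fun i => MvPowerSeries.map h (F i)) hF').toRingHom.comp (MvPowerSeries.map h))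
    (β := (MvPowerSeries.map h).comp (substHom F hF).toRingHom)
    (fun i => by simpa using hF' i) (fun r => ?_) (fun i => by simp)
  · exact RingHom.congr_fun this f
  · simp only [RingHom.comp_apply, map_C]
    exact ((substHom (fun i => MvPowerSeries.map h (F i)) hF').commutes (h r)).trans
      ((map_C h r).symm.trans (congrArg _ ((substHom F hF).commutes r).symm))

theorem eq_substHom (φ : PowAut n R) (f : MvPowerSeries (Fin n) R) :
    φ.1 f = substHom (fun i => φ.1 (X i)) (constCoeff_X φ) f :=
  AlgHom.congr_fun (algHom_ext_X (α := φ.1.toAlgHom) (constCoeff_X φ) fun i => by simp) f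

/-- The base change of an automorphism. -/
def baseChange (h : R →+* S) (φ : PowAut n R) : PowAut n S :=
  ofSubst (fun i => MvPowerSeries.map h (φ.1 (X i))) (fun i => MvPowerSeries.map h ((φ⁻¹).1 (X i)))
    (fun i => by rw [constantCoeff_map, (constCoeff_X φ), map_zero])
    (fun i => by rw [constantCoeff_map, (constCoeff_X φ⁻¹), map_zero])
    (fun i => by rw [substHom_map h _ (constCoeff_X φ), ← eq_substHom, apply_inv_apply, map_X])
    (fun i => by
      rw [substHom_map h _ (constCoeff_X φ⁻¹), ← eq_substHom, inv_apply_apply, map_X])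

@[simp]
theorem baseChange_X (h : R →+* S) (φ : PowAut n R) (i : Fin n) :
    (baseChange h φ).1 (X i) = MvPowerSeries.map h (φ.1 (X i)) := ofSubst_X _ _ _ _ _ _ i

theorem baseChange_map (h : R →+* S) (φ : PowAut n R) (f : MvPowerSeries (Fin n) R) :
    (baseChange h φ).1 (MvPowerSeries.map h f) = MvPowerSeries.map h (φ.1 f) :=
  map_apply (baseChange_X h φ) f

/-- Conjugation of derivations by an automorphism. -/
def conj (φ : PowAut n R) (D : Derivation R (MvPowerSeries (Fin n) R) (MvPowerSeries (Fin n) R)) :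
    Derivation R (MvPowerSeries (Fin n) R) (MvPowerSeries (Fin n) R) :=
  Derivation.mk' (φ.1.toLinearMap ∘ₗ D.toLinearMap ∘ₗ (φ⁻¹).1.toLinearMap) fun f g => by
    simp only [LinearMap.comp_apply, AlgEquiv.toLinearMap_apply, map_mul,
      Derivation.coeFn_coe, Derivation.leibniz, smul_eq_mul, map_add,
      apply_inv_apply]

theorem conj_apply (φ : PowAut n R)
    (D : Derivation R (MvPowerSeries (Fin n) R) (MvPowerSeries (Fin n) R))
    (f : MvPowerSeries (Fin n) R) : conj φ D f = φ.1 (D ((φ⁻¹).1 f)) := rfl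

end PowAut

end Substitution

end PowerSeriesTools

/-! ### The Euler derivation and the bound on weights. -/

section LPlusModule

open MvPowerSeries

variable {n : ℕ}

/-- The derivations of `R[[X₁, …, Xₙ]]`. -/
abbrev PowDer (n : ℕ) (R : Type*) [CommRing R] : Type _ :=
  Derivation R (MvPowerSeries (Fin n) R) (MvPowerSeries (Fin n) R)

/-- The multi-indices of total degree `k`. -/
def degSet (n k : ℕ) : Finset (Fin n →₀ ℕ) := (Finsupp.finite_of_degree_le k).toFinset.filter
  (fun s => s.degree = k)

@[simp]
theorem mem_degSet {k : ℕ} {s : Fin n →₀ ℕ} : s ∈ degSet n k ↔ s.degree = k := by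
  simp only [degSet, Finset.mem_filter, Set.Finite.mem_toFinset, Set.mem_ofPred_eq]
  exact ⟨fun h => h.2, fun h => ⟨h.le, h⟩⟩

section General

variable {R : Type*} [CommRing R]

/-- Power series all of whose terms have total degree `k`. -/
def IsHomog (f : MvPowerSeries (Fin n) R) (k : ℕ) : Prop :=
  ∀ s : Fin n →₀ ℕ, s.degree ≠ k → coeff s f = 0

theorem IsHomog.mul {f g : MvPowerSeries (Fin n) R} {k l : ℕ} (hf : IsHomog f k)
    (hg : IsHomog g l) : IsHomog (f * g) (k + l) := fun s hs => by
  classical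
  rw [coeff_mul]
  refine Finset.sum_eq_zero fun p hp => ?_
  rw [← Finset.HasAntidiagonal.mem_antidiagonal.1 hp, map_add] at hs
  by_cases h : p.1.degree = k
  · rw [hg p.2 (by omega), mul_zero]
  · rw [hf p.1 h, zero_mul]

/-- The derivation `X^s ∂/∂X_i` of `R[[X]]`. -/
def monDer (R : Type*) [CommRing R] (s : Fin n →₀ ℕ) (i : Fin n) : PowDer n R :=
  monomial s (1 : R) • pderiv R i

theorem monDer_X (s : Fin n →₀ ℕ) (i j : Fin n) :
    monDer R s i (X j) = if i = j then monomial s 1 else 0 := by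
  classical
  rw [monDer, Derivation.smul_apply, pderiv_X, Pi.single_apply, smul_eq_mul]
  split_ifs <;> simp_all

theorem monDer_X_map {S : Type*} [CommRing S] (h : R →+* S) (s : Fin n →₀ ℕ) (i j : Fin n) :
    monDer S s i (X j) = MvPowerSeries.map h (monDer R s i (X j)) := by
  rw [monDer_X, monDer_X]
  split_ifs <;> simp

theorem coeff_monDer_X (s t : Fin n →₀ ℕ) (i j : Fin n) [Decidable (t = s ∧ i = j)] :
    coeff t (monDer R s i (X j)) = if t = s ∧ i = j then 1 else 0 := by
  classical
  rw [monDer_X]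
  by_cases h : i = j
  · rw [if_pos h, coeff_monomial]; simp [h]
  · simp [h]

variable {D D' : PowDer n R}

theorem isHomog_derivation {a b : ℕ} (hD : ∀ i, IsHomog (D (X i)) (a + 1))
    {f : MvPowerSeries (Fin n) R} (hf : IsHomog f (b + 1)) : IsHomog (D f) (a + b + 1) := by
  intro s hs
  rw [derivation_eq_sum D, map_sum]
  refine Finset.sum_eq_zero fun i _ => ?_
  have h : IsHomog (pderiv R i f) b := fun t ht => by
    rw [coeff_pderiv, hf, zero_mul]
    rw [map_add, Finsupp.degree_single]; omega
  exact ((hD i).mul h) s (by omega)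

theorem isHomog_lie {a b : ℕ} (hD : ∀ i, IsHomog (D (X i)) (a + 1))
    (hD' : ∀ i, IsHomog (D' (X i)) (b + 1)) (i : Fin n) :
    IsHomog (⁅D, D'⁆ (X i)) (a + b + 1) := by
  have h1 := isHomog_derivation hD (hD' i)
  have h2 := isHomog_derivation hD' (hD i)
  rw [add_comm b a] at h2
  intro s hs
  rw [Derivation.commutator_apply, map_sub, h1 s hs, h2 s hs, sub_zero]

theorem isHomog_monDer {s : Fin n →₀ ℕ} {k : ℕ} (hs : s.degree = k) (i j : Fin n) :
    IsHomog (monDer R s i (X j)) k := by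
  classical
  intro t ht
  rw [coeff_monDer_X, if_neg]
  rintro ⟨rfl, -⟩
  exact ht hs

variable (D) in
/-- The part of a derivation that consists of terms `X^s ∂/∂X_i` with `1 ≤ |s| ≤ k`. -/
def truncDer (k : ℕ) : PowDer n R :=
  ∑ l ∈ Finset.range k, ∑ i, ∑ s ∈ degSet n (l + 1), coeff s (D (X i)) • monDer R s i

theorem derivation_sum_apply {ι : Type*} (t : Finset ι) (F : ι → PowDer n R)
    (f : MvPowerSeries (Fin n) R) : (∑ a ∈ t, F a) f = ∑ a ∈ t, F a f := by
  rw [← Derivation.coeFnAddMonoidHom_apply, map_sum, Finset.sum_apply]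
  rfl

theorem coeff_truncDer (k : ℕ) (t : Fin n →₀ ℕ) (j : Fin n) :
    coeff t (truncDer D k (X j)) =
      if t.degree ∈ Finset.Icc 1 k then coeff t (D (X j)) else 0 := by
  classical
  simp only [truncDer, derivation_sum_apply, map_sum, Derivation.smul_apply, coeff_smul,
    coeff_monDer_X]
  have h (l : ℕ) : ∑ i, ∑ s ∈ degSet n (l + 1),
      coeff s (D (X i)) * (if t = s ∧ i = j then 1 else 0) =
      if l + 1 = t.degree then coeff t (D (X j)) else 0 := by
    rw [Finset.sum_eq_single j]
    · by_cases ht : l + 1 = t.degree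
      · rw [if_pos ht, Finset.sum_eq_single t]
        · simp
        · intro s _ hs; simp [hs.symm]
        · intro hs; exact absurd (mem_degSet.2 ht.symm) hs
      · rw [if_neg ht]
        refine Finset.sum_eq_zero fun s hs => ?_
        rw [if_neg, mul_zero]
        rintro ⟨rfl, -⟩
        exact ht (mem_degSet.1 hs).symm
    · intro i _ hi; simp [hi]
    · simp
  simp only [h]
  split_ifs with ht
  · rw [Finset.mem_Icc] at ht
    rw [Finset.sum_eq_single (t.degree - 1), if_pos (by omega)]
    · intro l _ hl; exact if_neg (by omega)
    · intro hl; simp only [Finset.mem_range] at hl; omega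
  · refine Finset.sum_eq_zero fun l hl => if_neg fun h => ht ?_
    simp only [Finset.mem_range, Finset.mem_Icc] at hl ⊢
    omega

theorem sub_truncDer_mem (hD : ∀ i, constantCoeff (D (X i)) = 0) (k : ℕ) (i : Fin n) :
    (D - truncDer D k) (X i) ∈ ordIdeal n R (k + 1) := fun s hs => by
  rw [Derivation.sub_apply, map_sub, coeff_truncDer]
  split_ifs with h
  · exact sub_self _
  · have : s.degree = 0 := by simp only [Finset.mem_Icc] at h; omega
    rw [Finsupp.degree_eq_zero_iff] at this
    rw [this, sub_zero]
    exact hD i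

theorem lie_mem_ordIdeal {k : ℕ} (hD : ∀ i, D (X i) ∈ ordIdeal n R (k + 1))
    (hD' : ∀ i, constantCoeff (D' (X i)) = 0) (i : Fin n) :
    ⁅D, D'⁆ (X i) ∈ ordIdeal n R (k + 1) := by
  rw [Derivation.commutator_apply]
  refine sub_mem ?_ (derivation_mem_ordIdeal' hD' (hD i))
  have := derivation_mem_ordIdeal (k := 0) hD (mem_ordIdeal_one.2 (hD' i))
  simpa using this

variable (n R) in
/-- The Euler derivation `∑ X_i ∂/∂X_i`. -/
def eulerDer : PowDer n R := vecField X

theorem eulerDer_X (i : Fin n) : eulerDer n R (X i) = X i := vecField_X _ _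

theorem coeff_eulerDer (f : MvPowerSeries (Fin n) R) (s : Fin n →₀ ℕ) :
    coeff s (eulerDer n R f) = (s.degree : R) * coeff s f := by
  classical
  rw [eulerDer, vecField_apply, map_sum]
  have h (i : Fin n) : coeff s (X i * pderiv R i f) = (s i : R) * coeff s f := by
    rw [X, coeff_monomial_mul]
    by_cases hi : s i = 0
    · rw [if_neg, hi, Nat.cast_zero, zero_mul]
      intro h
      have := h i
      rw [Finsupp.single_eq_same] at this
      omega
    · have hle : Finsupp.single i 1 ≤ s := Finsupp.single_le_iff.2 (Nat.one_le_iff_ne_zero.2 hi)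
      rw [if_pos hle, one_mul, coeff_pderiv, tsub_add_cancel_of_le hle, mul_comm]
      congr 1
      rw [Finsupp.tsub_apply, Finsupp.single_eq_same]
      have : s i = (s i - 1) + 1 := by omega
      rw [this]; push_cast; simp
  simp only [h]
  rw [← Finset.sum_mul, ← Nat.cast_sum, Finsupp.degree_eq_sum]

/-- The component of degree `|s|` of a derivation has weight `|s| - 1` under the commutator with the
Euler derivation. This grading is the source of all finiteness statements. -/
theorem coeff_lie_eulerDer (D : PowDer n R) (i : Fin n) (s : Fin n →₀ ℕ) :
    coeff s (⁅eulerDer n R, D⁆ (X i)) = ((s.degree : R) - 1) * coeff s (D (X i)) := by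
  rw [Derivation.commutator_apply, map_sub, coeff_eulerDer, eulerDer_X, sub_mul, one_mul]

end General

section Module

variable (K : Type*) [Field K]

theorem LPlus.constantCoeff_X (D : LPlus K n) (i : Fin n) : constantCoeff (D.1 (X i)) = 0 := D.2 _

variable {K} in
/-- A derivation with `D(X_i)` of positive order, as an element of `L̂₊`. -/
def LPlus.mk (D : PowDer n K) (hD : ∀ i, constantCoeff (D (X i)) = 0) : LPlus K n :=
  ⟨D, fun f => by
    rw [derivation_eq_sum D, map_sum]
    exact Finset.sum_eq_zero fun i _ => by rw [map_mul, hD i, zero_mul]⟩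

variable {W : Type*} [AddCommGroup W] [Module K W] [LieRingModule (LPlus K n) W]
  [LieModule K (LPlus K n) W]

theorem constantCoeff_eulerDer (R : Type*) [CommRing R] (i : Fin n) :
    constantCoeff (eulerDer n R (X i)) = 0 := by
  rw [eulerDer_X, MvPowerSeries.constantCoeff_X]

variable (n W) in
/-- The action of `L̂₊` on `W`. -/
def actEnd : LPlus K n →ₗ[K] Module.End K W := (LieModule.toEnd K (LPlus K n) W : _ →ₗ[K] _)

theorem actEnd_apply (D : LPlus K n) (w : W) : actEnd n K W D w = ⁅D, w⁆ := rfl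

theorem actEnd_lie (D D' : LPlus K n) : actEnd n K W ⁅D, D'⁆ =
    actEnd n K W D * actEnd n K W D' - actEnd n K W D' * actEnd n K W D := by
  ext w
  simp only [actEnd_apply, LinearMap.sub_apply, Module.End.mul_apply, lie_lie]

variable (n) in
/-- The Euler derivation as an element of `L̂₊`. -/
def LPlus.euler : LPlus K n := LPlus.mk (eulerDer n K) (constantCoeff_eulerDer K)

variable (n W) in
/-- The adjoint action of the Euler derivation on `End W`. -/
def eulerAd  : Module.End K (Module.End K W) :=
  LinearMap.mulLeft K (actEnd n K W (LPlus.euler n K)) -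
    LinearMap.mulRight K (actEnd n K W (LPlus.euler n K))

/-- Transports a polynomial in `ad E` along coefficient functionals, where `ad E` becomes a scalar,
and along the action on `W`, where it becomes `eulerAd`. -/
theorem aeval_intertwine {M N : Type*} [AddCommGroup M] [Module K M] [AddCommGroup N] [Module K N]
    (l : M →ₗ[K] N) (a : Module.End K M) (b : Module.End K N) (h : l ∘ₗ a = b ∘ₗ l)
    (p : Polynomial K) (m : M) : l (Polynomial.aeval a p m) = Polynomial.aeval b p (l m) := by
  induction p using Polynomial.induction_on' generalizing m with
  | add p q hp hq => simp only [map_add, LinearMap.add_apply, hp, hq]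
  | monomial k c =>
    simp only [Polynomial.aeval_monomial, Module.algebraMap_end_eq_smul_id, Module.End.mul_apply,
      LinearMap.smul_apply, LinearMap.id_apply, map_smul]
    congr 1
    induction k generalizing m with
    | zero => simp
    | succ k ih =>
      rw [pow_succ, pow_succ, Module.End.mul_apply, Module.End.mul_apply, ih]
      exact congrArg _ (LinearMap.congr_fun h m)

variable {K} in
/-- Elements of a tensor product over a field are separated by functionals on the left factor. -/
theorem tensor_eq_zero_of_forall_dual {R W : Type*} [AddCommGroup R] [Module K R] [AddCommGroup W]
    [Module K W] {z : R ⊗[K] W} (h : ∀ l : R →ₗ[K] K, TensorProduct.lid K W (l.rTensor W z) = 0) :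
    z = 0 := by
  classical
  let b := Module.Free.chooseBasis K R
  refine (TensorProduct.equivFinsuppOfBasisLeft b).injective ?_
  rw [map_zero]
  ext i
  rw [Finsupp.zero_apply, ← h (b.coord i)]
  clear h
  induction z using TensorProduct.induction_on with
  | zero => simp
  | add x y hx hy => simp only [map_add, Finsupp.add_apply, hx, hy]
  | tmul r w => simp [TensorProduct.equivFinsuppOfBasisLeft_apply_tmul]

variable [Module.Finite K W] [CharZero K]

/-- `End W` is finite-dimensional, so the minimal polynomial is non-zero and has finitely many
roots; in characteristic zero distinct natural numbers stay distinct in `K`. -/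
theorem exists_weightBound : ∃ N : ℕ, ∀ k : ℕ, N ≤ k →
    (minpoly K (eulerAd n K W)).eval (k : K) ≠ 0 := by
  classical
  have hp : minpoly K (eulerAd n K W) ≠ 0 := minpoly.ne_zero (Algebra.IsIntegral.isIntegral _)
  have hfin : {k : ℕ | (minpoly K (eulerAd n K W)).eval (k : K) = 0}.Finite := by
    refine Set.Finite.of_finite_image (f := fun k : ℕ => (k : K))
      ((minpoly K (eulerAd n K W)).roots.toFinset.finite_toSet.subset ?_)
      (Nat.cast_injective.injOn)
    rintro _ ⟨k, hk, rfl⟩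
    simpa [hp] using hk
  obtain ⟨N, hN⟩ := hfin.bddAbove
  exact ⟨N + 1, fun k hk h => absurd (hN h) (by omega)⟩

variable (n W) in
/-- A bound for the weights of the Euler derivation on `End W`. -/
def weightBound : ℕ := (exists_weightBound (n := n) K (W := W)).choose

theorem minpoly_eval_ne_zero {k : ℕ} (hk : weightBound n K W ≤ k) :
    (minpoly K (eulerAd n K W)).eval (k : K) ≠ 0 :=
  (exists_weightBound (n := n) K (W := W)).choose_spec k hk

/-- Derivations of high order act by zero. -/
theorem actEnd_eq_zero {D : LPlus K n}
    (hD : ∀ i, D.1 (X i) ∈ ordIdeal n K (weightBound n K W + 1)) :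
    actEnd n K W D = 0 := by
  set p := minpoly K (eulerAd n K W) with hp
  -- With `p` the minimal polynomial of `eulerAd`, the aim is `D = p(ad E) Z`. The operator `p(ad
  -- E)` multiplies the coefficient at `s` by `p(|s| - 1)`, so `Z` is obtained by division. Where
  -- the denominator might vanish, `|s| ≤ weightBound` and the coefficient of `D` is zero.
  let v (i : Fin n) : MvPowerSeries (Fin n) K := fun s =>
    (p.eval ((s.degree : K) - 1))⁻¹ * coeff s (D.1 (X i))
  have hv (i s) : coeff s (v i) = (p.eval ((s.degree : K) - 1))⁻¹ * coeff s (D.1 (X i)) := rfl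
  let Z : LPlus K n := LPlus.mk (vecField v) fun i => by
    rw [vecField_X, ← coeff_zero_eq_constantCoeff_apply, hv, coeff_zero_eq_constantCoeff_apply,
      LPlus.constantCoeff_X, mul_zero]
  have hZ : Polynomial.aeval (LieAlgebra.ad K (LPlus K n) (LPlus.euler n K)) p Z = D := by
    refine Subtype.ext (derivation_ext fun i => ?_)
    ext s
    let l : LPlus K n →ₗ[K] K :=
      { toFun := fun D => coeff s (D.1 (X i))
        map_add' := fun _ _ => by simp
        map_smul' := fun _ _ => by simp }
    have h1 := aeval_intertwine K l (LieAlgebra.ad K (LPlus K n) (LPlus.euler n K))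
      (algebraMap K (Module.End K K) ((s.degree : K) - 1)) (by
        ext D
        simp only [l, LinearMap.comp_apply, LieAlgebra.ad_apply, LinearMap.coe_mk, AddHom.coe_mk,
          Module.algebraMap_end_apply, smul_eq_mul]
        exact coeff_lie_eulerDer D.1 i s) p Z
    refine h1.trans ?_
    rw [Polynomial.aeval_algebraMap_apply, Module.algebraMap_end_apply, smul_eq_mul]
    change _ * coeff s (vecField v (X i)) = _
    rw [vecField_X, hv, Polynomial.coe_aeval_eq_eval]
    by_cases hs : s.degree < weightBound n K W + 1
    · rw [hD i s hs, mul_zero, mul_zero]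
    · rw [← mul_assoc, mul_inv_cancel₀, one_mul]
      have := minpoly_eval_ne_zero K (n := n) (W := W) (k := s.degree - 1) (by omega)
      rwa [Nat.cast_sub (by omega), Nat.cast_one] at this
  -- The action of `D = p(ad E) Z` is `p(eulerAd)` applied to the action of `Z`, and `p(eulerAd) =
  -- 0`.
  have h2 := aeval_intertwine K (actEnd n K W)
    (LieAlgebra.ad K (LPlus K n) (LPlus.euler n K)) (eulerAd n K W) (by
      ext1 D
      exact actEnd_lie K _ _) p Z
  rw [hZ, hp, minpoly.aeval] at h2
  exact h2

/-- There are no operators of high weight. -/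
theorem eq_zero_of_weight {R : Type*} [CommRing R] [Algebra K R] {k : ℕ}
    (hk : weightBound n K W ≤ k) {A : Module.End R (R ⊗[K] W)}
    (hA : (actEnd n K W (LPlus.euler n K)).baseChange R * A -
      A * (actEnd n K W (LPlus.euler n K)).baseChange R = (k : R) • A) : A = 0 := by
  set e := actEnd n K W (LPlus.euler n K) with he
  -- A functional on `R` turns `A` into an operator `B` on `W` with `[E, B] = k B`. Then `p(k) B =
  -- p(eulerAd) B = 0` while `p(k) ≠ 0`. Such functionals separate the elements of `R ⊗ W`.
  have key (l : R →ₗ[K] K) (w : W) :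
      TensorProduct.lid K W (l.rTensor W (A (1 ⊗ₜ w))) = 0 := by
    let B : Module.End K W := (TensorProduct.lid K W).toLinearMap ∘ₗ l.rTensor W ∘ₗ
      A.restrictScalars K ∘ₗ TensorProduct.mk K R W 1
    have hB (w : W) : B w = TensorProduct.lid K W (l.rTensor W (A (1 ⊗ₜ w))) := rfl
    have hl (z : R ⊗[K] W) : TensorProduct.lid K W (l.rTensor W (e.baseChange R z)) =
        e (TensorProduct.lid K W (l.rTensor W z)) := by
      induction z using TensorProduct.induction_on with
      | zero => simp
      | add x y hx hy => simp only [map_add, hx, hy]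
      | tmul r w => simp
    have hw : eulerAd n K W B = (k : K) • B := by
      ext w
      have h := LinearMap.congr_fun hA (1 ⊗ₜ w)
      simp only [LinearMap.sub_apply, Module.End.mul_apply, LinearMap.baseChange_tmul,
        LinearMap.smul_apply] at h
      have h' := congrArg (fun z => TensorProduct.lid K W (l.rTensor W z)) h
      simp only [map_sub, hl, ← hB] at h'
      have hk' : ((k : R) • A (1 ⊗ₜ[K] w)) = (k : K) • A (1 ⊗ₜ[K] w) := by
        rw [Nat.cast_smul_eq_nsmul, Nat.cast_smul_eq_nsmul]
      rw [hk', map_smul, map_smul, ← hB] at h'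
      exact h'
    have h1 := aeval_intertwine K (LinearMap.toSpanSingleton K _ B)
      (algebraMap K (Module.End K K) (k : K)) (eulerAd n K W) (by
        ext1
        simp [hw]) (minpoly K (eulerAd n K W)) 1
    rw [minpoly.aeval, Polynomial.aeval_algebraMap_apply, Polynomial.coe_aeval_eq_eval] at h1
    simp only [Module.algebraMap_end_apply, smul_eq_mul, mul_one, LinearMap.toSpanSingleton_apply,
      LinearMap.zero_apply, smul_eq_zero, minpoly_eval_ne_zero K hk, false_or] at h1
    rw [← hB, h1, LinearMap.zero_apply]
  refine TensorProduct.AlgebraTensorModule.ext fun r w => ?_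
  have h1 : (r ⊗ₜ[K] w : R ⊗[K] W) = r • (1 ⊗ₜ[K] w) := by
    rw [TensorProduct.smul_tmul', smul_eq_mul, mul_one]
  rw [h1, map_smul, tensor_eq_zero_of_forall_dual fun l => key l w, smul_zero,
    LinearMap.zero_apply]

end Module

end LPlusModule

/-! ### The failure of a graded family of maps to be a Lie homomorphism. -/

section LieDefect

variable {R L A : Type*} [CommRing R] [LieRing L] [LieAlgebra R L] [Ring A] [Algebra R A]

/-- The defect of a sequence of linear maps as a homomorphism of graded Lie algebras. -/
def lieDefect (f : ℕ → L →ₗ[R] A) (k : ℕ) : L →ₗ[R] L →ₗ[R] A :=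
  LinearMap.mk₂ R (fun D D' => f k ⁅D, D'⁆ - ∑ p ∈ Finset.HasAntidiagonal.antidiagonal k,
      (f p.1 D * f p.2 D' - f p.2 D' * f p.1 D))
    (fun D₁ D₂ D' => by
      simp only [add_lie, map_add, add_mul, mul_add, Finset.sum_sub_distrib, Finset.sum_add_distrib]
      abel)
    (fun r D D' => by
      simp only [smul_lie, map_smul, smul_mul_assoc, mul_smul_comm, ← smul_sub, ← Finset.smul_sum])
    (fun D' D₁ D₂ => by
      simp only [lie_add, map_add, add_mul, mul_add, Finset.sum_sub_distrib, Finset.sum_add_distrib]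
      abel)
    (fun r D D' => by
      simp only [lie_smul, map_smul, smul_mul_assoc, mul_smul_comm, ← smul_sub, ← Finset.smul_sum])

theorem lieDefect_apply (f : ℕ → L →ₗ[R] A) (k : ℕ) (D D' : L) : lieDefect f k D D' =
    f k ⁅D, D'⁆ - ∑ p ∈ Finset.HasAntidiagonal.antidiagonal k,
      (f p.1 D * f p.2 D' - f p.2 D' * f p.1 D) := rfl

theorem lieDefect_swap (f : ℕ → L →ₗ[R] A) (k : ℕ) (D D' : L) :
    lieDefect f k D' D = - lieDefect f k D D' := by
  rw [lieDefect_apply, lieDefect_apply, ← lie_skew, map_neg, ← Finset.Nat.sum_antidiagonal_swap]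
  simp only [Prod.fst_swap, Prod.snd_swap, Finset.sum_sub_distrib]
  abel

/-- The sum in the defect is the coefficient of the commutator of generating functions; in one of
the two products the antidiagonal is traversed in the opposite order. -/
theorem lie_eq_of_lieDefect_eq_zero {f : ℕ → L →ₗ[R] A} {D D' : L}
    (h : ∀ k, lieDefect f k D D' = 0) :
    PowerSeries.mk (fun k => f k ⁅D, D'⁆) =
      PowerSeries.mk (fun k => f k D) * PowerSeries.mk (fun k => f k D') -
        PowerSeries.mk (fun k => f k D') * PowerSeries.mk (fun k => f k D) := by
  ext k
  have hk := h k
  rw [lieDefect_apply, sub_eq_zero] at hk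
  rw [PowerSeries.coeff_mk, hk, map_sub, PowerSeries.coeff_mul, PowerSeries.coeff_mul,
    Finset.sum_sub_distrib]
  simp only [PowerSeries.coeff_mk]
  congr 1
  rw [← Finset.Nat.sum_antidiagonal_swap]
  rfl

end LieDefect

/-! ### Operators on `R ⊗ W`. -/

section Operators

variable (K : Type*) [CommRing K] (W : Type*) [AddCommGroup W] [Module K W]
  (R : Type*) [CommRing R] [Algebra K R]

/-- The `R`-algebra of `R`-linear operators on `R ⊗ W`. -/
def Op : Type _ := Module.End R (R ⊗[K] W)

instance : Ring (Op K W R) := inferInstanceAs (Ring (Module.End R (R ⊗[K] W)))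

instance : Algebra R (Op K W R) := inferInstanceAs (Algebra R (Module.End R (R ⊗[K] W)))

namespace Op

variable {K W R}

/-- An operator as a linear map. -/
def app (A : Op K W R) : R ⊗[K] W →ₗ[R] R ⊗[K] W := A

variable (A B : Op K W R) (z : R ⊗[K] W)

theorem add_app : (A + B).app z = A.app z + B.app z := rfl
theorem sub_app : (A - B).app z = A.app z - B.app z := rfl
theorem mul_app : (A * B).app z = A.app (B.app z) := rfl
theorem one_app : (1 : Op K W R).app z = z := rfl
theorem zero_app : (0 : Op K W R).app z = 0 := rfl
theorem smul_app (r : R) : (r • A).app z = r • A.app z := rfl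

theorem sum_app {ι : Type*} (t : Finset ι) (F : ι → Op K W R) :
    (∑ a ∈ t, F a).app z = ∑ a ∈ t, (F a).app z :=
  map_sum (⟨⟨fun A : Op K W R => A.app z, rfl⟩, fun _ _ => rfl⟩ : Op K W R →+ R ⊗[K] W) F t

variable {A B} in
theorem ext (h : ∀ w : W, A.app (1 ⊗ₜ w) = B.app (1 ⊗ₜ w)) : A = B := by
  refine TensorProduct.AlgebraTensorModule.ext (g := A.app) (h := B.app) fun r w => ?_
  have h1 : (r ⊗ₜ[K] w : R ⊗[K] W) = r • (1 ⊗ₜ[K] w) := by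
    rw [TensorProduct.smul_tmul', smul_eq_mul, mul_one]
  rw [h1, map_smul, map_smul, h]

variable (R) in
/-- The base change of an operator on `W`. -/
def ofEnd : Module.End K W →+* Op K W R := (Module.End.baseChangeHom K R W).toRingHom

theorem ofEnd_app (T : Module.End K W) (r : R) (w : W) :
    (ofEnd R T).app (r ⊗ₜ w) = r ⊗ₜ T w := rfl

theorem ofEnd_smul (c : K) (T : Module.End K W) : ofEnd R (c • T) = algebraMap K R c • ofEnd R T :=
  ext fun w => by
    rw [smul_app, ofEnd_app, ofEnd_app, LinearMap.smul_apply, TensorProduct.tmul_smul,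
      algebraMap_smul]

end Op

end Operators

/-! ### The action of derivations of `R[[X]]` on `R ⊗ W`, weight by weight. -/

section Graded

open MvPowerSeries

variable {n : ℕ} (K : Type*) [Field K] (W : Type*) [AddCommGroup W] [Module K W]
  [LieRingModule (LPlus K n) W] [LieModule K (LPlus K n) W]

open Classical in
/-- The operator on `W` given by `X^s ∂/∂X_i`. -/
def actMon (s : Fin n →₀ ℕ) (i : Fin n) : Module.End K W :=
  if h : s ≠ 0 then actEnd n K W (LPlus.monomial K ⟨s, h⟩ i) else 0

theorem actMon_of_ne {s : Fin n →₀ ℕ} (h : s ≠ 0) (i : Fin n) :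
    actMon K W s i = actEnd n K W (LPlus.monomial K ⟨s, h⟩ i) := dif_pos h

variable {K} in
/-- The action on `W` of the homogeneous component of degree `k` of a derivation. -/
def actCoeff (k : ℕ) (D : PowDer n K) : Module.End K W :=
  ∑ i, ∑ s ∈ degSet n (k + 1), coeff s (D (X i)) • actMon K W s i

theorem ne_zero_of_mem_degSet {k : ℕ} {s : Fin n →₀ ℕ} (hs : s ∈ degSet n (k + 1)) : s ≠ 0 := by
  rintro rfl
  simp at hs

/-- A homogeneous derivation is a finite combination of the `X^s ∂/∂X_i`, so linearity of the action
suffices and no continuity is involved. -/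
theorem actCoeff_eq_actEnd {k : ℕ} {D : LPlus K n} (hD : ∀ i, IsHomog (D.1 (X i)) (k + 1)) :
    actCoeff W k D.1 = actEnd n K W D := by
  classical
  have h : D = ∑ i, ∑ s ∈ (degSet n (k + 1)).attach, coeff s.1 (D.1 (X i)) •
      LPlus.monomial K ⟨s.1, ne_zero_of_mem_degSet s.2⟩ i := by
    refine Subtype.ext (derivation_ext fun j => ?_)
    simp only [AddSubmonoidClass.coe_finsetSum, derivation_sum_apply]
    ext t
    simp only [map_sum]
    have e (i : Fin n) (s : (degSet n (k + 1))) : coeff t ((coeff s.1 (D.1 (X i)) •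
      LPlus.monomial K ⟨s.1, ne_zero_of_mem_degSet s.2⟩ i : LPlus K n).1 (X j)) =
        coeff s.1 (D.1 (X i)) * if t = s.1 ∧ i = j then 1 else 0 := by
      rw [← coeff_monDer_X (R := K) s.1 t i j]
      rfl
    simp only [e]
    rw [Finset.sum_eq_single j]
    · by_cases ht : t.degree = k + 1
      · rw [Finset.sum_eq_single ⟨t, mem_degSet.2 ht⟩]
        · simp
        · intro s _ hs
          rw [if_neg, mul_zero]
          rintro ⟨rfl, -⟩
          exact hs rfl
        · intro h; exact absurd (Finset.mem_attach _ _) h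
      · rw [hD j t ht, eq_comm]
        refine Finset.sum_eq_zero fun s _ => ?_
        rw [if_neg, mul_zero]
        rintro ⟨rfl, -⟩
        exact ht (mem_degSet.1 s.2)
    · intro i _ hi; simp [hi]
    · simp
  conv_rhs => rw [h]
  rw [map_sum, actCoeff]
  refine Finset.sum_congr rfl fun i _ => ?_
  rw [map_sum, ← Finset.sum_attach]
  refine Finset.sum_congr rfl fun s _ => ?_
  rw [map_smul, actMon_of_ne]

theorem actCoeff_eq_zero {k l : ℕ} {D : PowDer n K} (hD : ∀ i, IsHomog (D (X i)) (l + 1))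
    (h : k ≠ l) : actCoeff W k D = 0 :=
  Finset.sum_eq_zero fun i _ => Finset.sum_eq_zero fun s hs => by
    rw [hD i s (by rw [mem_degSet.1 hs]; omega), zero_smul]

section Base

variable {R : Type*} [CommRing R] [Algebra K R]

variable {K} in
/-- The operator on `R ⊗ W` given by the homogeneous component of degree `k` of a derivation of
`R[[X]]`. -/
def rhoCoeff (k : ℕ) : PowDer n R →ₗ[R] Op K W R where
  toFun D := ∑ i, ∑ s ∈ degSet n (k + 1), coeff s (D (X i)) • Op.ofEnd R (actMon K W s i)
  map_add' D D' := by
    simp only [Derivation.add_apply, map_add, add_smul, Finset.sum_add_distrib]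
  map_smul' r D := by
    simp only [Derivation.smul_apply, coeff_smul, mul_smul, Finset.smul_sum, RingHom.id_apply]

theorem rhoCoeff_apply (k : ℕ) (D : PowDer n R) : rhoCoeff (K := K) W k D =
    ∑ i, ∑ s ∈ degSet n (k + 1), coeff s (D (X i)) • Op.ofEnd R (actMon K W s i) := rfl

theorem rhoCoeff_eq_zero {k : ℕ} {D : PowDer n R} (h : ∀ i, D (X i) ∈ ordIdeal n R (k + 2)) :
    rhoCoeff (K := K) W k D = 0 := by
  rw [rhoCoeff_apply]
  refine Finset.sum_eq_zero fun i _ => Finset.sum_eq_zero fun s hs => ?_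
  rw [h i s (by rw [mem_degSet.1 hs]; omega), zero_smul]

theorem rhoCoeff_eq_baseChange (k : ℕ) {D : PowDer n R} {D₀ : PowDer n K}
    (h : ∀ i, D (X i) = MvPowerSeries.map (algebraMap K R) (D₀ (X i))) :
    rhoCoeff W k D = Op.ofEnd R (actCoeff W k D₀) := by
  simp only [rhoCoeff_apply, actCoeff, h, coeff_map, map_sum, Op.ofEnd_smul]

theorem rhoCoeff_map {S : Type*} [CommRing S] [Algebra K S] (h : R →ₐ[K] S) (k : ℕ)
    {D : PowDer n R} {D' : PowDer n S}
    (hD : ∀ i, D' (X i) = MvPowerSeries.map h.toRingHom (D (X i))) (z : R ⊗[K] W) :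
    (rhoCoeff W k D').app (h.toLinearMap.rTensor W z) =
      h.toLinearMap.rTensor W ((rhoCoeff W k D).app z) := by
  induction z using TensorProduct.induction_on with
  | zero => simp
  | add x y hx hy => simp only [map_add, hx, hy]
  | tmul r w =>
    simp only [rhoCoeff_apply, Op.sum_app, Op.smul_app, hD, coeff_map,
      LinearMap.rTensor_tmul, Op.ofEnd_app, map_sum, TensorProduct.smul_tmul']
    simp

theorem rhoCoeff_monDer {s : Fin n →₀ ℕ} {l : ℕ} (hs : s.degree = l + 1) (k : ℕ) (i : Fin n) :
    rhoCoeff (K := K) W k (monDer R s i) =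
      if k = l then Op.ofEnd R (actMon K W s i) else 0 := by
  rw [rhoCoeff_eq_baseChange K W k (D₀ := monDer K s i) fun j => monDer_X_map _ s i j]
  have hne : s ≠ 0 := by rintro rfl; simp at hs
  split_ifs with h
  · subst h
    rw [actMon_of_ne K W hne]
    exact congrArg _ (actCoeff_eq_actEnd K W (D := LPlus.monomial K ⟨s, hne⟩ i)
      fun j => isHomog_monDer hs i j)
  · rw [actCoeff_eq_zero K W (fun j => isHomog_monDer hs i j) h, map_zero]

theorem lie_monDer_X_map {S : Type*} [CommRing S] (h : R →+* S) (s t : Fin n →₀ ℕ)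
    (i j l : Fin n) : ⁅monDer S s i, monDer S t j⁆ (X l) =
      MvPowerSeries.map h (⁅monDer R s i, monDer R t j⁆ (X l)) := by
  rw [Derivation.commutator_apply, Derivation.commutator_apply, map_sub, monDer_X_map h t,
    monDer_X_map h s, derivation_map h (monDer_X_map h s i), derivation_map h (monDer_X_map h t j)]

theorem rhoCoeff_lie_monDer {s t : Fin n →₀ ℕ} {a b : ℕ} (hs : s.degree = a + 1)
    (ht : t.degree = b + 1) (k : ℕ) (i j : Fin n) :
    rhoCoeff (K := K) W k ⁅monDer R s i, monDer R t j⁆ = if k = a + b then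
      Op.ofEnd R (actMon K W s i) * Op.ofEnd R (actMon K W t j) -
        Op.ofEnd R (actMon K W t j) * Op.ofEnd R (actMon K W s i) else 0 := by
  rw [rhoCoeff_eq_baseChange K W k (D₀ := ⁅monDer K s i, monDer K t j⁆)
    fun l => lie_monDer_X_map _ s t i j l]
  have hs0 : s ≠ 0 := by rintro rfl; simp at hs
  have ht0 : t ≠ 0 := by rintro rfl; simp at ht
  have hh := isHomog_lie (D := monDer K s i) (D' := monDer K t j) (isHomog_monDer hs i)
    (isHomog_monDer ht j)
  split_ifs with h
  · subst h
    rw [actMon_of_ne K W hs0, actMon_of_ne K W ht0, ← map_mul (Op.ofEnd R),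
      ← map_mul (Op.ofEnd R), ← map_sub (Op.ofEnd R), ← actEnd_lie]
    exact congrArg _ (actCoeff_eq_actEnd K W
      (D := ⁅LPlus.monomial K ⟨s, hs0⟩ i, LPlus.monomial K ⟨t, ht0⟩ j⁆) hh)
  · rw [actCoeff_eq_zero K W hh h, map_zero]

/-- The defect of `rhoCoeff` as a homomorphism of graded Lie algebras. -/
def rhoDefect (k : ℕ) : PowDer n R →ₗ[R] PowDer n R →ₗ[R] Op K W R :=
  lieDefect (fun k => rhoCoeff W k) k

theorem rhoDefect_apply (k : ℕ) (D D' : PowDer n R) : rhoDefect K W k D D' =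
    rhoCoeff W k ⁅D, D'⁆ - ∑ p ∈ Finset.HasAntidiagonal.antidiagonal k, (rhoCoeff W p.1 D * rhoCoeff W p.2 D' -
      rhoCoeff W p.2 D' * rhoCoeff W p.1 D) := rfl

/-- Monomial derivations and their brackets are base changed from `K`, and they are homogeneous. So
only one pair of weights contributes, and there the identity is the one for the Lie algebra action
on `W`. -/
theorem rhoDefect_monDer {s t : Fin n →₀ ℕ} {a b : ℕ} (hs : s.degree = a + 1)
    (ht : t.degree = b + 1) (k : ℕ) (i j : Fin n) :
    rhoDefect K W k (monDer R s i) (monDer R t j) = 0 := by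
  rw [rhoDefect_apply, rhoCoeff_lie_monDer K W hs ht, sub_eq_zero]
  simp only [rhoCoeff_monDer K W hs, rhoCoeff_monDer K W ht]
  split_ifs with h
  · rw [Finset.sum_eq_single (a, b)]
    · simp
    · rintro ⟨a', b'⟩ hp hne
      dsimp only
      by_cases h1 : a' = a
      · rw [if_neg (fun h2 : b' = b => hne (by rw [h1, h2])), mul_zero, zero_mul, sub_zero]
      · rw [if_neg h1, mul_zero, zero_mul, sub_zero]
    · intro hn
      exact absurd (Finset.HasAntidiagonal.mem_antidiagonal.2 h.symm) hn
  · rw [eq_comm]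
    refine Finset.sum_eq_zero ?_
    rintro ⟨a', b'⟩ hp
    have hp' := Finset.HasAntidiagonal.mem_antidiagonal.1 hp
    dsimp only at hp' ⊢
    by_cases h1 : a' = a
    · rw [if_neg (fun h2 : b' = b => h (by rw [← hp', h1, h2])), mul_zero, zero_mul, sub_zero]
    · rw [if_neg h1, mul_zero, zero_mul, sub_zero]

theorem rhoDefect_eq_zero_of_mem {k : ℕ} {D D' : PowDer n R}
    (hD : ∀ i, D (X i) ∈ ordIdeal n R (k + 2)) (hD' : ∀ i, constantCoeff (D' (X i)) = 0) :
    rhoDefect K W k D D' = 0 := by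
  rw [rhoDefect_apply, rhoCoeff_eq_zero K W (lie_mem_ordIdeal hD hD'), zero_sub, neg_eq_zero]
  refine Finset.sum_eq_zero fun p hp => ?_
  have := Finset.HasAntidiagonal.mem_antidiagonal.1 hp
  rw [rhoCoeff_eq_zero K W fun i => ordIdeal_anti (by omega) (hD i), zero_mul, mul_zero, sub_zero]

theorem rhoDefect_swap (k : ℕ) (D D' : PowDer n R) :
    rhoDefect K W k D' D = - rhoDefect K W k D D' := lieDefect_swap _ k D D'

theorem truncDer_constantCoeff (D : PowDer n R) (k : ℕ) (i : Fin n) :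
    constantCoeff (truncDer D k (X i)) = 0 := by
  rw [← coeff_zero_eq_constantCoeff_apply, coeff_truncDer, if_neg (by simp)]

/-- The defect is `R`-bilinear, so it vanishes on finite combinations of monomial derivations. In
weight `k` the terms of degree at least `k + 2` in either argument do not contribute, so both
arguments may be truncated. -/
theorem rhoDefect_eq_zero (k : ℕ) {D D' : PowDer n R} (hD : ∀ i, constantCoeff (D (X i)) = 0)
    (hD' : ∀ i, constantCoeff (D' (X i)) = 0) : rhoDefect K W k D D' = 0 := by
  have h1 : rhoDefect K W k (truncDer D (k + 1)) (truncDer D' (k + 1)) = 0 := by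
    simp only [truncDer, map_sum, LinearMap.sum_apply, map_smul, LinearMap.smul_apply]
    refine Finset.sum_eq_zero fun b _ => Finset.sum_eq_zero fun j _ => Finset.sum_eq_zero
      fun t ht => ?_
    refine (congrArg _ (Finset.sum_eq_zero fun a _ => Finset.sum_eq_zero fun i _ =>
      Finset.sum_eq_zero fun s hs => ?_)).trans (smul_zero _)
    rw [rhoDefect_monDer K W (mem_degSet.1 hs) (mem_degSet.1 ht), smul_zero]
  have h2 := rhoDefect_eq_zero_of_mem K W (k := k) (sub_truncDer_mem hD (k + 1)) hD'
  have h3 := rhoDefect_eq_zero_of_mem K W (k := k) (sub_truncDer_mem hD' (k + 1))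
    (truncDer_constantCoeff D (k + 1))
  rw [rhoDefect_swap, neg_eq_zero] at h3
  rw [map_sub, LinearMap.sub_apply, sub_eq_zero] at h2
  rw [map_sub, h1, sub_zero] at h3
  rw [h2, h3]

/-- The generating function of the operators on `R ⊗ W` given by the homogeneous components of a
derivation of `R[[X]]`. -/
def rhoT : PowDer n R →ₗ[R] PowerSeries (Op K W R) where
  toFun D := PowerSeries.mk fun k => rhoCoeff W k D
  map_add' D D' := by ext k : 1; simp
  map_smul' r D := by ext k : 1; simp

@[simp]
theorem coeff_rhoT (k : ℕ) (D : PowDer n R) :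
    PowerSeries.coeff k (rhoT K W D) = rhoCoeff W k D := by
  exact PowerSeries.coeff_mk k fun k => rhoCoeff W k D

theorem rhoT_lie {D D' : PowDer n R} (hD : ∀ i, constantCoeff (D (X i)) = 0)
    (hD' : ∀ i, constantCoeff (D' (X i)) = 0) :
    rhoT K W ⁅D, D'⁆ = rhoT K W D * rhoT K W D' - rhoT K W D' * rhoT K W D :=
  lie_eq_of_lieDefect_eq_zero fun k => rhoDefect_eq_zero K W k hD hD'

theorem rhoCoeff_lie_eulerDer (k : ℕ) (D : PowDer n R) :
    rhoCoeff (K := K) W k ⁅eulerDer n R, D⁆ = (k : R) • rhoCoeff W k D := by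
  simp only [rhoCoeff_apply, coeff_lie_eulerDer, Finset.smul_sum, smul_smul]
  refine Finset.sum_congr rfl fun i _ => Finset.sum_congr rfl fun s hs => ?_
  rw [mem_degSet.1 hs]
  simp

theorem isHomog_X (i : Fin n) : IsHomog (X i : MvPowerSeries (Fin n) R) 1 := by
  classical
  intro s hs
  rw [coeff_X, if_neg]
  rintro rfl
  simp at hs

/-- The Euler derivation has weight zero, so its generating function is constant. -/
theorem rhoT_eulerDer : rhoT K W (eulerDer n R) =
    PowerSeries.C (Op.ofEnd R (actEnd n K W (LPlus.euler n K))) := by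
  have hh (i : Fin n) : IsHomog (eulerDer n K (X i)) (0 + 1) := by
    rw [eulerDer_X]; exact isHomog_X i
  have hm (i : Fin n) : eulerDer n R (X i) =
      MvPowerSeries.map (algebraMap K R) (eulerDer n K (X i)) := by
    rw [eulerDer_X, eulerDer_X, map_X]
  ext k : 1
  rw [coeff_rhoT, rhoCoeff_eq_baseChange K W k hm, PowerSeries.coeff_C]
  split_ifs with h
  · subst h
    exact congrArg _ (actCoeff_eq_actEnd K W (D := LPlus.euler n K) hh)
  · rw [actCoeff_eq_zero K W hh h, map_zero]

variable [Module.Finite K W] [CharZero K]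

theorem actMon_eq_zero {s : Fin n →₀ ℕ} (hs : weightBound n K W < s.degree) (i : Fin n) :
    actMon K W s i = 0 := by
  have hne : s ≠ 0 := by rintro rfl; simp at hs
  rw [actMon_of_ne K W hne]
  refine actEnd_eq_zero K fun j t ht => ?_
  exact isHomog_monDer (R := K) (s := s) rfl i j t (by omega)

theorem rhoCoeff_eq_zero_of_le {k : ℕ} (hk : weightBound n K W ≤ k) (D : PowDer n R) :
    rhoCoeff (K := K) W k D = 0 := by
  rw [rhoCoeff_apply]
  refine Finset.sum_eq_zero fun i _ => Finset.sum_eq_zero fun s hs => ?_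
  rw [actMon_eq_zero K W (by rw [mem_degSet.1 hs]; omega), map_zero, smul_zero]

/-- The operator on `R ⊗ W` given by a derivation of `R[[X]]`. -/
def rho : PowDer n R →ₗ[R] Op K W R :=
  ∑ k ∈ Finset.range (weightBound n K W), rhoCoeff W k

theorem rho_apply (D : PowDer n R) :
    rho K W D = ∑ k ∈ Finset.range (weightBound n K W), rhoCoeff W k D := by
  simp [rho]

/-- `rho` adds up finitely many components, so it has to be compared with the true action of `D₀`.
The two agree because the difference between `D₀` and its truncation has order above the weight
bound and acts by zero. -/
theorem rho_eq_baseChange {D : PowDer n R} {D₀ : LPlus K n}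
    (h : ∀ i, D (X i) = MvPowerSeries.map (algebraMap K R) (D₀.1 (X i))) :
    rho K W D = Op.ofEnd R (actEnd n K W D₀) := by
  have h0 : ∀ i, constantCoeff (D₀.1 (X i)) = 0 := fun i => LPlus.constantCoeff_X K D₀ i
  have hT : actEnd n K W D₀ = ∑ k ∈ Finset.range (weightBound n K W), actCoeff W k D₀.1 := by
    have h1 := actEnd_eq_zero K (W := W) (D := D₀ - LPlus.mk (truncDer D₀.1 (weightBound n K W))
      (truncDer_constantCoeff _ _)) (sub_truncDer_mem h0 (weightBound n K W))
    rw [map_sub, sub_eq_zero] at h1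
    have h2 : LPlus.mk (truncDer D₀.1 (weightBound n K W)) (truncDer_constantCoeff _ _) =
        ∑ l ∈ Finset.range (weightBound n K W), ∑ i, ∑ s ∈ (degSet n (l + 1)).attach,
          coeff s.1 (D₀.1 (X i)) • LPlus.monomial K ⟨s.1, ne_zero_of_mem_degSet s.2⟩ i := by
      refine Subtype.ext ?_
      simp only [AddSubmonoidClass.coe_finsetSum]
      change truncDer D₀.1 (weightBound n K W) = _
      rw [truncDer]
      refine Finset.sum_congr rfl fun l _ => Finset.sum_congr rfl fun i _ => ?_
      exact (Finset.sum_attach (degSet n (l + 1))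
        fun s => coeff s (D₀.1 (X i)) • monDer K s i).symm
    rw [h1, h2, map_sum]
    refine Finset.sum_congr rfl fun l _ => ?_
    rw [map_sum, actCoeff]
    refine Finset.sum_congr rfl fun i _ => ?_
    rw [map_sum, ← Finset.sum_attach (degSet n (l + 1))]
    refine Finset.sum_congr rfl fun s _ => ?_
    rw [map_smul, actMon_of_ne]
  rw [rho_apply, hT, map_sum]
  exact Finset.sum_congr rfl fun k _ => rhoCoeff_eq_baseChange K W k h

theorem rho_map {S : Type*} [CommRing S] [Algebra K S] (h : R →ₐ[K] S)
    {D : PowDer n R} {D' : PowDer n S}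
    (hD : ∀ i, D' (X i) = MvPowerSeries.map h.toRingHom (D (X i))) (z : R ⊗[K] W) :
    (rho K W D').app (h.toLinearMap.rTensor W z) = h.toLinearMap.rTensor W ((rho K W D).app z) := by
  simp only [rho_apply, Op.sum_app, map_sum, rhoCoeff_map K W h _ hD]

end Base

end Graded

/-! ### The formal differential equation `t dP/dt = -a P`. -/

section Theta

variable {A : Type*} [Ring A]

/-- The operator `t d/dt` on power series. -/
def theta (P : PowerSeries A) : PowerSeries A := PowerSeries.mk fun k => k • PowerSeries.coeff k P

@[simp]
theorem coeff_theta (k : ℕ) (P : PowerSeries A) :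
    PowerSeries.coeff k (theta P) = k • PowerSeries.coeff k P := PowerSeries.coeff_mk _ _

theorem theta_sub (P Q : PowerSeries A) : theta (P - Q) = theta P - theta Q := by
  ext k; simp [smul_sub]

theorem theta_mul (P Q : PowerSeries A) : theta (P * Q) = theta P * Q + P * theta Q := by
  ext k
  simp only [coeff_theta, map_add, PowerSeries.coeff_mul, Finset.smul_sum,
    ← Finset.sum_add_distrib]
  refine Finset.sum_congr rfl fun p hp => ?_
  rw [← Finset.HasAntidiagonal.mem_antidiagonal.1 hp, add_smul, smul_mul_assoc, mul_smul_comm]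

theorem theta_map {B : Type*} [Ring B] (h : A →+* B) (P : PowerSeries A) :
    theta (PowerSeries.map h P) = PowerSeries.map h (theta P) := by
  ext k; simp

variable {K : Type*} [Field K] [CharZero K] [Algebra K A]

theorem nsmul_eq_zero_of_algebra (K : Type*) [Field K] [CharZero K] [Algebra K A] {k : ℕ}
    (hk : k ≠ 0) {a : A} (h : k • a = 0) : a = 0 := by
  rw [← Nat.cast_smul_eq_nsmul K] at h
  exact (smul_eq_zero.1 h).resolve_left (Nat.cast_ne_zero.2 hk)

/-- Comparison of coefficients gives `(k - b) d_k` in terms of the `d_j` with `j < k`, because `a`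
has no constant term. The induction fails only at the resonance `k = b`, which `hb` covers. -/
theorem eq_zero_of_theta (K : Type*) [Field K] [CharZero K] [Algebra K A] {a d : PowerSeries A}
    (ha : PowerSeries.coeff 0 a = 0) {b : ℕ} (h : theta d = - (a * d) + b • d)
    (hb : PowerSeries.coeff b d = 0) : d = 0 := by
  ext k
  induction k using Nat.strong_induction_on with
  | _ k ih =>
    have hk := congrArg (PowerSeries.coeff k) h
    rw [coeff_theta, map_add, map_neg, PowerSeries.coeff_mul, Finset.sum_eq_zero, neg_zero,
      zero_add, map_nsmul] at hk
    · rw [map_zero]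
      rcases lt_trichotomy k b with hkb | rfl | hkb
      · refine nsmul_eq_zero_of_algebra K (k := b - k) (by omega) ?_
        obtain ⟨c, rfl⟩ := Nat.exists_eq_add_of_lt hkb
        rw [add_assoc, add_smul, eq_comm, add_eq_left] at hk
        rw [← hk]; congr 1; omega
      · exact hb
      · refine nsmul_eq_zero_of_algebra K (k := k - b) (by omega) ?_
        obtain ⟨c, rfl⟩ := Nat.exists_eq_add_of_lt hkb
        rw [add_assoc, add_smul, add_eq_left] at hk
        rw [← hk]; congr 1; omega
    · rintro ⟨i, j⟩ hp
      have hp' := Finset.HasAntidiagonal.mem_antidiagonal.1 hp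
      dsimp only at hp' ⊢
      rcases Nat.eq_zero_or_pos i with rfl | hi
      · rw [ha, zero_mul]
      · rw [ih j (by omega), map_zero, mul_zero]

/-- The coefficients of the solution of `t dP/dt = - a P` with initial value `p`. -/
def odeCoeff (K : Type*) [Field K] [Algebra K A] (a : PowerSeries A) (p : A) : ℕ → A
  | 0 => p
  | k + 1 => - ((k + 1 : ℕ) : K)⁻¹ •
      ∑ j : Fin (k + 1), PowerSeries.coeff (k + 1 - j) a * odeCoeff K a p j

/-- The solution of `t dP/dt = - a P` with initial value `p`. -/
def odeSol (K : Type*) [Field K] [Algebra K A] (a : PowerSeries A) (p : A) : PowerSeries A :=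
  PowerSeries.mk (odeCoeff K a p)

theorem coeff_zero_odeSol (K : Type*) [Field K] [Algebra K A] (a : PowerSeries A) (p : A) :
    PowerSeries.coeff 0 (odeSol K a p) = p := by
  rw [odeSol, PowerSeries.coeff_mk, odeCoeff]

theorem theta_odeSol {a : PowerSeries A} (ha : PowerSeries.coeff 0 a = 0) (p : A) :
    theta (odeSol K a p) = - (a * odeSol K a p) := by
  ext k
  cases k with
  | zero =>
    rw [PowerSeries.coeff_zero_eq_constantCoeff_apply] at ha
    simp [ha]
  | succ k =>
    rw [coeff_theta, map_neg, PowerSeries.coeff_mul, odeSol]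
    simp only [PowerSeries.coeff_mk]
    rw [odeCoeff, ← Nat.cast_smul_eq_nsmul K, smul_smul, mul_neg,
      mul_inv_cancel₀ (Nat.cast_ne_zero.2 (Nat.succ_ne_zero k)), neg_one_smul,
      Finset.Nat.antidiagonal_succ, Finset.sum_cons, ha, zero_mul, zero_add, Finset.sum_map,
      ← Finset.Nat.sum_antidiagonal_swap, Finset.Nat.sum_antidiagonal_eq_sum_range_succ_mk,
      Finset.sum_range]
    congr 1
    refine Finset.sum_congr rfl fun j _ => ?_
    simp only [Function.Embedding.prodMap, Function.Embedding.coeFn_mk, Prod.map, Prod.swap_prod_mk,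
      Function.Embedding.refl_apply, Nat.succ_eq_add_one]
    rw [show k + 1 - (j : ℕ) = k - j + 1 by have := j.2; omega]

/-- The difference of two solutions with the same initial value solves the equation with `b = 0`,
where the resonance is the initial value itself. -/
theorem odeSol_unique {a : PowerSeries A} (ha : PowerSeries.coeff 0 a = 0) {P : PowerSeries A}
    (h : theta P = - (a * P)) : P = odeSol K a (PowerSeries.coeff 0 P) := by
  refine sub_eq_zero.1 (eq_zero_of_theta K ha (b := 0) ?_ ?_)
  · rw [theta_sub, h, theta_odeSol ha, zero_smul, add_zero, mul_sub]; abel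
  · rw [map_sub, coeff_zero_odeSol K, sub_self]

/-- The sum of the first `N` coefficients. -/
def sumCoeff (N : ℕ) (P : PowerSeries A) : A := ∑ k ∈ Finset.range N, PowerSeries.coeff k P

theorem sumCoeff_eq_of_le {N M : ℕ} (h : N ≤ M) {P : PowerSeries A}
    (hP : ∀ k, N ≤ k → PowerSeries.coeff k P = 0) : sumCoeff M P = sumCoeff N P :=
  (Finset.sum_subset (Finset.range_subset_range.2 h) fun k _ hk => hP k (by simpa using hk)).symm

/-- Evaluation at `t = 1` is multiplicative on polynomials; the bound `2 * N` covers all degrees of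
the product. -/
theorem sumCoeff_mul {N : ℕ} {P Q : PowerSeries A} (hP : ∀ k, N ≤ k → PowerSeries.coeff k P = 0)
    (hQ : ∀ k, N ≤ k → PowerSeries.coeff k Q = 0) :
    sumCoeff (2 * N) (P * Q) = sumCoeff N P * sumCoeff N Q := by
  rw [sumCoeff, sumCoeff, sumCoeff, Finset.sum_mul_sum, ← Finset.sum_product',
    ← Finset.sum_fiberwise_of_maps_to (s := Finset.range N ×ˢ Finset.range N)
      (t := Finset.range (2 * N)) (g := fun p => p.1 + p.2)]
  · refine Finset.sum_congr rfl fun k _ => ?_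
    rw [PowerSeries.coeff_mul]
    symm
    refine Finset.sum_subset (fun p hp => ?_) fun p hp hn => ?_
    · exact Finset.HasAntidiagonal.mem_antidiagonal.2 (Finset.mem_filter.1 hp).2
    · have hp' := Finset.HasAntidiagonal.mem_antidiagonal.1 hp
      by_cases h1 : N ≤ p.1
      · rw [hP _ h1, zero_mul]
      · by_cases h2 : N ≤ p.2
        · rw [hQ _ h2, mul_zero]
        · exact absurd (Finset.mem_filter.2 ⟨Finset.mem_product.2
            ⟨Finset.mem_range.2 (by omega), Finset.mem_range.2 (by omega)⟩, hp'⟩) hn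
  · intro p hp
    have := Finset.mem_product.1 hp
    simp only [Finset.mem_range] at this ⊢
    omega

end Theta

/-! ### Base change of operators, dual numbers and derivatives of operators. -/

section OperatorMaps

variable {K : Type*} [Field K] {W : Type*} [AddCommGroup W] [Module K W]
variable {R S T : Type*} [CommRing R] [Algebra K R] [CommRing S] [Algebra K S] [CommRing T]
  [Algebra K T]

instance : Algebra K (Op K W R) := inferInstanceAs (Algebra K (Module.End R (R ⊗[K] W)))

namespace Op

/-- The operator with prescribed values on `W`. -/
def lift (l : W →ₗ[K] R ⊗[K] W) : Op K W R := LinearMap.liftBaseChange R l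

theorem lift_app (l : W →ₗ[K] R ⊗[K] W) (w : W) : (lift l).app (1 ⊗ₜ w) = l w := by
  change LinearMap.liftBaseChange R l (1 ⊗ₜ w) = l w
  simp

/-- The values of an operator on `W`. -/
def onW (A : Op K W R) : W →ₗ[K] R ⊗[K] W := A.app.restrictScalars K ∘ₗ TensorProduct.mk K R W 1

theorem app_tmul (A : Op K W R) (r : R) (w : W) : A.app (r ⊗ₜ w) = r • A.app (1 ⊗ₜ w) := by
  rw [← map_smul, TensorProduct.smul_tmul', smul_eq_mul, mul_one]

theorem rTensor_smul (h : R →ₐ[K] S) (r : R) (z : R ⊗[K] W) :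
    h.toLinearMap.rTensor W (r • z) = h r • h.toLinearMap.rTensor W z := by
  induction z using TensorProduct.induction_on with
  | zero => simp
  | add x y hx hy => simp only [smul_add, map_add, hx, hy]
  | tmul g w => simp [TensorProduct.smul_tmul']

/-- Base change of operators, as a function. -/
def mapFun (h : R →ₐ[K] S) (A : Op K W R) : Op K W S := lift (h.toLinearMap.rTensor W ∘ₗ A.onW)

theorem mapFun_app (h : R →ₐ[K] S) (A : Op K W R) (z : R ⊗[K] W) :
    (mapFun h A).app (h.toLinearMap.rTensor W z) = h.toLinearMap.rTensor W (A.app z) := by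
  induction z using TensorProduct.induction_on with
  | zero => simp
  | add x y hx hy => simp only [map_add, hx, hy]
  | tmul r w =>
    rw [LinearMap.rTensor_tmul, app_tmul, app_tmul A, rTensor_smul, mapFun, lift_app]
    rfl

theorem eq_mapFun {h : R →ₐ[K] S} {A : Op K W R} {B : Op K W S}
    (hB : ∀ w, B.app (1 ⊗ₜ w) = h.toLinearMap.rTensor W (A.app (1 ⊗ₜ w))) : B = mapFun h A :=
  ext fun w => by rw [hB, mapFun, lift_app]; rfl

/-- Base change of operators. -/
def map (h : R →ₐ[K] S) : Op K W R →+* Op K W S where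
  toFun := mapFun h
  map_one' := (eq_mapFun fun w => by simp [one_app]).symm
  map_mul' A B := (eq_mapFun fun w => by
    rw [mul_app, mul_app, ← mapFun_app, ← mapFun_app, LinearMap.rTensor_tmul]; simp).symm
  map_zero' := (eq_mapFun fun w => by simp [zero_app]).symm
  map_add' A B := (eq_mapFun fun w => by
    rw [add_app, add_app, map_add, ← mapFun_app, ← mapFun_app, LinearMap.rTensor_tmul]; simp).symm

theorem map_app (h : R →ₐ[K] S) (A : Op K W R) (z : R ⊗[K] W) :
    (map h A).app (h.toLinearMap.rTensor W z) = h.toLinearMap.rTensor W (A.app z) :=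
  mapFun_app h A z

theorem map_app_one (h : R →ₐ[K] S) (A : Op K W R) (w : W) :
    (map h A).app (1 ⊗ₜ w) = h.toLinearMap.rTensor W (A.app (1 ⊗ₜ w)) := by
  rw [← map_app]; simp

theorem eq_map {h : R →ₐ[K] S} {A : Op K W R} {B : Op K W S}
    (hB : ∀ w, B.app (1 ⊗ₜ w) = h.toLinearMap.rTensor W (A.app (1 ⊗ₜ w))) : B = map h A :=
  eq_mapFun hB

theorem map_smul (h : R →ₐ[K] S) (r : R) (A : Op K W R) : map h (r • A) = h r • map h A :=
  (eq_map fun w => by rw [smul_app, smul_app, map_app_one, rTensor_smul]).symm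

theorem map_map (h : R →ₐ[K] S) (h' : S →ₐ[K] T) (A : Op K W R) :
    map h' (map h A) = map (h'.comp h) A :=
  eq_map fun w => by
    rw [map_app_one, map_app_one, AlgHom.comp_toLinearMap, LinearMap.rTensor_comp]; rfl

theorem map_injective {h : R →ₐ[K] S} (hh : Function.Injective h) :
    Function.Injective (map (W := W) h) := fun A B e => ext fun w => by
  refine Module.Flat.rTensor_preserves_injective_linearMap h.toLinearMap hh ?_
  rw [← map_app_one, ← map_app_one, e]

end Op

section Basis

open Classical in
theorem equivFinsuppOfBasisRight_rTensor {ι M N : Type*} [AddCommGroup M]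
    [Module K M] [AddCommGroup N] [Module K N] (b : Module.Basis ι K W) (f : M →ₗ[K] N)
    (z : M ⊗[K] W) (i : ι) :
    TensorProduct.equivFinsuppOfBasisRight b (f.rTensor W z) i =
      f (TensorProduct.equivFinsuppOfBasisRight b z i) := by
  induction z using TensorProduct.induction_on with
  | zero => simp
  | add x y hx hy => simp only [map_add, Finsupp.add_apply, hx, hy]
  | tmul r w => simp [TensorProduct.equivFinsuppOfBasisRight_apply_tmul]

/-- An element of `R ⊗ W` killed by a map on `R` is killed by any map with a larger kernel. -/
theorem rTensor_eq_zero_of_ker_le {M M' M'' : Type*} [AddCommGroup M] [Module K M]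
    [AddCommGroup M'] [Module K M'] [AddCommGroup M''] [Module K M''] {l : M →ₗ[K] M'}
    {l' : M →ₗ[K] M''} (h : ∀ m, l m = 0 → l' m = 0) {z : M ⊗[K] W} (hz : l.rTensor W z = 0) :
    l'.rTensor W z = 0 := by
  classical
  let b := Module.Free.chooseBasis K W
  refine (TensorProduct.equivFinsuppOfBasisRight b).injective (Finsupp.ext fun i => ?_)
  have h1 := equivFinsuppOfBasisRight_rTensor b l z i
  rw [hz] at h1
  rw [equivFinsuppOfBasisRight_rTensor, h _ (by rw [← h1]; simp)]
  simp

end Basis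

section Dual

open DualNumber TrivSqZeroExt

variable (K R) in
/-- The inclusion of `R` in the ring of dual numbers. -/
def inlHom : R →ₐ[K] DualNumber R := TrivSqZeroExt.inlAlgHom K R R

variable (K) in
/-- The homomorphism `r ↦ r + ε d(r)`. -/
def derHom (d : Derivation K R R) : R →ₐ[K] DualNumber R where
  toFun r := TrivSqZeroExt.inl r + TrivSqZeroExt.inr (d r)
  map_one' := by simp
  map_zero' := by simp
  map_mul' a b := by
    ext <;> simp [mul_comm]
  map_add' a b := by ext <;> simp
  commutes' c := by
    simp [TrivSqZeroExt.algebraMap_eq_inl']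

theorem derHom_apply (d : Derivation K R R) (r : R) :
    derHom K d r = inlHom K R r + (DualNumber.eps : DualNumber R) * inlHom K R (d r) := by
  ext <;> simp [derHom, inlHom]

/-- The derivative of an operator. -/
def Op.der (d : Derivation K R R) (A : Op K W R) : Op K W R :=
  Op.lift ((d : R →ₗ[K] R).rTensor W ∘ₗ A.onW)

theorem Op.der_app (d : Derivation K R R) (A : Op K W R) (w : W) :
    (Op.der d A).app (1 ⊗ₜ w) = (d : R →ₗ[K] R).rTensor W (A.app (1 ⊗ₜ w)) := by
  rw [Op.der, Op.lift_app]; rfl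

theorem rTensor_derHom (d : Derivation K R R) (z : R ⊗[K] W) :
    (derHom K d).toLinearMap.rTensor W z = (inlHom K R).toLinearMap.rTensor W z +
      (DualNumber.eps : DualNumber R) •
        (inlHom K R).toLinearMap.rTensor W ((d : R →ₗ[K] R).rTensor W z) := by
  induction z using TensorProduct.induction_on with
  | zero => simp
  | add x y hx hy => simp only [smul_add, map_add, hx, hy]; abel
  | tmul r w =>
    simp only [LinearMap.rTensor_tmul, AlgHom.toLinearMap_apply, derHom_apply,
      TensorProduct.add_tmul, TensorProduct.smul_tmul', smul_eq_mul]
    rfl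

/-- Base change along `r ↦ r + ε d(r)` has the derivative of the operator as its `ε`-part. Any
construction natural in the ring can therefore be differentiated by evaluating it on this
homomorphism. -/
theorem Op.map_derHom (d : Derivation K R R) (A : Op K W R) : Op.map (derHom K d) A =
    Op.map (inlHom K R) A + (DualNumber.eps : DualNumber R) • Op.map (inlHom K R) (Op.der d A) :=
  (Op.eq_map fun w => by
    rw [Op.add_app, Op.smul_app, Op.map_app_one, Op.map_app_one, Op.der_app, rTensor_derHom]).symm

/-- The two coordinate projections of the dual numbers to `R` are `K`-linear, so they can be applied
to the first factor of the tensor product. -/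
theorem dual_tensor_ext {z₀ z₁ z₀' z₁' : R ⊗[K] W}
    (h : (inlHom K R).toLinearMap.rTensor W z₀ +
        (DualNumber.eps : DualNumber R) • (inlHom K R).toLinearMap.rTensor W z₁ =
      (inlHom K R).toLinearMap.rTensor W z₀' +
        (DualNumber.eps : DualNumber R) • (inlHom K R).toLinearMap.rTensor W z₁') :
    z₀ = z₀' ∧ z₁ = z₁' := by
  let f : DualNumber R →ₗ[K] R := TrivSqZeroExt.fstHom K R R
  let s : DualNumber R →ₗ[K] R := (TrivSqZeroExt.sndHom R R).restrictScalars K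
  have hf (z : R ⊗[K] W) : f.rTensor W ((inlHom K R).toLinearMap.rTensor W z) = z := by
    induction z using TensorProduct.induction_on with
    | zero => simp
    | add x y hx hy => simp only [map_add, hx, hy]
    | tmul r w => simp [f, inlHom]
  have hf' (z : R ⊗[K] W) : f.rTensor W ((DualNumber.eps : DualNumber R) •
      (inlHom K R).toLinearMap.rTensor W z) = 0 := by
    induction z using TensorProduct.induction_on with
    | zero => simp
    | add x y hx hy => simp only [map_add, smul_add, hx, hy, add_zero]
    | tmul r w => simp [f, inlHom, TensorProduct.smul_tmul']
  have hs (z : R ⊗[K] W) : s.rTensor W ((inlHom K R).toLinearMap.rTensor W z) = 0 := by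
    induction z using TensorProduct.induction_on with
    | zero => simp
    | add x y hx hy => simp only [map_add, hx, hy, add_zero]
    | tmul r w => simp [s, inlHom]
  have hs' (z : R ⊗[K] W) : s.rTensor W ((DualNumber.eps : DualNumber R) •
      (inlHom K R).toLinearMap.rTensor W z) = z := by
    induction z using TensorProduct.induction_on with
    | zero => simp
    | add x y hx hy => simp only [map_add, smul_add, hx, hy]
    | tmul r w => simp [s, inlHom, TensorProduct.smul_tmul']
  have h1 := congrArg (f.rTensor W) h
  have h2 := congrArg (s.rTensor W) h
  simp only [map_add, hf, hf', hs, hs', add_zero, zero_add] at h1 h2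
  exact ⟨h1, h2⟩

theorem Op.dual_ext {A₀ A₁ A₀' A₁' : Op K W R}
    (h : Op.map (inlHom K R) A₀ + (DualNumber.eps : DualNumber R) • Op.map (inlHom K R) A₁ =
      Op.map (inlHom K R) A₀' + (DualNumber.eps : DualNumber R) • Op.map (inlHom K R) A₁') :
    A₀ = A₀' ∧ A₁ = A₁' := by
  have h' (w : W) := dual_tensor_ext (z₀ := A₀.app (1 ⊗ₜ w)) (z₁ := A₁.app (1 ⊗ₜ w))
    (z₀' := A₀'.app (1 ⊗ₜ w)) (z₁' := A₁'.app (1 ⊗ₜ w)) (by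
      have := congrArg (fun A : Op K W (DualNumber R) => A.app (1 ⊗ₜ w)) h
      simpa only [Op.add_app, Op.smul_app, Op.map_app_one] using this)
  exact ⟨Op.ext fun w => (h' w).1, Op.ext fun w => (h' w).2⟩

end Dual

end OperatorMaps

/-! ### Linear parts of automorphisms, and linear automorphisms. -/

section LinearPart

open MvPowerSeries

variable {n : ℕ} {R S : Type*} [CommRing R] [CommRing S]

/-- The linear part of a power series. -/
def linSeries (f : MvPowerSeries (Fin n) R) : MvPowerSeries (Fin n) R :=
  ∑ j, coeff (Finsupp.single j 1) f • X j

theorem coeff_single_X (i j : Fin n) : coeff (Finsupp.single j 1) (X i : MvPowerSeries (Fin n) R) =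
    (1 : Matrix (Fin n) (Fin n) R) j i := by
  classical
  rw [coeff_X, Matrix.one_apply]
  simp [Finsupp.single_left_inj]

theorem eq_single_of_degree_eq_one {s : Fin n →₀ ℕ} (h : s.degree = 1) :
    ∃ j, s = Finsupp.single j 1 := by
  obtain ⟨j, hj⟩ : ∃ j, s j ≠ 0 := by
    by_contra! h'
    rw [show s = 0 from Finsupp.ext h'] at h
    simp at h
  have hle : Finsupp.single j 1 ≤ s := Finsupp.single_le_iff.2 (Nat.one_le_iff_ne_zero.2 hj)
  have h2 : (s - Finsupp.single j 1).degree = 0 := by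
    have := congrArg Finsupp.degree (tsub_add_cancel_of_le hle)
    rw [map_add, Finsupp.degree_single, h] at this
    omega
  rw [Finsupp.degree_eq_zero_iff] at h2
  exact ⟨j, by rw [← tsub_add_cancel_of_le hle, h2, zero_add]⟩

theorem coeff_single_linSeries (f : MvPowerSeries (Fin n) R) (j : Fin n) :
    coeff (Finsupp.single j 1) (linSeries f) = coeff (Finsupp.single j 1) f := by
  classical
  simp [linSeries, coeff_single_X, Matrix.one_apply]

theorem constantCoeff_linSeries (f : MvPowerSeries (Fin n) R) :
    constantCoeff (linSeries f) = 0 := by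
  simp [linSeries]

/-- Series without constant term and with the same linear part agree up to terms of order two. -/
theorem sub_mem_ordIdeal_two {f g : MvPowerSeries (Fin n) R} (hf : constantCoeff f = 0)
    (hg : constantCoeff g = 0)
    (h : ∀ j, coeff (Finsupp.single j 1) f = coeff (Finsupp.single j 1) g) :
    f - g ∈ ordIdeal n R 2 := by
  intro s hs
  rw [map_sub, sub_eq_zero]
  rcases Nat.lt_succ_iff_lt_or_eq.1 hs with h0 | h1
  · obtain rfl : s = 0 := (Finsupp.degree_eq_zero_iff s).1 (by omega)
    rw [coeff_zero_eq_constantCoeff_apply, coeff_zero_eq_constantCoeff_apply, hf, hg]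
  · obtain ⟨j, rfl⟩ := eq_single_of_degree_eq_one h1
    exact h j

theorem coeff_single_of_mem {f : MvPowerSeries (Fin n) R} (hf : f ∈ ordIdeal n R 2) (j : Fin n) :
    coeff (Finsupp.single j 1) f = 0 := hf _ (by simp)

/-- The derivation `X_i ↦ ∑ j, Z j i X_j`. -/
def linDer (Z : Matrix (Fin n) (Fin n) R) : PowDer n R :=
  vecField fun i => ∑ j, Z j i • X j

theorem linDer_X (Z : Matrix (Fin n) (Fin n) R) (i : Fin n) :
    linDer Z (X i) = ∑ j, Z j i • X j := vecField_X _ _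

theorem constantCoeff_linDer (Z : Matrix (Fin n) (Fin n) R) (i : Fin n) :
    constantCoeff (linDer Z (X i)) = 0 := by simp [linDer_X]

theorem linDer_add (Z Z' : Matrix (Fin n) (Fin n) R) : linDer (Z + Z') = linDer Z + linDer Z' :=
  derivation_ext fun i => by
    simp [linDer_X, add_smul, Finset.sum_add_distrib]

theorem linDer_zero : linDer (0 : Matrix (Fin n) (Fin n) R) = 0 :=
  derivation_ext fun i => by simp [linDer_X]

theorem linDer_smul (r : R) (Z : Matrix (Fin n) (Fin n) R) : linDer (r • Z) = r • linDer Z :=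
  derivation_ext fun i => by simp [linDer_X, Finset.smul_sum, smul_smul]

theorem isHomog_linDer (Z : Matrix (Fin n) (Fin n) R) (i : Fin n) :
    IsHomog (linDer Z (X i)) (0 + 1) := fun s hs => by
  rw [linDer_X, map_sum]
  exact Finset.sum_eq_zero fun j _ => by rw [coeff_smul, isHomog_X j s hs, mul_zero]

/-- The base change of a derivation. -/
def derMap (h : R →+* S) (D : PowDer n R) : PowDer n S := vecField fun i => MvPowerSeries.map h (D (X i))

theorem derMap_X (h : R →+* S) (D : PowDer n R) (i : Fin n) :
    derMap h D (X i) = MvPowerSeries.map h (D (X i)) := vecField_X _ _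

theorem derMap_map (h : R →+* S) (D : PowDer n R) (f : MvPowerSeries (Fin n) R) :
    derMap h D (MvPowerSeries.map h f) = MvPowerSeries.map h (D f) :=
  derivation_map h (derMap_X h D) f

theorem constantCoeff_derMap (h : R →+* S) {D : PowDer n R}
    (hD : ∀ i, constantCoeff (D (X i)) = 0) (i : Fin n) :
    constantCoeff (derMap h D (X i)) = 0 := by
  rw [derMap_X, constantCoeff_map, hD, map_zero]

theorem derMap_derMap {T : Type*} [CommRing T] (h : R →+* S) (h' : S →+* T) (D : PowDer n R) :
    derMap h' (derMap h D) = derMap (h'.comp h) D := derivation_ext fun i => by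
  rw [derMap_X, derMap_X, derMap_X]; ext s; simp

theorem map_smul_series (h : R →+* S) (r : R) (f : MvPowerSeries (Fin n) R) :
    MvPowerSeries.map h (r • f) = h r • MvPowerSeries.map h f := by
  ext s; simp

theorem derMap_linDer (h : R →+* S) (Z : Matrix (Fin n) (Fin n) R) :
    derMap h (linDer Z) = linDer (Z.map h) := derivation_ext fun i => by
  simp [derMap_X, linDer_X, map_smul_series]

namespace PowAut

/-- The matrix of the linear part of an automorphism. -/
def linMat (φ : PowAut n R) : Matrix (Fin n) (Fin n) R :=
  Matrix.of fun j i => coeff (Finsupp.single j 1) (φ.1 (X i))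

theorem linMat_apply (φ : PowAut n R) (i j : Fin n) :
    linMat φ j i = coeff (Finsupp.single j 1) (φ.1 (X i)) := rfl

theorem linMat_one : linMat (1 : PowAut n R) = 1 := by
  ext j i
  rw [linMat_apply, one_apply, coeff_single_X]

/-- An automorphism preserves the order, so the terms of `f` of degree at least two do not affect
the linear part of the image. -/
theorem coeff_single_apply (φ : PowAut n R) {f : MvPowerSeries (Fin n) R}
    (hf : constantCoeff f = 0) (j : Fin n) : coeff (Finsupp.single j 1) (φ.1 f) =
      ∑ k, linMat φ j k * coeff (Finsupp.single k 1) f := by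
  have h : f - linSeries f ∈ ordIdeal n R 2 :=
    sub_mem_ordIdeal_two hf (constantCoeff_linSeries f) fun j => (coeff_single_linSeries f j).symm
  have h' := coeff_single_of_mem (mem_ordIdeal φ h) j
  rw [map_sub, map_sub, sub_eq_zero] at h'
  rw [h', linSeries, map_sum, map_sum]
  refine Finset.sum_congr rfl fun k _ => ?_
  rw [map_smul, coeff_smul, linMat_apply, mul_comm]

theorem linMat_mul (φ ψ : PowAut n R) : linMat (φ * ψ) = linMat φ * linMat ψ := by
  ext j i
  rw [linMat_apply, mul_apply, coeff_single_apply φ (constCoeff_X ψ i), Matrix.mul_apply]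
  rfl

/-- The linear part of an automorphism. -/
def linPart : PowAut n R →* GL (Fin n) R :=
  MonoidHom.toHomUnits ⟨⟨linMat, linMat_one⟩, linMat_mul⟩

theorem linPart_apply (φ : PowAut n R) (i j : Fin n) :
    (linPart φ).1 j i = coeff (Finsupp.single j 1) (φ.1 (X i)) := rfl

theorem linPart_map {h : R →+* S} {φ : PowAut n R} {ψ : PowAut n S}
    (hψ : ∀ i, ψ.1 (X i) = MvPowerSeries.map h (φ.1 (X i))) :
    linPart ψ = Matrix.GeneralLinearGroup.map h (linPart φ) := by
  ext j i
  exact (congrArg (coeff _) (hψ i)).trans (coeff_map _ _ _)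

theorem constantCoeff_linForm (Z : Matrix (Fin n) (Fin n) R) (i : Fin n) :
    constantCoeff (∑ j, Z j i • (X j : MvPowerSeries (Fin n) R)) = 0 := by simp

theorem substHom_linForm (Z Z' : Matrix (Fin n) (Fin n) R) (i : Fin n) :
    substHom (fun i => ∑ j, Z j i • (X j : MvPowerSeries (Fin n) R)) (constantCoeff_linForm Z)
      (∑ j, Z' j i • X j) = ∑ j, (Z * Z') j i • X j := by
  simp only [map_sum, map_smul, substHom_X, Finset.smul_sum, smul_smul, Matrix.mul_apply,
    Finset.sum_smul]
  rw [Finset.sum_comm]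
  simp only [mul_comm]

theorem one_linForm (i : Fin n) :
    ∑ j, (1 : Matrix (Fin n) (Fin n) R) j i • (X j : MvPowerSeries (Fin n) R) = X i := by
  classical
  simp [Matrix.one_apply]

/-- The automorphism `X_i ↦ ∑ j, g j i X_j`. -/
def linAut (g : GL (Fin n) R) : PowAut n R :=
  ofSubst (fun i => ∑ j, g.1 j i • X j) (fun i => ∑ j, (g⁻¹).1 j i • X j)
    (constantCoeff_linForm _) (constantCoeff_linForm _)
    (fun i => by
      rw [substHom_linForm, ← one_linForm i, ← Units.val_one, ← mul_inv_cancel g]; rfl)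
    (fun i => by
      rw [substHom_linForm, ← one_linForm i, ← Units.val_one, ← inv_mul_cancel g]; rfl)

theorem linAut_X (g : GL (Fin n) R) (i : Fin n) : (linAut g).1 (X i) = ∑ j, g.1 j i • X j :=
  ofSubst_X _ _ _ _ _ _ i

theorem linAut_mul (g h : GL (Fin n) R) : linAut (g * h) = linAut g * linAut h := ext_X fun i => by
  rw [mul_apply, linAut_X, linAut_X, eq_substHom]
  simp only [linAut_X]
  rw [substHom_linForm]
  rfl

theorem linAut_one : linAut (1 : GL (Fin n) R) = 1 := ext_X fun i => by
  rw [linAut_X, one_apply]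
  exact one_linForm i

theorem linAut_inv (g : GL (Fin n) R) : linAut g⁻¹ = (linAut g)⁻¹ :=
  eq_inv_of_mul_eq_one_left (by rw [← linAut_mul, inv_mul_cancel, linAut_one])

theorem linPart_linAut (g : GL (Fin n) R) : linPart (linAut g) = g := by
  classical
  ext j i
  rw [linPart_apply, linAut_X, map_sum]
  simp [coeff_single_X, Matrix.one_apply]

theorem linAut_map (h : R →+* S) (g : GL (Fin n) R) (i : Fin n) :
    (linAut (Matrix.GeneralLinearGroup.map h g)).1 (X i) =
      MvPowerSeries.map h ((linAut g).1 (X i)) := by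
  simp [linAut_X, map_smul_series]

/-- Automorphisms with the same linear part agree on series of order `k` up to higher order. -/
theorem sub_mem_of_linPart_eq {φ ψ : PowAut n R} (h : linPart φ = linPart ψ) {k : ℕ}
    {f : MvPowerSeries (Fin n) R} (hf : f ∈ ordIdeal n R k) :
    φ.1 f - ψ.1 f ∈ ordIdeal n R (k + 1) := by
  have hX (i : Fin n) : φ.1 (X i) - ψ.1 (X i) ∈ ordIdeal n R 2 :=
    sub_mem_ordIdeal_two (constCoeff_X φ i) (constCoeff_X ψ i) fun j => by
      rw [← linPart_apply, ← linPart_apply, h]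
  induction k generalizing f with
  | zero => exact mem_ordIdeal_one.2 (by rw [map_sub, φ.2, ψ.2, sub_self])
  | succ k ih =>
    obtain ⟨g, hg, rfl⟩ := exists_eq_sum_X_mul hf
    simp only [map_sum, map_mul]
    rw [← Finset.sum_sub_distrib]
    refine Ideal.sum_mem _ fun i _ => ?_
    rw [show φ.1 (X i) * φ.1 (g i) - ψ.1 (X i) * ψ.1 (g i) =
      (φ.1 (X i) - ψ.1 (X i)) * φ.1 (g i) + ψ.1 (X i) * (φ.1 (g i) - ψ.1 (g i)) by ring]
    refine add_mem ?_ ?_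
    · have := mul_mem_ordIdeal (hX i) (mem_ordIdeal φ (hg i))
      rwa [show 2 + k = k + 1 + 1 by omega] at this
    · have := mul_mem_ordIdeal (mem_ordIdeal_one.2 (constCoeff_X ψ i)) (ih (hg i))
      rwa [show 1 + (k + 1) = k + 1 + 1 by omega] at this

theorem conj_mem_ordIdeal (φ : PowAut n R) {D : PowDer n R} {k : ℕ}
    (hD : ∀ i, D (X i) ∈ ordIdeal n R (k + 1)) (i : Fin n) :
    conj φ D (X i) ∈ ordIdeal n R (k + 1) := by
  rw [conj_apply]
  refine mem_ordIdeal φ ?_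
  have := derivation_mem_ordIdeal (k := 0) hD (mem_ordIdeal_one.2 (constCoeff_X φ⁻¹ i))
  simpa using this

theorem constantCoeff_conj (φ : PowAut n R) {D : PowDer n R}
    (hD : ∀ i, constantCoeff (D (X i)) = 0) (i : Fin n) :
    constantCoeff (conj φ D (X i)) = 0 :=
  mem_ordIdeal_one.1 (conj_mem_ordIdeal φ (k := 0) (fun i => mem_ordIdeal_one.2 (hD i)) i)

/-- Replacing `φ` by an automorphism with the same linear part changes every series only in higher
order. So the leading component of a conjugated derivation depends on the linear part alone. -/
theorem conj_sub_mem_of_linPart_eq {φ ψ : PowAut n R} (h : linPart φ = linPart ψ) {D : PowDer n R}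
    {k : ℕ} (hD : ∀ i, D (X i) ∈ ordIdeal n R (k + 1)) (i : Fin n) :
    (conj φ D - conj ψ D) (X i) ∈ ordIdeal n R (k + 2) := by
  -- The intermediate term `φ D ψ⁻¹` separates the change of the inner automorphism from that of the
  -- outer one.
  rw [Derivation.sub_apply, conj_apply, conj_apply, ← sub_add_sub_cancel _ (φ.1 (D ((ψ⁻¹).1 (X i))))]
  refine add_mem ?_ (sub_mem_of_linPart_eq h ?_)
  · rw [← map_sub, ← map_sub]
    refine mem_ordIdeal φ ?_
    have := derivation_mem_ordIdeal (k := 1) hD (sub_mem_of_linPart_eq (φ := φ⁻¹) (ψ := ψ⁻¹)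
      (by rw [map_inv, map_inv, h]) (X_mem_ordIdeal i))
    rwa [show k + 1 + 1 = k + 2 by omega] at this
  · have := derivation_mem_ordIdeal (k := 0) hD (mem_ordIdeal_one.2 (constCoeff_X ψ⁻¹ i))
    simpa using this

theorem conj_mul (φ ψ : PowAut n R) (D : PowDer n R) : conj (φ * ψ) D = conj φ (conj ψ D) :=
  derivation_ext fun i => by
    rw [conj_apply, conj_apply, conj_apply, mul_inv_rev, mul_apply, mul_apply]

theorem conj_one (D : PowDer n R) : conj 1 D = D := derivation_ext fun i => by
  rw [conj_apply, inv_one, one_apply, one_apply]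

theorem conj_add (φ : PowAut n R) (D D' : PowDer n R) : conj φ (D + D') = conj φ D + conj φ D' :=
  derivation_ext fun i => by simp [conj_apply]

theorem conj_sub (φ : PowAut n R) (D D' : PowDer n R) : conj φ (D - D') = conj φ D - conj φ D' :=
  derivation_ext fun i => by simp [conj_apply]

theorem conj_lie (φ : PowAut n R) (D D' : PowDer n R) : conj φ ⁅D, D'⁆ = ⁅conj φ D, conj φ D'⁆ :=
  derivation_ext fun i => by
    simp only [conj_apply, Derivation.commutator_apply, inv_apply_apply, map_sub]

theorem map_inv_X {h : R →+* S} {φ : PowAut n R} {ψ : PowAut n S}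
    (hψ : ∀ i, ψ.1 (X i) = MvPowerSeries.map h (φ.1 (X i))) (i : Fin n) :
    (ψ⁻¹).1 (X i) = MvPowerSeries.map h ((φ⁻¹).1 (X i)) := by
  rw [← inv_apply_apply ψ (MvPowerSeries.map h ((φ⁻¹).1 (X i))), map_apply hψ, apply_inv_apply,
    map_X]

theorem conj_map {h : R →+* S} {φ : PowAut n R} {ψ : PowAut n S}
    (hψ : ∀ i, ψ.1 (X i) = MvPowerSeries.map h (φ.1 (X i))) (D : PowDer n R) :
    conj ψ (derMap h D) = derMap h (conj φ D) := derivation_ext fun i => by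
  rw [conj_apply, derMap_X, conj_apply, map_inv_X hψ, derMap_map, map_apply hψ]

end PowAut

end LinearPart

/-! ### Infinitesimal automorphisms `1 + εη` and matrices `1 + εZ`. -/

section Infinitesimal

open MvPowerSeries

variable {n : ℕ} {R : Type*} [CommRing R]

variable (R) in
/-- The inclusion of `R` in the dual numbers, as a ring homomorphism. -/
def inlR : R →+* DualNumber R := TrivSqZeroExt.inlHom R R

/-- The ring homomorphism `f ↦ f + ε η(f)`. -/
def infFun (η : PowDer n R) (f : MvPowerSeries (Fin n) R) : MvPowerSeries (Fin n) (DualNumber R) :=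
  MvPowerSeries.map (inlR R) f + (DualNumber.eps : DualNumber R) • MvPowerSeries.map (inlR R) (η f)

theorem eps_smul_eps_smul {M : Type*} [AddCommGroup M] [Module (DualNumber R) M] (m : M) :
    (DualNumber.eps : DualNumber R) • (DualNumber.eps : DualNumber R) • m = 0 := by
  rw [smul_smul, DualNumber.eps_mul_eps, zero_smul]

/-- By the Leibniz rule and `ε² = 0`, the map `f ↦ f + ε η(f)` is multiplicative. It then agrees
with the substitution, since both have the same values on constants and variables. -/
theorem infFun_substHom (η : PowDer n R)
    (h0 : ∀ i, constantCoeff (infFun η (X i)) = 0) (f : MvPowerSeries (Fin n) R) :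
    substHom (fun i => infFun η (X i)) h0 (MvPowerSeries.map (inlR R) f) = infFun η f := by
  let α : MvPowerSeries (Fin n) R →+* MvPowerSeries (Fin n) (DualNumber R) :=
    { toFun := infFun η
      map_one' := by simp [infFun]
      map_zero' := by simp [infFun]
      map_add' f g := by simp only [infFun, map_add, smul_add]; abel
      map_mul' f g := by
        simp only [infFun, map_mul, Derivation.leibniz, smul_eq_mul, map_add, mul_add, add_mul,
          smul_add, mul_smul_comm, smul_mul_assoc, eps_smul_eps_smul]
        rw [mul_comm (MvPowerSeries.map (inlR R) g)]
        abel }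
  have := ringHom_ext (α := ((substHom (fun i => infFun η (X i)) h0 :
    MvPowerSeries (Fin n) (DualNumber R) →+* _)).comp (MvPowerSeries.map (inlR R))) (β := α)
    (fun i => by simpa using h0 i) (fun r => ?_) (fun i => by simp [α])
  · exact RingHom.congr_fun this f
  · have h1 : η (C r) = 0 := η.map_algebraMap r
    simp only [RingHom.comp_apply, map_C, RingHom.coe_coe, α, RingHom.coe_mk, MonoidHom.coe_mk,
      OneHom.coe_mk, infFun, h1, map_zero, smul_zero, add_zero]
    exact (substHom _ h0).commutes _

theorem constantCoeff_infFun_X (η : PowDer n R) (hη : ∀ i, constantCoeff (η (X i)) = 0)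
    (i : Fin n) : constantCoeff (infFun η (X i)) = 0 := by
  simp [infFun, smul_eq_C_mul, hη]

theorem infFun_neg (η : PowDer n R) (hη : ∀ i, constantCoeff (η (X i)) = 0) (i : Fin n) :
    substHom (fun i => infFun η (X i)) (constantCoeff_infFun_X η hη) (infFun (-η) (X i)) = X i := by
  conv_lhs => rw [infFun]
  rw [map_add, map_smul, infFun_substHom η, infFun_substHom η, Derivation.neg_apply]
  simp [infFun, eps_smul_eps_smul]

theorem constantCoeff_neg_der {η : PowDer n R} (hη : ∀ i, constantCoeff (η (X i)) = 0)
    (i : Fin n) : constantCoeff ((-η) (X i)) = 0 := by simp [hη]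

/-- The infinitesimal automorphism `1 + εη`. -/
def infAut (η : PowDer n R) (hη : ∀ i, constantCoeff (η (X i)) = 0) : PowAut n (DualNumber R) :=
  PowAut.ofSubst (fun i => infFun η (X i)) (fun i => infFun (-η) (X i))
    (constantCoeff_infFun_X η hη) (constantCoeff_infFun_X (-η) (constantCoeff_neg_der hη))
    (infFun_neg η hη)
    (fun i => by
      have := infFun_neg (-η) (constantCoeff_neg_der hη) i
      simpa only [neg_neg] using this)

theorem infAut_X (η : PowDer n R) (hη : ∀ i, constantCoeff (η (X i)) = 0) (i : Fin n) :
    (infAut η hη).1 (X i) = infFun η (X i) := PowAut.ofSubst_X _ _ _ _ _ _ i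

theorem infAut_map (η : PowDer n R) (hη : ∀ i, constantCoeff (η (X i)) = 0)
    (f : MvPowerSeries (Fin n) R) :
    (infAut η hη).1 (MvPowerSeries.map (inlR R) f) = infFun η f := by
  rw [PowAut.eq_substHom]
  simp only [infAut_X]
  exact infFun_substHom η _ f

theorem infAut_add (η η' : PowDer n R) (hη : ∀ i, constantCoeff (η (X i)) = 0)
    (hη' : ∀ i, constantCoeff (η' (X i)) = 0) (h : ∀ i, constantCoeff ((η + η') (X i)) = 0) :
    infAut (η + η') h = infAut η hη * infAut η' hη' := PowAut.ext_X fun i => by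
  rw [PowAut.mul_apply, infAut_X, infAut_X]
  conv_rhs => rw [infFun]
  rw [map_add, map_smul, infAut_map, infAut_map]
  simp only [infFun, Derivation.add_apply, map_add, smul_add, eps_smul_eps_smul]
  abel

theorem infAut_zero (h : ∀ i, constantCoeff ((0 : PowDer n R) (X i)) = 0) :
    infAut (0 : PowDer n R) h = 1 := PowAut.ext_X fun i => by
  rw [infAut_X, PowAut.one_apply]; simp [infFun]

theorem infAut_inv (η : PowDer n R) (hη : ∀ i, constantCoeff (η (X i)) = 0) :
    (infAut η hη)⁻¹ = infAut (-η) (constantCoeff_neg_der hη) := by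
  refine inv_eq_of_mul_eq_one_right ?_
  rw [← infAut_add η (-η) hη _ (by simp)]
  have h : η + -η = 0 := add_neg_cancel η
  simp only [h]
  exact infAut_zero _

/-- Expansion of `(1 + εη) D (1 - εη)` with `ε² = 0`: the differential of conjugation is the
bracket. -/
theorem conj_infAut (η : PowDer n R) (hη : ∀ i, constantCoeff (η (X i)) = 0) (D : PowDer n R) :
    PowAut.conj (infAut η hη) (derMap (inlR R) D) = derMap (inlR R) D +
      (DualNumber.eps : DualNumber R) • derMap (inlR R) ⁅η, D⁆ := derivation_ext fun i => by
  rw [PowAut.conj_apply, infAut_inv, infAut_X, infFun, map_add, Derivation.map_smul, derMap_map,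
    derMap_map, map_add, map_smul, infAut_map, infAut_map, Derivation.add_apply,
    Derivation.smul_apply, derMap_X, derMap_X, Derivation.commutator_apply]
  simp only [infFun, smul_add, eps_smul_eps_smul, Derivation.neg_apply, map_neg, map_sub, smul_neg,
    smul_sub]
  abel

/-- The infinitesimal matrix `1 + εZ`. -/
def infGL (Z : Matrix (Fin n) (Fin n) R) : GL (Fin n) (DualNumber R) where
  val := 1 + (DualNumber.eps : DualNumber R) • Z.map (inlR R)
  inv := 1 - (DualNumber.eps : DualNumber R) • Z.map (inlR R)
  val_inv := by simp [add_mul, mul_sub, eps_smul_eps_smul]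
  inv_val := by simp [sub_mul, mul_add, eps_smul_eps_smul]

theorem infGL_apply (Z : Matrix (Fin n) (Fin n) R) (i j : Fin n) : (infGL Z).1 i j =
    (1 : Matrix (Fin n) (Fin n) (DualNumber R)) i j + DualNumber.eps * inlR R (Z i j) := rfl

theorem infGL_zero : infGL (0 : Matrix (Fin n) (Fin n) R) = 1 :=
  Units.ext (Matrix.ext fun i j => by rw [infGL_apply]; simp)

theorem infGL_add (Z Z' : Matrix (Fin n) (Fin n) R) : infGL (Z + Z') = infGL Z * infGL Z' := by
  refine Units.ext ?_
  rw [Units.val_mul]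
  simp only [infGL, add_mul, mul_add, smul_mul_smul_comm, DualNumber.eps_mul_eps, zero_smul]
  simp [Matrix.map_add, add_assoc, add_comm]

theorem linAut_infGL (Z : Matrix (Fin n) (Fin n) R) :
    PowAut.linAut (R := DualNumber R) (infGL Z) = infAut (linDer Z) (constantCoeff_linDer Z) := PowAut.ext_X fun i => by
  have h : (PowAut.linAut (R := DualNumber R) (infGL Z)).1 (X i) =
      ∑ j, ((1 : Matrix (Fin n) (Fin n) (DualNumber R)) j i • X j +
        (DualNumber.eps : DualNumber R) • inlR R (Z j i) • X j) :=
    (PowAut.linAut_X _ i).trans (Finset.sum_congr rfl fun j _ => by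
      rw [infGL_apply, add_smul, mul_smul])
  rw [h, infAut_X, infFun, linDer_X, Finset.sum_add_distrib, PowAut.one_linForm, map_X, map_sum,
    Finset.smul_sum]
  simp only [map_smul_series, map_X]

end Infinitesimal

/-! ### Calculus of operators `A + εB`. -/

section EpsilonOperators

variable {K : Type*} [Field K] {W : Type*} [AddCommGroup W] [Module K W]
variable {R : Type*} [CommRing R] [Algebra K R]

namespace Op

/-- The operator `A`, with scalars extended to the dual numbers. -/
def inl (A : Op K W R) : Op K W (DualNumber R) := map (inlHom K R) A

/-- The operator `εA` over the dual numbers. -/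
def ep (A : Op K W R) : Op K W (DualNumber R) :=
  (DualNumber.eps : DualNumber R) • map (inlHom K R) A

theorem smul_mul_smul_eq_zero {S A : Type*} [CommRing S] [Ring A] [Algebra S A] {e : S}
    (he : e * e = 0) (a b : A) : (e • a) * (e • b) = 0 := by
  rw [smul_mul_smul_comm, he, zero_smul]

theorem ep_mul_ep (A B : Op K W R) : ep A * ep B = 0 :=
  smul_mul_smul_eq_zero DualNumber.eps_mul_eps _ _

theorem ep_mul_inl (A B : Op K W R) : ep A * inl B = ep (A * B) :=
  (smul_mul_assoc _ _ _).trans (congrArg _ (map_mul _ _ _).symm)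

theorem inl_mul_ep (A B : Op K W R) : inl A * ep B = ep (A * B) :=
  (mul_smul_comm _ _ _).trans (congrArg _ (map_mul _ _ _).symm)

theorem inl_mul_inl (A B : Op K W R) : inl A * inl B = inl (A * B) := (map_mul _ _ _).symm

theorem inl_one : inl (1 : Op K W R) = 1 := map_one _

theorem ep_zero : ep (0 : Op K W R) = 0 :=
  ext fun w => by rw [ep, map_zero, smul_app, zero_app, smul_zero]

theorem ep_add (A B : Op K W R) : ep (A + B) = ep A + ep B :=
  ext fun w => by rw [ep, map_add, smul_app, add_app, add_app, smul_add]; rfl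

/-- The map `A ↦ εA`, as a homomorphism of additive groups. -/
def epHom : Op K W R →+ Op K W (DualNumber R) where
  toFun := ep
  map_zero' := ep_zero
  map_add' := ep_add

theorem inl_add_ep_mul (A B A' B' : Op K W R) :
    (inl A + ep B) * (inl A' + ep B') = inl (A * A') + ep (A * B' + B * A') := by
  rw [add_mul, mul_add, mul_add, inl_mul_inl, inl_mul_ep, ep_mul_inl, ep_mul_ep, add_zero, ep_add,
    add_assoc]

theorem one_add_ep_mul (A B : Op K W R) : (1 + ep A) * (1 + ep B) = 1 + ep (A + B) := by
  rw [← inl_one, inl_add_ep_mul, mul_one, one_mul, mul_one, add_comm B]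

theorem inl_add_ep_injective {A₀ A₁ A₀' A₁' : Op K W R} (h : inl A₀ + ep A₁ = inl A₀' + ep A₁') :
    A₀ = A₀' ∧ A₁ = A₁' := dual_ext h

theorem map_derHom_eq (d : Derivation K R R) (A : Op K W R) :
    map (derHom K d) A = inl A + ep (der d A) := map_derHom d A

end Op

end EpsilonOperators

/-! ### Infinitesimal equivariance under `GLₙ`. -/

section LinearEquivariance

open MvPowerSeries PowAut

variable {K : Type u} [Field K] {n : ℕ} {W : Type u} [AddCommGroup W] [Module K W]
variable {R S : Type u} [CommRing R] [Algebra K R] [CommRing S] [Algebra K S]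

/-- The operators of a representation of `GLₙ`. -/
def GLRep.op (τ : GLRep K n W) : GL (Fin n) R →* Op K W R where
  toFun g := τ.act R g
  map_one' := map_one (τ.act R)
  map_mul' := map_mul (τ.act R)

theorem GLRep.op_map (τ : GLRep K n W) (h : R →ₐ[K] S) (g : GL (Fin n) R) :
    τ.op (Matrix.GeneralLinearGroup.map h.toRingHom g) = Op.map h (τ.op g) :=
  Op.eq_map fun w => by
    have := τ.act_baseChange h g (1 ⊗ₜ w)
    rw [LinearMap.rTensor_tmul, AlgHom.toLinearMap_apply, map_one] at this
    exact this

variable (K R) in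
/-- The homomorphism of rings of dual numbers `ε ↦ r ε`. -/
def dualScale (r : R) : DualNumber K →ₐ[K] DualNumber R :=
  DualNumber.lift ⟨(Algebra.ofId K _, DualNumber.eps * inlR R r), by
    rw [mul_mul_mul_comm, DualNumber.eps_mul_eps, zero_mul], fun a => (Algebra.commutes a _).symm⟩

theorem dualScale_eps (r : R) : dualScale K R r DualNumber.eps = DualNumber.eps * inlR R r :=
  DualNumber.lift_apply_eps _

theorem dualScale_inl (r : R) (c : K) : dualScale K R r (inlR K c) = inlR R (algebraMap K R c) :=
  (DualNumber.lift_apply_inl _ _).trans rfl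

variable [LieRingModule (LPlus K n) W] [LieModule K (LPlus K n) W]

/-- The action of `glₙ ⊆ L̂₊` is the differential of the representation of `GLₙ`. -/
def GLRep.Integrates (τ : GLRep K n W) : Prop :=
  ∀ (E : Matrix (Fin n) (Fin n) K) (η : LPlus K n) (g : GL (Fin n) (DualNumber K)),
    (∀ i, η.1 (MvPowerSeries.X i) = ∑ j, E j i • MvPowerSeries.X j) →
    (∀ i j, g.1 i j = (1 : Matrix (Fin n) (Fin n) (DualNumber K)) i j + E i j • DualNumber.eps) →
    ∀ w : W, τ.act (DualNumber K) g (1 ⊗ₜ[K] w) = 1 ⊗ₜ[K] w + DualNumber.eps ⊗ₜ[K] ⁅η, w⁆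

theorem rhoCoeff_derMap (k : ℕ) (h : R →ₐ[K] S) (D : PowDer n R) :
    rhoCoeff W k (derMap h.toRingHom D) = Op.map h (rhoCoeff W k D) :=
  Op.eq_map fun w => by
    rw [← rhoCoeff_map K W h k (derMap_X h.toRingHom D)]; simp

theorem rhoCoeff_add_eps (k : ℕ) (D D' : PowDer n R) :
    rhoCoeff W k (derMap (inlR R) D + (DualNumber.eps : DualNumber R) • derMap (inlR R) D') =
      Op.inl (rhoCoeff (K := K) W k D) + Op.ep (rhoCoeff W k D') := by
  have h (D : PowDer n R) : rhoCoeff W k (derMap (inlR R) D) =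
    Op.map (inlHom K R) (rhoCoeff W k D) := rhoCoeff_derMap k (inlHom K R) D
  rw [map_add, map_smul, h, h]
  rfl

theorem rhoCoeff_zero_linDer (E : Matrix (Fin n) (Fin n) K) (r : R) :
    rhoCoeff W 0 (linDer (r • E.map (algebraMap K R))) =
      r • Op.ofEnd R (actEnd n K W (LPlus.mk (linDer E) (constantCoeff_linDer E))) := by
  rw [linDer_smul, map_smul, ← derMap_linDer, rhoCoeff_eq_baseChange K W 0 (D₀ := linDer E)
    (derMap_X _ _)]
  congr 2
  exact actCoeff_eq_actEnd K W (D := LPlus.mk (linDer E) (constantCoeff_linDer E)) (isHomog_linDer E)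

variable {τ : GLRep K n W}

/-- The hypothesis speaks only of matrices over `K` and the dual numbers of `K`. The matrix `1 + ε r
E_ij` is the image of `1 + ε E_ij` under `ε ↦ r ε`, so naturality of the representation gives its
action. -/
theorem GLRep.Integrates.op_infGL_single (hτ : τ.Integrates) (i j : Fin n) (r : R) :
    τ.op (R := DualNumber R) (infGL (Matrix.single i j r)) = 1 + Op.ep (rhoCoeff W 0 (linDer (Matrix.single i j r))) := by
  have h1 : infGL (Matrix.single i j r) = Matrix.GeneralLinearGroup.map
      (n := Fin n) (dualScale K R r).toRingHom (infGL (Matrix.single i j (1 : K))) := by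
    refine Units.ext (Matrix.ext fun a b => ?_)
    have h2 : dualScale K R r ((infGL (Matrix.single i j (1 : K))).1 a b) =
        (infGL (Matrix.single i j r)).1 a b := by
      rw [infGL_apply, infGL_apply, map_add, map_mul, dualScale_eps, dualScale_inl, mul_assoc,
        ← map_mul]
      congr 1
      · simp only [Matrix.one_apply]; split_ifs <;> simp
      · congr 2
        simp only [Matrix.single_apply]; split_ifs <;> simp
    exact h2.symm
  have h3 : Matrix.single i j r = r • (Matrix.single i j (1 : K)).map (algebraMap K R) := by
    ext a b; simp only [Matrix.single_apply, Matrix.smul_apply, Matrix.map_apply]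
    split_ifs <;> simp
  rw [h1, τ.op_map]
  refine (Op.eq_map fun w => ?_).symm
  have h4 : (τ.op (R := DualNumber K) (infGL (Matrix.single i j (1 : K)))).app (1 ⊗ₜ w) = _ :=
    hτ (Matrix.single i j (1 : K)) (LPlus.mk (linDer _) (constantCoeff_linDer _)) _
    (linDer_X _) (fun a b => by
      rw [infGL_apply]; congr 1
      ext <;> simp [inlR]) w
  rw [h4, Op.add_app, Op.one_app, Op.ep, Op.smul_app, Op.map_app_one, h3, rhoCoeff_zero_linDer,
    Op.smul_app, Op.ofEnd_app, actEnd_apply, map_add]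
  simp only [LinearMap.rTensor_tmul, AlgHom.toLinearMap_apply, map_one, dualScale_eps,
    TensorProduct.smul_tmul', smul_eq_mul, mul_one]
  rfl

theorem GLRep.Integrates.op_infGL (hτ : τ.Integrates) (Z : Matrix (Fin n) (Fin n) R) :
    τ.op (R := DualNumber R) (infGL Z) = 1 + Op.ep (rhoCoeff W 0 (linDer Z)) := by
  induction Z using Matrix.induction_on' with
  | h_zero => rw [infGL_zero, map_one, linDer_zero, map_zero, Op.ep_zero, add_zero]
  | h_add Z Z' hZ hZ' =>
    rw [infGL_add, map_mul, hZ, hZ', linDer_add, map_add, Op.one_add_ep_mul]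
  | h_std_basis i j r => exact hτ.op_infGL_single i j r

/-- A linear derivation has weight zero, so bracketing with it preserves each weight. -/
theorem rhoCoeff_lie_linDer (k : ℕ) (Z : Matrix (Fin n) (Fin n) R) {D : PowDer n R}
    (hD : ∀ i, constantCoeff (D (X i)) = 0) :
    rhoCoeff (K := K) W k ⁅linDer Z, D⁆ = rhoCoeff W 0 (linDer Z) * rhoCoeff W k D -
      rhoCoeff W k D * rhoCoeff W 0 (linDer Z) := by
  have h0 : rhoT K W (linDer Z) = PowerSeries.C (rhoCoeff W 0 (linDer Z)) := by
    ext k : 1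
    rw [coeff_rhoT, PowerSeries.coeff_C]
    split_ifs with h
    · rw [h]
    · rw [rhoCoeff_apply]
      refine Finset.sum_eq_zero fun i _ => Finset.sum_eq_zero fun s hs => ?_
      rw [isHomog_linDer Z i s (by rw [mem_degSet.1 hs]; omega), zero_smul]
  have := congrArg (PowerSeries.coeff k) (rhoT_lie K W (constantCoeff_linDer Z) hD)
  rwa [coeff_rhoT, h0, map_sub, PowerSeries.coeff_C_mul, PowerSeries.coeff_mul_C, coeff_rhoT] at this

/-- The equivariance at `g = 1 + εZ`: the parts without `ε` agree trivially, and the parts with `ε`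
are the bracket relation with a linear derivation. -/
theorem GLRep.Integrates.op_infGL_mul (hτ : τ.Integrates) (k : ℕ) (Z : Matrix (Fin n) (Fin n) R)
    {D : PowDer n R} (hD : ∀ i, constantCoeff (D (X i)) = 0) :
    τ.op (R := DualNumber R) (infGL Z) * Op.inl (rhoCoeff W k D) =
      rhoCoeff W k (conj (linAut (R := DualNumber R) (infGL Z)) (derMap (inlR R) D)) *
        τ.op (R := DualNumber R) (infGL Z) := by
  rw [hτ.op_infGL, linAut_infGL, conj_infAut, rhoCoeff_add_eps, ← Op.inl_one, Op.inl_add_ep_mul,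
    ← add_zero (Op.inl (rhoCoeff W k D)), ← Op.ep_zero, Op.inl_add_ep_mul,
    rhoCoeff_lie_linDer k Z hD]
  simp

/-- The operator `τ(g)⁻¹ ρ(g D g⁻¹) τ(g)`, which will turn out to be `ρ(D)`. -/
def glConj (τ : GLRep K n W) (k : ℕ) (D : PowDer n R) (g : GL (Fin n) R) : Op K W R :=
  τ.op g⁻¹ * rhoCoeff W k (conj (linAut g) D) * τ.op g

theorem glConj_map (k : ℕ) (D : PowDer n R) (g : GL (Fin n) R) (h : R →ₐ[K] S) :
    glConj τ k (derMap h.toRingHom D) (Matrix.GeneralLinearGroup.map h.toRingHom g) =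
      Op.map h (glConj τ k D g) := by
  rw [glConj, glConj, conj_map (linAut_map h.toRingHom g), rhoCoeff_derMap, ← map_inv, τ.op_map,
    τ.op_map, map_mul, map_mul]

theorem glConj_one (k : ℕ) (D : PowDer n R) : glConj τ k D 1 = rhoCoeff W k D := by
  rw [glConj, inv_one, map_one, linAut_one, conj_one, one_mul, mul_one]

/-- Since equivariance holds at `1 + εZ`, the expression `τ(g)⁻¹ ρ(g D g⁻¹) τ(g)` does not change
when `g` is multiplied on the left by `1 + εZ`. -/
theorem GLRep.Integrates.glConj_infGL_mul (hτ : τ.Integrates) (k : ℕ)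
    (Z : Matrix (Fin n) (Fin n) R) {D : PowDer n R} (hD : ∀ i, constantCoeff (D (X i)) = 0)
    (g : GL (Fin n) R) :
    glConj τ (R := DualNumber R) k (derMap (inlR R) D)
      (infGL Z * Matrix.GeneralLinearGroup.map (inlR R) g) =
      Op.inl (glConj τ k D g) := by
  have h1 : τ.op (R := DualNumber R) (infGL Z)⁻¹ * rhoCoeff W k (conj (linAut (R := DualNumber R)
      (infGL Z)) (derMap (inlR R) (conj (linAut g) D))) * τ.op (R := DualNumber R) (infGL Z) =
      Op.inl (rhoCoeff W k (conj (linAut g) D)) := by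
    rw [mul_assoc, ← hτ.op_infGL_mul k Z (constantCoeff_conj _ hD), ← mul_assoc, ← map_mul,
      inv_mul_cancel, map_one, one_mul]
  have h2 : τ.op (R := DualNumber R) (Matrix.GeneralLinearGroup.map (inlR R) g) =
    Op.inl (τ.op g) := τ.op_map (inlHom K R) g
  have h3 : τ.op (R := DualNumber R) (Matrix.GeneralLinearGroup.map (inlR R) g)⁻¹ =
    Op.inl (τ.op g⁻¹) := by rw [← map_inv]; exact τ.op_map (inlHom K R) g⁻¹
  rw [glConj, linAut_mul, PowAut.conj_mul, conj_map (linAut_map (inlR R) g), mul_inv_rev, map_mul, map_mul,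
    glConj, ← Op.inl_mul_inl, ← Op.inl_mul_inl, ← h1, h2, h3]
  simp only [mul_assoc]

/-- The factorization `g + ε d(g) = (1 + ε d(g) g⁻¹) g` by the logarithmic derivative of `g`. -/
theorem map_derHom_eq (d : Derivation K R R) (g : GL (Fin n) R) :
    Matrix.GeneralLinearGroup.map (derHom K d).toRingHom g =
      infGL (g.1.map d * (g⁻¹).1) * Matrix.GeneralLinearGroup.map (inlR R) g := by
  refine Units.ext ?_
  have h : (1 + (DualNumber.eps : DualNumber R) • (g.1.map d * (g⁻¹).1).map (inlR R)) *
      g.1.map (inlR R) = g.1.map (inlR R) + (DualNumber.eps : DualNumber R) •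
        (g.1.map d).map (inlR R) := by
    rw [add_mul, one_mul, smul_mul_assoc, ← Matrix.map_mul, mul_assoc,
      show (g⁻¹).1 * g.1 = 1 from congrArg Units.val (inv_mul_cancel g), mul_one]
  refine Eq.trans ?_ h.symm
  refine Matrix.ext fun i j => ?_
  exact derHom_apply d (g.1 i j)

/-- The condition `hd` says that `d` kills the coefficients of `D`. Base change along `r ↦ r + ε
d(r)` then only multiplies `g` by an infinitesimal matrix, and this leaves `glConj` unchanged. -/
theorem GLRep.Integrates.der_glConj (hτ : τ.Integrates) (k : ℕ) (d : Derivation K R R)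
    {D : PowDer n R} (hD : ∀ i, constantCoeff (D (X i)) = 0)
    (hd : derMap (derHom K d).toRingHom D = derMap (inlR R) D) (g : GL (Fin n) R) :
    Op.der d (glConj τ k D g) = 0 := by
  have h1 := glConj_map (τ := τ) k D g (derHom K d)
  rw [map_derHom_eq, hd, hτ.glConj_infGL_mul k _ hD, Op.map_derHom_eq] at h1
  refine (Op.inl_add_ep_injective (A₀ := glConj τ k D g) (A₀' := glConj τ k D g) ?_).2.symm
  rw [← h1, Op.ep_zero, add_zero]

end LinearEquivariance

/-! ### Power series with zero derivative are constant. -/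

section Path

variable (K : Type*) [Field K] {R : Type*} [CommRing R] [Algebra K R]

variable (R) in
/-- The inclusion of constants in power series. -/
def constHom : R →ₐ[K] PowerSeries R :=
  AlgHom.restrictScalars K (Algebra.ofId R (PowerSeries R))

theorem constHom_apply (r : R) : constHom K R r = PowerSeries.C r := rfl

variable (R) in
/-- The value of a power series at zero. -/
def evalZeroHom : PowerSeries R →ₐ[K] R where
  __ := PowerSeries.constantCoeff
  commutes' c := by
    simp [PowerSeries.algebraMap_apply]

theorem evalZeroHom_apply (f : PowerSeries R) : evalZeroHom K R f = PowerSeries.coeff 0 f := by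
  rw [PowerSeries.coeff_zero_eq_constantCoeff_apply]; rfl

theorem eq_constHom_of_derivative_eq_zero [CharZero K] {f : PowerSeries R}
    (h : PowerSeries.derivative R f = 0) : f = constHom K R (evalZeroHom K R f) := by
  ext k
  rw [constHom_apply, evalZeroHom_apply, PowerSeries.coeff_C]
  cases k with
  | zero => simp
  | succ k =>
    rw [if_neg (Nat.succ_ne_zero k)]
    refine nsmul_eq_zero_of_algebra K (Nat.succ_ne_zero k) ?_
    have := congrArg (PowerSeries.coeff k) h
    rw [PowerSeries.coeff_derivative, map_zero] at this
    rw [nsmul_eq_mul, mul_comm, ← this]; push_cast; rfl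

end Path

/-! ### From infinitesimal to global equivariance under `GLₙ`. -/

section LinearEquivariance

open MvPowerSeries PowAut

variable {K : Type u} [Field K] [CharZero K] {n : ℕ} {W : Type u} [AddCommGroup W] [Module K W]
  [LieRingModule (LPlus K n) W] [LieModule K (LPlus K n) W]
variable {R : Type u} [CommRing R] [Algebra K R] {τ : GLRep K n W}

/-- Along a formal path `g(T)` with `g(0) = 1`, the operator `τ(g)⁻¹ ρ(g D g⁻¹) τ(g)` has derivative
zero with respect to `T`. So it is constant, and its value at `T = 0` is `ρ(D)`. -/
theorem GLRep.Integrates.glConj_powerSeries (hτ : τ.Integrates) (k : ℕ) {D : PowDer n R}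
    (hD : ∀ i, constantCoeff (D (X i)) = 0) (g : GL (Fin n) (PowerSeries R))
    (hg : Matrix.GeneralLinearGroup.map (evalZeroHom K R).toRingHom g = 1) :
    glConj τ k (derMap (constHom K R).toRingHom D) g = Op.map (constHom K R) (rhoCoeff W k D) := by
  let d : Derivation K (PowerSeries R) (PowerSeries R) :=
    (PowerSeries.derivative R).restrictScalars K
  have hd (r : R) : d (constHom K R r) = 0 := (PowerSeries.derivative R).map_algebraMap r
  have h1 := hτ.der_glConj k d (D := derMap (constHom K R).toRingHom D)
    (constantCoeff_derMap _ hD) (by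
      rw [derMap_derMap, derMap_derMap]
      congr 1
      ext1 r
      change derHom K d (constHom K R r) = inlHom K _ (constHom K R r)
      rw [derHom_apply, hd, map_zero, mul_zero, add_zero]) g
  have h2 := glConj_map (τ := τ) k (derMap (constHom K R).toRingHom D) g (evalZeroHom K R)
  have h3 : derMap (evalZeroHom K R).toRingHom (derMap (constHom K R).toRingHom D) = D := by
    rw [derMap_derMap]
    refine derivation_ext fun i => ?_
    rw [derMap_X]
    ext s
    rw [coeff_map]
    change evalZeroHom K R (constHom K R _) = _
    rw [evalZeroHom_apply, constHom_apply]; simp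
  rw [hg, h3, glConj_one] at h2
  rw [h2]
  set A := glConj τ k (derMap (constHom K R).toRingHom D) g
  refine Op.ext fun w => ?_
  rw [Op.map_app_one, Op.map_app_one, ← sub_eq_zero]
  have h4 : (d : PowerSeries R →ₗ[K] PowerSeries R).rTensor W (A.app (1 ⊗ₜ w)) = 0 := by
    rw [← Op.der_app, h1, Op.zero_app]
  -- A series killed by `d/dT` is also killed by `f ↦ f - f(0)`; the same then holds after tensoring
  -- with `W`.
  have h5 := rTensor_eq_zero_of_ker_le (l' := LinearMap.id -
    (constHom K R).toLinearMap ∘ₗ (evalZeroHom K R).toLinearMap) (fun f hf => by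
      rw [LinearMap.sub_apply, sub_eq_zero]
      exact eq_constHom_of_derivative_eq_zero K hf) h4
  rwa [LinearMap.rTensor_sub, LinearMap.rTensor_id, LinearMap.rTensor_comp] at h5

/-- The action of derivations is equivariant with respect to linear changes of variables. -/
theorem GLRep.Integrates.op_mul (hτ : τ.Integrates) (k : ℕ) {D : PowDer n R}
    (hD : ∀ i, constantCoeff (D (X i)) = 0) (g : GL (Fin n) R) :
    τ.op g * rhoCoeff W k D = rhoCoeff W k (conj (linAut g) D) * τ.op g := by
  classical
  -- The straight path from `1` to `g`. It need not be invertible over `R[T]`, so its determinant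
  -- `p` is inverted. As `p(0) = 1` and `p(1)` is a unit, the localization maps both to `R[[T]]`
  -- and, by `T ↦ 1`, to `R`.
  let M : Matrix (Fin n) (Fin n) (Polynomial R) :=
    1 + (Polynomial.X : Polynomial R) • (g.1 - 1).map Polynomial.C
  let p := M.det
  have hM1 : M.map (Polynomial.evalRingHom 1) = g.1 := by
    ext i j
    simp only [M, Matrix.map_apply, Matrix.add_apply, Matrix.smul_apply, Matrix.sub_apply,
      Matrix.one_apply, Polynomial.coe_evalRingHom]
    split_ifs <;> simp
  have hM0 : M.map (Polynomial.evalRingHom 0) = 1 := by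
    ext i j
    simp only [M, Matrix.map_apply, Matrix.add_apply, Matrix.smul_apply, Matrix.sub_apply,
      Matrix.one_apply, Polynomial.coe_evalRingHom]
    split_ifs <;> simp
  have hp1 : IsUnit (Polynomial.aeval (1 : R) p) := by
    have : Polynomial.evalRingHom 1 p = g.1.det := by rw [RingHom.map_det, ← hM1]; rfl
    rw [Polynomial.coe_evalRingHom] at this
    rw [Polynomial.coe_aeval_eq_eval, this]
    exact (Matrix.isUnit_iff_isUnit_det _).1 g.isUnit
  have hp0 : Polynomial.eval 0 p = 1 := by
    have : Polynomial.evalRingHom 0 p = 1 := by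
      rw [RingHom.map_det, ← Matrix.det_one (n := Fin n), ← hM0]; rfl
    exact this
  let c : Polynomial R →ₐ[K] PowerSeries R :=
    (Polynomial.coeToPowerSeries.algHom R).restrictScalars K
  have hc (q : Polynomial R) : c q = (q : PowerSeries R) := by
    change Polynomial.coeToPowerSeries.algHom R q = _
    simp
  have hcu : IsUnit (c p) := by
    rw [hc, PowerSeries.isUnit_iff_constantCoeff, ← PowerSeries.coeff_zero_eq_constantCoeff_apply,
      Polynomial.coeff_coe, Polynomial.coeff_zero_eq_eval_zero, hp0]
    exact isUnit_one
  let L := Localization.Away p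
  let e1 : L →ₐ[K] R := IsLocalization.liftAlgHom (M := Submonoid.powers p)
    (f := (Polynomial.aeval (1 : R)).restrictScalars K) (by
      rintro ⟨_, m, rfl⟩
      simpa using hp1.pow m)
  let et : L →ₐ[K] PowerSeries R := IsLocalization.liftAlgHom (M := Submonoid.powers p) (f := c) (by
      rintro ⟨_, m, rfl⟩
      simpa using hcu.pow m)
  have he1 (q : Polynomial R) : e1 (algebraMap _ L q) = Polynomial.eval 1 q := by
    simp only [e1, IsLocalization.liftAlgHom_apply]
    rw [IsLocalization.lift_eq]
    exact Polynomial.coe_aeval_eq_eval (1 : R) ▸ rfl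
  have het (q : Polynomial R) : et (algebraMap _ L q) = (q : PowerSeries R) := by
    simp only [et, IsLocalization.liftAlgHom_apply]
    rw [IsLocalization.lift_eq]
    exact hc q
  -- Injectivity brings the identity known over `R[[T]]` back to the localization, where `T` may be
  -- set to `1`.
  have hinj : Function.Injective et := by
    rw [injective_iff_map_eq_zero]
    intro z hz
    obtain ⟨q, y, rfl⟩ := IsLocalization.exists_mk'_eq (Submonoid.powers p) z
    have h1 : et (algebraMap _ L q) = 0 := by
      rw [← IsLocalization.mk'_spec L q y, map_mul, hz, zero_mul]
    rw [het, Polynomial.coe_eq_zero_iff] at h1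
    rw [h1, IsLocalization.mk'_zero]
  let ι : R →ₐ[K] L := ((Algebra.ofId (Polynomial R) L).restrictScalars K).comp
    ((Algebra.ofId R (Polynomial R)).restrictScalars K)
  have hdet : IsUnit (M.map (algebraMap (Polynomial R) L)).det := by
    have : (M.map (algebraMap (Polynomial R) L)).det = algebraMap _ L p :=
      ((algebraMap (Polynomial R) L).map_det M).symm
    rw [this]
    exact IsLocalization.Away.algebraMap_isUnit p
  let g' : GL (Fin n) L := Matrix.GeneralLinearGroup.mk'' _ hdet
  have hg1 : Matrix.GeneralLinearGroup.map e1.toRingHom g' = g := by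
    refine Units.ext (Matrix.ext fun i j => ?_)
    exact (he1 (M i j)).trans (congrFun (congrFun hM1 i) j)
  have hι1 : e1.comp ι = AlgHom.id K R := AlgHom.ext fun r => (he1 _).trans Polynomial.eval_C
  have hιt : et.comp ι = constHom K R := AlgHom.ext fun r => (het _).trans (Polynomial.coe_C r)
  have hgt : Matrix.GeneralLinearGroup.map (evalZeroHom K R).toRingHom
      (Matrix.GeneralLinearGroup.map et.toRingHom g') = 1 := by
    refine Units.ext (Matrix.ext fun i j => ?_)
    refine Eq.trans ?_ (congrFun (congrFun hM0 i) j)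
    change evalZeroHom K R (et (algebraMap _ L (M i j))) = Polynomial.eval 0 (M i j)
    rw [het, evalZeroHom_apply, Polynomial.coeff_coe, Polynomial.coeff_zero_eq_eval_zero]
  have h1 := hτ.glConj_powerSeries k hD _ hgt
  have hcomp : derMap (constHom K R).toRingHom D = derMap et.toRingHom (derMap ι.toRingHom D) := by
    rw [derMap_derMap, ← hιt]; rfl
  rw [hcomp, glConj_map, ← hιt, ← Op.map_map] at h1
  -- Evaluation at `T = 1`, where the path takes the value `g`.
  have h2 := congrArg (Op.map e1) (Op.map_injective hinj h1)
  have hid : derMap e1.toRingHom (derMap ι.toRingHom D) = D := by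
    rw [derMap_derMap, show e1.toRingHom.comp ι.toRingHom = RingHom.id R from
      congrArg AlgHom.toRingHom hι1]
    refine derivation_ext fun i => ?_
    rw [derMap_X, map_id]; rfl
  rw [← glConj_map, hg1, hid, Op.map_map, hι1, ← rhoCoeff_derMap] at h2
  have hid' : derMap (AlgHom.id K R).toRingHom D = D := derivation_ext fun i => by
    rw [derMap_X, show (AlgHom.id K R).toRingHom = RingHom.id R from rfl, map_id]; rfl
  rw [hid'] at h2
  rw [← h2, glConj, ← mul_assoc, ← mul_assoc, ← map_mul, mul_inv_cancel, map_one, one_mul]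

end LinearEquivariance

/-! ### Integration of the action to the group scheme of automorphisms. -/

section Integration

open MvPowerSeries PowAut

variable {K : Type u} [Field K] {n : ℕ}
variable {R S : Type u} [CommRing R] [CommRing S]

theorem derMap_eulerDer (h : R →+* S) : derMap h (eulerDer n R) = eulerDer n S :=
  derivation_ext fun i => by rw [derMap_X, eulerDer_X, eulerDer_X, map_X]

theorem conj_linAut_eulerDer (g : GL (Fin n) R) :
    conj (linAut g) (eulerDer n R) = eulerDer n R := derivation_ext fun i => by
  have h : eulerDer n R ((linAut g⁻¹).1 (X i)) = (linAut g⁻¹).1 (X i) := by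
    rw [linAut_X, map_sum]
    simp only [Derivation.map_smul, eulerDer_X]
  rw [conj_apply, ← linAut_inv, h, linAut_inv, apply_inv_apply, eulerDer_X]

/-- The change of the Euler derivation under an automorphism. -/
def eulerDiff (φ : PowAut n R) : PowDer n R := conj φ (eulerDer n R) - eulerDer n R

/-- Linear automorphisms fix the Euler derivation, so only terms of positive weight remain. This
makes the coefficient of the differential equation vanish at `t = 0`, and its solution is then
determined by the initial value. -/
theorem eulerDiff_mem (φ : PowAut n R) (i : Fin n) :
    eulerDiff φ (X i) ∈ ordIdeal n R 2 := by
  have := conj_sub_mem_of_linPart_eq (φ := φ) (ψ := linAut (linPart φ))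
    (linPart_linAut _).symm (D := eulerDer n R) (k := 0)
    (fun i => by rw [eulerDer_X]; exact X_mem_ordIdeal i) i
  rwa [conj_linAut_eulerDer] at this

theorem constantCoeff_eulerDiff (φ : PowAut n R) (i : Fin n) :
    constantCoeff (eulerDiff φ (X i)) = 0 :=
  mem_ordIdeal_one.1 (ordIdeal_anti one_le_two (eulerDiff_mem φ i))

variable {W : Type u} [AddCommGroup W] [Module K W]
  [LieRingModule (LPlus K n) W] [LieModule K (LPlus K n) W]
variable [Algebra K R] [Algebra K S]

theorem theta_rhoT (D : PowDer n R) :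
    theta (rhoT K W D) = rhoT K W ⁅eulerDer n R, D⁆ := by
  ext k : 1
  rw [coeff_theta, coeff_rhoT, coeff_rhoT, rhoCoeff_lie_eulerDer, Nat.cast_smul_eq_nsmul]

theorem coeff_zero_rhoT_eulerDiff (φ : PowAut n R) :
    PowerSeries.coeff 0 (rhoT K W (eulerDiff φ)) = 0 := by
  rw [coeff_rhoT, rhoCoeff_eq_zero K W (eulerDiff_mem φ)]

/-- The series of operators which integrates the action of derivations: the coefficient of `t^k`
is the part of weight `k` of the action of an automorphism. -/
def autT (τ : GLRep K n W) (φ : PowAut n R) : PowerSeries (Op K W R) :=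
  odeSol K (rhoT K W (eulerDiff φ)) (τ.op (linPart φ))

variable {τ : GLRep K n W}

theorem coeff_zero_autT (φ : PowAut n R) : PowerSeries.coeff 0 (autT τ φ) = τ.op (linPart φ) :=
  coeff_zero_odeSol K _ _

theorem rhoT_mul_of_mem {k : ℕ} {D : PowDer n R} (hD : ∀ i, D (X i) ∈ ordIdeal n R (k + 2))
    (P : PowerSeries (Op K W R)) : PowerSeries.coeff k (rhoT K W D * P) = 0 ∧
      PowerSeries.coeff k (P * rhoT K W D) = 0 := by
  constructor <;> rw [PowerSeries.coeff_mul] <;> refine Finset.sum_eq_zero fun p hp => ?_ <;>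
    have hp' := Finset.HasAntidiagonal.mem_antidiagonal.1 hp <;>
    rw [coeff_rhoT, rhoCoeff_eq_zero K W fun i => ordIdeal_anti (by omega) (hD i)]
  · rw [zero_mul]
  · rw [mul_zero]

variable [CharZero K]

theorem theta_autT (φ : PowAut n R) :
    theta (autT τ φ) = - (rhoT K W (eulerDiff φ) * autT τ φ) :=
  theta_odeSol (coeff_zero_rhoT_eulerDiff φ) _

theorem autT_unique {φ : PowAut n R} {P : PowerSeries (Op K W R)}
    (h : theta P = - (rhoT K W (eulerDiff φ) * P))
    (h0 : PowerSeries.coeff 0 P = τ.op (linPart φ)) : P = autT τ φ := by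
  rw [autT, ← h0]
  exact odeSol_unique (coeff_zero_rhoT_eulerDiff φ) h

theorem lie_eulerDer_of_isHomog {D : PowDer n R} {b : ℕ} (hD : ∀ i, IsHomog (D (X i)) (b + 1)) :
    ⁅eulerDer n R, D⁆ = b • D := derivation_ext fun i => by
  ext s
  rw [coeff_lie_eulerDer, Derivation.smul_apply, map_nsmul, nsmul_eq_mul]
  by_cases hs : s.degree = b + 1
  · rw [hs]; push_cast; ring
  · rw [hD i s hs, mul_zero, mul_zero]

/-- The difference `d` of the two sides satisfies `t d' = -a d + b d` for the same coefficient `a`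
as `autT τ φ`. Hence it vanishes as soon as its coefficient at the resonance `t^b` does. -/
theorem autT_mul_rhoT_of_isHomog (hτ : τ.Integrates) (φ : PowAut n R) {D : PowDer n R} {b : ℕ}
    (hD : ∀ i, IsHomog (D (X i)) (b + 1)) :
    autT τ φ * rhoT K W D = rhoT K W (conj φ D) * autT τ φ := by
  have hmem (i : Fin n) : D (X i) ∈ ordIdeal n R (b + 1) := fun s hs => hD i s hs.ne
  have hD0 (i : Fin n) : constantCoeff (D (X i)) = 0 :=
    mem_ordIdeal_one.1 (ordIdeal_anti (Nat.le_add_left 1 b) (hmem i))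
  refine sub_eq_zero.1 (eq_zero_of_theta K (coeff_zero_rhoT_eulerDiff φ) (b := b) ?_ ?_)
  · have h1 : theta (rhoT K W D) = b • rhoT K W D := by
      rw [theta_rhoT, lie_eulerDer_of_isHomog hD, map_nsmul]
    have h2 : theta (rhoT K W (conj φ D)) = b • rhoT K W (conj φ D) -
        (rhoT K W (eulerDiff φ) * rhoT K W (conj φ D) -
          rhoT K W (conj φ D) * rhoT K W (eulerDiff φ)) := by
      rw [← rhoT_lie K W (constantCoeff_eulerDiff φ) (constantCoeff_conj φ hD0), theta_rhoT,
        ← map_nsmul, ← map_sub]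
      congr 1
      have h3 : conj φ (b • D) = b • conj φ D := derivation_ext fun i => by
        rw [conj_apply, Derivation.smul_apply, Derivation.smul_apply, conj_apply, map_nsmul]
      rw [← h3, ← lie_eulerDer_of_isHomog hD, conj_lie]
      refine derivation_ext fun i => ?_
      simp only [Derivation.commutator_apply, Derivation.sub_apply, eulerDiff, map_sub]
      abel
    rw [theta_sub, theta_mul, theta_mul, theta_autT, h1, h2]
    simp only [mul_smul_comm, smul_mul_assoc, sub_mul, mul_sub, smul_sub, neg_mul, mul_neg, mul_assoc]
    abel
  -- At `t^b` only the lowest term of each factor matters. There `φ` may be replaced by its linear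
  -- part, and the claim becomes the equivariance of the action under `GLₙ`.
  · rw [map_sub, PowerSeries.coeff_mul, PowerSeries.coeff_mul, Finset.sum_eq_single (0, b),
      Finset.sum_eq_single (b, 0), coeff_zero_autT, coeff_rhoT, coeff_rhoT, hτ.op_mul b hD0,
      ← sub_mul, ← map_sub, rhoCoeff_eq_zero K W, zero_mul]
    · exact conj_sub_mem_of_linPart_eq (linPart_linAut _) hmem
    · rintro ⟨i, j⟩ hp hne
      have hp' := Finset.HasAntidiagonal.mem_antidiagonal.1 hp
      dsimp only at hp' ⊢
      have hib : i ≠ b := fun h => hne (by ext <;> simp <;> omega)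
      rw [coeff_rhoT, rhoCoeff_eq_zero K W, zero_mul]
      exact fun l => ordIdeal_anti (by omega) (conj_mem_ordIdeal φ hmem l)
    · intro h; exact absurd (Finset.HasAntidiagonal.mem_antidiagonal.2 (by simp)) h
    · rintro ⟨i, j⟩ hp hne
      have hp' := Finset.HasAntidiagonal.mem_antidiagonal.1 hp
      dsimp only at hp' ⊢
      have hib : j ≠ b := fun h => hne (by ext <;> simp <;> omega)
      rw [coeff_rhoT, rhoCoeff_eq_zero K W, mul_zero]
      exact fun l => ordIdeal_anti (by omega) (hmem l)
    · intro h; exact absurd (Finset.HasAntidiagonal.mem_antidiagonal.2 (by simp)) h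

/-- The relation is additive in `D`, and its coefficient at `t^k` depends only on the terms of `D`
of degree at most `k + 1`. So the homogeneous case suffices. -/
theorem autT_mul_rhoT (hτ : τ.Integrates) (φ : PowAut n R) {D : PowDer n R}
    (hD : ∀ i, constantCoeff (D (X i)) = 0) :
    autT τ φ * rhoT K W D = rhoT K W (conj φ D) * autT τ φ := by
  let δ : PowDer n R →+ PowerSeries (Op K W R) :=
    { toFun := fun D => autT τ φ * rhoT K W D - rhoT K W (conj φ D) * autT τ φ
      map_zero' := by
        rw [show conj φ 0 = 0 from derivation_ext fun i => by simp [conj_apply]]; simp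
      map_add' := fun D D' => by rw [conj_add, map_add, map_add, mul_add, add_mul]; abel }
  refine sub_eq_zero.1 (show δ D = 0 from ?_)
  ext k : 1
  have h1 : δ (truncDer D (k + 1)) = 0 := by
    rw [truncDer, map_sum]
    refine Finset.sum_eq_zero fun l _ => sub_eq_zero.2 (autT_mul_rhoT_of_isHomog hτ φ (b := l) ?_)
    intro j s hs
    simp only [derivation_sum_apply, map_sum, Derivation.smul_apply, coeff_smul]
    exact Finset.sum_eq_zero fun i _ => Finset.sum_eq_zero fun t ht => by
      rw [isHomog_monDer (mem_degSet.1 ht) i j s hs, mul_zero]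
  have hmem := sub_truncDer_mem hD (k + 1)
  rw [show δ D = δ (D - truncDer D (k + 1)) by rw [map_sub, h1, sub_zero]]
  have h2 (D : PowDer n R) :
    δ D = autT τ φ * rhoT K W D - rhoT K W (conj φ D) * autT τ φ := rfl
  rw [h2, map_sub, (rhoT_mul_of_mem hmem _).2, (rhoT_mul_of_mem (conj_mem_ordIdeal φ hmem) _).1,
    sub_zero, map_zero]

/-- `eulerDiff` is a cocycle, `eulerDiff (φ * ψ) = eulerDiff φ + conj φ (eulerDiff ψ)`. With the
intertwining relation the product of two solutions solves the equation for `φ * ψ`, and uniqueness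
applies. -/
theorem autT_mul (hτ : τ.Integrates) (φ ψ : PowAut n R) :
    autT τ (φ * ψ) = autT τ φ * autT τ ψ := by
  symm
  refine autT_unique ?_ ?_
  · have h : eulerDiff (φ * ψ) = eulerDiff φ + conj φ (eulerDiff ψ) := by
      rw [eulerDiff, eulerDiff, eulerDiff, PowAut.conj_mul, conj_sub]; abel
    rw [theta_mul, theta_autT, theta_autT, h, map_add, add_mul, mul_neg, ← mul_assoc,
      autT_mul_rhoT hτ φ (constantCoeff_eulerDiff ψ), neg_mul, neg_add, mul_assoc, mul_assoc]
  · rw [PowerSeries.coeff_mul]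
    simp [coeff_zero_autT]

theorem autT_one : autT τ (1 : PowAut n R) = 1 := by
  symm
  refine autT_unique ?_ ?_
  · rw [eulerDiff, conj_one, sub_self, map_zero, zero_mul, neg_zero]
    ext k : 1
    rw [coeff_theta, PowerSeries.coeff_one]
    split_ifs with h
    · rw [h, zero_smul, map_zero]
    · rw [smul_zero, map_zero]
  · rw [PowerSeries.coeff_one, if_pos rfl, map_one, map_one]

theorem autT_map (h : R →ₐ[K] S) {φ : PowAut n R} {ψ : PowAut n S}
    (hψ : ∀ i, ψ.1 (X i) = MvPowerSeries.map h.toRingHom (φ.1 (X i))) :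
    autT τ ψ = PowerSeries.map (Op.map h) (autT τ φ) := by
  symm
  refine autT_unique ?_ ?_
  · have h1 : rhoT K W (eulerDiff ψ) = PowerSeries.map (Op.map h) (rhoT K W (eulerDiff φ)) := by
      ext k : 1
      rw [PowerSeries.coeff_map, coeff_rhoT, coeff_rhoT, ← rhoCoeff_derMap]
      congr 1
      have h2 : derMap h.toRingHom (eulerDiff φ) = derMap h.toRingHom (conj φ (eulerDer n R)) -
          derMap h.toRingHom (eulerDer n R) := derivation_ext fun i => by
        rw [Derivation.sub_apply, derMap_X, derMap_X, derMap_X, eulerDiff, Derivation.sub_apply,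
          map_sub]
      rw [h2, ← conj_map hψ, derMap_eulerDer, eulerDiff]
    rw [theta_map, theta_autT, map_neg, map_mul, h1]
  · rw [PowerSeries.coeff_map, coeff_zero_autT, linPart_map hψ, τ.op_map]

theorem linPart_infAut (η : PowDer n R) (hη : ∀ i, constantCoeff (η (X i)) = 0) :
    linPart (R := DualNumber R) (infAut η hη) =
      infGL (Matrix.of fun j i => coeff (Finsupp.single j 1) (η (X i))) := by
  refine Units.ext (Matrix.ext fun j i => ?_)
  rw [linPart_apply, infAut_X, infGL_apply, infFun, map_add, map_X, coeff_single_X, coeff_smul,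
    coeff_map]
  rfl

/-- For `φ = 1 + εη` the coefficient of the equation is `ε ρ_t([η, E])`, whose component of weight
`k` is `-k ε ρ_k(η)`. Products of two such terms vanish, so `1 + ε ρ_t(η)` solves the equation; its
value at `t = 0` is right because `τ` integrates the linear part. -/
theorem autT_infAut (hτ : τ.Integrates) (η : PowDer n R) (hη : ∀ i, constantCoeff (η (X i)) = 0) :
    autT τ (R := DualNumber R) (infAut η hη) =
      1 + PowerSeries.mk fun k => Op.ep (rhoCoeff W k η) := by
  symm
  have h1 : rhoT K W (R := DualNumber R) (eulerDiff (infAut η hη)) =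
      PowerSeries.mk fun k => Op.ep (rhoCoeff W k ⁅η, eulerDer n R⁆) := by
    have h2 : eulerDiff (R := DualNumber R) (infAut η hη) = derMap (inlR R) 0 +
        (DualNumber.eps : DualNumber R) • derMap (inlR R) ⁅η, eulerDer n R⁆ := by
      rw [eulerDiff, ← derMap_eulerDer (inlR R), conj_infAut]
      refine derivation_ext fun i => ?_
      simp [derMap_X]
    ext k : 1
    rw [coeff_rhoT, h2, rhoCoeff_add_eps, PowerSeries.coeff_mk, map_zero, Op.inl, map_zero, zero_add]
  refine autT_unique ?_ ?_
  · rw [h1]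
    ext k : 1
    have h3 (k : ℕ) : Op.ep (K := K) (W := W) (rhoCoeff W k ⁅η, eulerDer n R⁆) =
        - (k • Op.ep (rhoCoeff W k η)) := by
      rw [← lie_skew, map_neg, rhoCoeff_lie_eulerDer, Nat.cast_smul_eq_nsmul]
      exact (map_neg Op.epHom _).trans (congrArg _ (map_nsmul Op.epHom _ _))
    have h4 : (PowerSeries.mk fun k => Op.ep (K := K) (W := W) (rhoCoeff W k ⁅η, eulerDer n R⁆)) *
        (PowerSeries.mk fun k => Op.ep (rhoCoeff W k η)) = 0 := by
      ext k : 1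
      rw [PowerSeries.coeff_mul]
      exact Finset.sum_eq_zero fun p _ => by
        rw [PowerSeries.coeff_mk, PowerSeries.coeff_mk, Op.ep_mul_ep]
    rw [mul_add, mul_one, h4, add_zero, map_neg, coeff_theta, map_add, PowerSeries.coeff_mk,
      PowerSeries.coeff_mk, h3, neg_neg, smul_add, PowerSeries.coeff_one]
    split_ifs with h
    · simp [h]
    · rw [smul_zero, zero_add]
  · rw [map_add, PowerSeries.coeff_one, if_pos rfl, PowerSeries.coeff_mk, linPart_infAut,
      hτ.op_infGL]
    congr 2
    rw [← sub_eq_zero, ← map_sub, rhoCoeff_eq_zero K W]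
    intro i
    rw [Derivation.sub_apply]
    refine sub_mem_ordIdeal_two (hη i) (constantCoeff_linDer _ i) fun j => ?_
    rw [linDer_X]
    exact (coeff_single_linSeries (η (X i)) j).symm

variable [Module.Finite K W]

/-- The intertwining relation for the Euler derivation says that the coefficient at `t^k` is an
operator of weight `k`, and there are none of high weight. -/
theorem coeff_autT_eq_zero (hτ : τ.Integrates) (φ : PowAut n R) {k : ℕ}
    (hk : weightBound n K W + 1 ≤ k) : PowerSeries.coeff k (autT τ φ) = 0 := by
  refine eq_zero_of_weight K (n := n) (W := W) (R := R) (k := k) (by omega) ?_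
  have h1 := autT_mul_rhoT hτ φ (D := eulerDer n R) (constantCoeff_eulerDer R)
  have h2 : conj φ (eulerDer n R) = eulerDiff φ + eulerDer n R := (sub_add_cancel _ _).symm
  rw [h2, map_add, add_mul, rhoT_eulerDer] at h1
  have h3 : PowerSeries.C (Op.ofEnd R (actEnd n K W (LPlus.euler n K))) * autT τ φ -
      autT τ φ * PowerSeries.C (Op.ofEnd R (actEnd n K W (LPlus.euler n K))) =
      theta (autT τ φ) := by
    rw [h1, theta_autT]; abel
  replace h3 := congrArg (PowerSeries.coeff k) h3
  rw [map_sub, PowerSeries.coeff_C_mul, PowerSeries.coeff_mul_C, coeff_theta] at h3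
  refine Eq.trans h3 ?_
  exact (Nat.cast_smul_eq_nsmul R k (PowerSeries.coeff k (autT τ φ))).symm

/-- The action of an automorphism. -/
def autOp (hτ : τ.Integrates) : PowAut n R →* Op K W R where
  -- Evaluation at `t = 1`. The summand `1` ensures that the index `0` always belongs to the range.
  toFun φ := sumCoeff (weightBound n K W + 1) (autT τ φ)
  map_one' := by
    rw [autT_one, sumCoeff, Finset.sum_eq_single 0]
    · rw [PowerSeries.coeff_one, if_pos rfl]
    · intro k _ hk; rw [PowerSeries.coeff_one, if_neg hk]
    · simp
  map_mul' φ ψ := by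
    rw [← sumCoeff_mul (fun k hk => coeff_autT_eq_zero hτ φ hk)
      (fun k hk => coeff_autT_eq_zero hτ ψ hk), ← autT_mul hτ]
    exact (sumCoeff_eq_of_le (by omega) fun k hk => coeff_autT_eq_zero hτ _ hk).symm

theorem autOp_apply (hτ : τ.Integrates) (φ : PowAut n R) :
    autOp hτ φ = sumCoeff (weightBound n K W + 1) (autT τ φ) := rfl

theorem autOp_map (hτ : τ.Integrates) (h : R →ₐ[K] S) {φ : PowAut n R} {ψ : PowAut n S}
    (hψ : ∀ i, ψ.1 (X i) = MvPowerSeries.map h.toRingHom (φ.1 (X i))) :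
    autOp hτ ψ = Op.map h (autOp hτ φ) := by
  rw [autOp_apply, autOp_apply, autT_map h hψ, sumCoeff, sumCoeff, map_sum]
  simp only [PowerSeries.coeff_map]

/-- The representation of `Aut K[[X]]` that integrates the action of `L̂₊`. -/
def autRep (hτ : τ.Integrates) : PowAutRep K n W where
  act R _ _ :=
    { toFun := fun φ => (autOp hτ φ).app
      map_one' := congrArg Op.app (map_one (autOp hτ))
      map_mul' := fun φ ψ => congrArg Op.app (map_mul (autOp hτ) φ ψ) }
  act_baseChange h φ ψ hψ z := by
    have := Op.map_app h (autOp hτ φ) z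
    rw [← autOp_map hτ h hψ] at this
    exact this

theorem autOp_infAut (hτ : τ.Integrates) (η : PowDer n R)
    (hη : ∀ i, constantCoeff (η (X i)) = 0) :
    autOp hτ (R := DualNumber R) (infAut η hη) = 1 + Op.ep (rho K W η) := by
  rw [autOp_apply, autT_infAut hτ, sumCoeff]
  simp only [map_add, Finset.sum_add_distrib]
  congr 1
  · rw [Finset.sum_eq_single 0]
    · rw [PowerSeries.coeff_one, if_pos rfl]
    · intro k _ hk; rw [PowerSeries.coeff_one, if_neg hk]
    · simp
  · simp only [PowerSeries.coeff_mk]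
    rw [Finset.sum_range_succ, rhoCoeff_eq_zero_of_le K W le_rfl, Op.ep_zero, add_zero, rho_apply]
    exact (map_sum Op.epHom _ _).symm

theorem autRep_integrates (hτ : τ.Integrates) : (autRep hτ).Integrates := by
  intro η φ hφ w
  have h0 := LPlus.constantCoeff_X K η
  have h1 : φ = infAut η.1 h0 := ext_X fun i => (hφ i).trans (by
    rw [infAut_X, infFun, map_X]; rfl)
  have h2 : autOp hτ (R := DualNumber K) φ =
      1 + Op.ep (Op.ofEnd K (actEnd n K W η)) := by
    rw [h1, autOp_infAut hτ, rho_eq_baseChange K W (D₀ := η)]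
    intro i
    rw [show algebraMap K K = RingHom.id K from rfl, map_id]; rfl
  have h3 := congrArg (fun A : Op K W (DualNumber K) => A.app (1 ⊗ₜ w)) h2
  refine h3.trans ?_
  rw [Op.add_app, Op.one_app, Op.ep, Op.smul_app, Op.map_app_one, Op.ofEnd_app, actEnd_apply]
  simp [TensorProduct.smul_tmul']

end Integration

/-! ### The differential of an integrating representation over arbitrary rings. -/

section Differential

open MvPowerSeries PowAut

variable {K : Type u} [Field K] {n : ℕ} {W : Type u} [AddCommGroup W] [Module K W]
variable {R S : Type u} [CommRing R] [Algebra K R] [CommRing S] [Algebra K S]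

/-- The operators of a representation of `Aut K[[X]]`. -/
def PowAutRep.op (P : PowAutRep K n W) : PowAut n R →* Op K W R where
  toFun g := P.act R g
  map_one' := map_one (P.act R)
  map_mul' := map_mul (P.act R)

theorem PowAutRep.op_map (P : PowAutRep K n W) (h : R →ₐ[K] S) {φ : PowAut n R} {ψ : PowAut n S}
    (hψ : ∀ i, ψ.1 (X i) = MvPowerSeries.map h.toRingHom (φ.1 (X i))) :
    P.op ψ = Op.map h (P.op φ) :=
  Op.eq_map fun w => by
    have := P.act_baseChange h φ ψ hψ (1 ⊗ₜ w)
    rw [LinearMap.rTensor_tmul, AlgHom.toLinearMap_apply, map_one] at this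
    exact this

/-- The homomorphism of rings of dual numbers induced by a homomorphism. -/
def dualMap (f : R →ₐ[K] S) : DualNumber R →ₐ[K] DualNumber S :=
  DualNumber.lift ⟨((inlHom K S).comp f, DualNumber.eps), DualNumber.eps_mul_eps,
    fun _ => mul_comm _ _⟩

theorem dualMap_eps (f : R →ₐ[K] S) : dualMap f DualNumber.eps = DualNumber.eps :=
  DualNumber.lift_apply_eps _

theorem dualMap_inl (f : R →ₐ[K] S) (r : R) : dualMap f (inlR R r) = inlR S (f r) :=
  DualNumber.lift_apply_inl _ _

theorem map_dualMap_map_inlR (f : R →ₐ[K] S) (g : MvPowerSeries (Fin n) R) :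
    MvPowerSeries.map (dualMap f).toRingHom (MvPowerSeries.map (inlR R) g) =
      MvPowerSeries.map (inlR S) (MvPowerSeries.map f.toRingHom g) := by
  ext s : 1
  rw [coeff_map, coeff_map, coeff_map, coeff_map]
  exact dualMap_inl f _

theorem infAut_derMap_X (f : R →ₐ[K] S) (η : PowDer n R) (hη : ∀ i, constantCoeff (η (X i)) = 0)
    (hη' : ∀ i, constantCoeff (derMap f.toRingHom η (X i)) = 0) (i : Fin n) :
    (infAut (derMap f.toRingHom η) hη').1 (X i) =
      MvPowerSeries.map (dualMap f).toRingHom ((infAut η hη).1 (X i)) := by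
  rw [infAut_X, infAut_X, infFun, infFun, map_add, map_smul_series, map_dualMap_map_inlR,
    map_dualMap_map_inlR, derMap_X, map_X]
  have h : (dualMap f).toRingHom DualNumber.eps = DualNumber.eps := dualMap_eps f
  rw [h, map_X, map_X]

theorem Op.map_dualMap_one_add_ep (f : R →ₐ[K] S) (A : Op K W R) :
    Op.map (dualMap f) (1 + ep A) = 1 + ep (map f A) := by
  rw [map_add, map_one]
  congr 1
  have h : (dualMap f).comp (inlHom K R) = (inlHom K S).comp f :=
    AlgHom.ext fun r => dualMap_inl f r
  rw [ep, Op.map_smul, dualMap_eps, map_map, ep, map_map, h]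

theorem infAut_smul_monDer_X (s : Fin n →₀ ℕ) (i : Fin n) (r : R)
    (h : ∀ j, constantCoeff (monDer K s i (X j)) = 0)
    (h' : ∀ j, constantCoeff ((r • monDer R s i) (X j)) = 0) (j : Fin n) :
    (infAut (r • monDer R s i) h').1 (X j) =
      MvPowerSeries.map (dualScale K R r).toRingHom ((infAut (monDer K s i) h).1 (X j)) := by
  rw [infAut_X, infAut_X, infFun, infFun, map_add, map_smul_series, Derivation.smul_apply,
    map_smul_series, smul_smul, map_X, map_X, map_X]
  congr 1
  rw [monDer_X_map (algebraMap K R)]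
  have h1 : (dualScale K R r).toRingHom DualNumber.eps = DualNumber.eps * inlR R r :=
    dualScale_eps r
  rw [h1]
  congr 1
  ext s : 1
  rw [coeff_map, coeff_map, coeff_map, coeff_map]
  exact (dualScale_inl r _).symm

variable (K n) in
/-- The ring of coefficients of the universal derivation of order at least one. -/
abbrev UnivRing : Type u := MvPolynomial (Fin n × {s : Fin n →₀ ℕ // s ≠ 0}) K

variable (K n) in
open Classical in
/-- The values of the universal derivation on the variables. -/
def univSeries (i : Fin n) : MvPowerSeries (Fin n) (UnivRing K n) := fun s =>
  if h : s ≠ 0 then MvPolynomial.X (i, ⟨s, h⟩) else 0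

variable (K n) in
/-- The universal derivation of order at least one. -/
def univDer : PowDer n (UnivRing K n) := vecField (univSeries K n)

theorem coeff_univDer {s : Fin n →₀ ℕ} (hs : s ≠ 0) (i : Fin n) :
    coeff s (univDer K n (X i)) = MvPolynomial.X (i, ⟨s, hs⟩) := by
  rw [univDer, vecField_X]
  exact dif_pos hs

theorem constantCoeff_univDer (i : Fin n) : constantCoeff (univDer K n (X i)) = 0 := by
  rw [← coeff_zero_eq_constantCoeff_apply, univDer, vecField_X]
  change univSeries K n i 0 = 0
  simp [univSeries]

open Classical in
variable (K n) in
/-- The endomorphism of the universal ring that kills the variables outside a finite set. -/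
def killHom (t : Finset (Fin n × {s : Fin n →₀ ℕ // s ≠ 0})) : UnivRing K n →ₐ[K] UnivRing K n :=
  MvPolynomial.aeval fun a => if a ∈ t then MvPolynomial.X a else 0

theorem exists_killHom_eq (p : UnivRing K n) : ∃ t₀, ∀ t, t₀ ⊆ t → killHom K n t p = p := by
  classical
  induction p using MvPolynomial.induction_on with
  | C c => exact ⟨∅, fun t _ => MvPolynomial.aeval_C _ _⟩
  | add p q hp hq =>
    obtain ⟨a, ha⟩ := hp
    obtain ⟨b, hb⟩ := hq
    exact ⟨a ∪ b, fun t ht => by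
      rw [map_add, ha t (Finset.union_subset_left ht), hb t (Finset.union_subset_right ht)]⟩
  | mul_X p i hp =>
    obtain ⟨a, ha⟩ := hp
    refine ⟨insert i a, fun t ht => ?_⟩
    rw [map_mul, ha t ((Finset.subset_insert i a).trans ht), killHom, MvPolynomial.aeval_X,
      if_pos (ht (Finset.mem_insert_self i a))]

theorem exists_rTensor_killHom_eq (z : DualNumber (UnivRing K n) ⊗[K] W) : ∃ t₀, ∀ t, t₀ ⊆ t →
    (dualMap (killHom K n t)).toLinearMap.rTensor W z = z := by
  classical
  induction z using TensorProduct.induction_on with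
  | zero => exact ⟨∅, fun t _ => map_zero _⟩
  | add p q hp hq =>
    obtain ⟨a, ha⟩ := hp
    obtain ⟨b, hb⟩ := hq
    exact ⟨a ∪ b, fun t ht => by
      rw [map_add, ha t (Finset.union_subset_left ht), hb t (Finset.union_subset_right ht)]⟩
  | tmul p w =>
    obtain ⟨a, ha⟩ := exists_killHom_eq p.fst
    obtain ⟨b, hb⟩ := exists_killHom_eq p.snd
    refine ⟨a ∪ b, fun t ht => ?_⟩
    rw [LinearMap.rTensor_tmul, AlgHom.toLinearMap_apply]
    congr 1
    have hp : p = inlR _ p.fst + DualNumber.eps * inlR _ p.snd := by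
      ext <;> simp [inlR]
    conv_lhs => rw [hp]
    rw [map_add, map_mul, dualMap_eps, dualMap_inl, dualMap_inl,
      ha t (Finset.union_subset_left ht), hb t (Finset.union_subset_right ht), ← hp]

theorem derMap_killHom_univDer (t : Finset (Fin n × {s : Fin n →₀ ℕ // s ≠ 0})) :
    derMap (killHom K n t).toRingHom (univDer K n) =
      ∑ a ∈ t, (MvPolynomial.X a : UnivRing K n) • monDer (UnivRing K n) a.2.1 a.1 := by
  classical
  refine derivation_ext fun i => ?_
  rw [derMap_X, derivation_sum_apply]
  ext1 s
  rw [coeff_map, map_sum]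
  simp only [Derivation.smul_apply, coeff_smul, coeff_monDer_X]
  by_cases hs : s = 0
  · subst hs
    rw [coeff_zero_eq_constantCoeff_apply, constantCoeff_univDer, map_zero, Finset.sum_eq_zero]
    intro a _
    rw [if_neg (fun h => a.2.2 h.1.symm), mul_zero]
  · rw [coeff_univDer hs]
    have h1 : killHom K n t (MvPolynomial.X (i, ⟨s, hs⟩)) =
      if (i, ⟨s, hs⟩) ∈ t then MvPolynomial.X (i, ⟨s, hs⟩) else 0 := MvPolynomial.aeval_X _ _
    refine Eq.trans h1 ?_
    split_ifs with h
    · rw [Finset.sum_eq_single (i, ⟨s, hs⟩)]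
      · simp
      · rintro ⟨j, s', hs'⟩ _ hne
        rw [if_neg, mul_zero]
        rintro ⟨rfl, rfl⟩
        exact hne rfl
      · exact fun h' => absurd h h'
    · symm
      refine Finset.sum_eq_zero ?_
      rintro ⟨j, s', hs'⟩ ha
      rw [if_neg, mul_zero]
      rintro ⟨rfl, rfl⟩
      exact h ha

variable [LieRingModule (LPlus K n) W] [LieModule K (LPlus K n) W]

theorem constantCoeff_smul_monDer {s : Fin n →₀ ℕ} (hs : s ≠ 0) (i : Fin n) (r : R) (j : Fin n) :
    constantCoeff ((r • monDer R s i) (X j)) = 0 := by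
  classical
  rw [Derivation.smul_apply, ← coeff_zero_eq_constantCoeff_apply, coeff_smul, coeff_monDer_X,
    if_neg (fun h => hs h.1.symm), mul_zero]

variable {P : PowAutRep K n W}

variable [CharZero K] [Module.Finite K W]

theorem rho_derMap (h : R →ₐ[K] S) (D : PowDer n R) :
    rho K W (derMap h.toRingHom D) = Op.map h (rho K W D) :=
  Op.eq_map fun w => by
    rw [← rho_map K W h (derMap_X h.toRingHom D)]; simp

theorem rho_smul_monDer {s : Fin n →₀ ℕ} (hs : s ≠ 0) (i : Fin n) (r : R) :
    rho K W (r • monDer R s i) = r • Op.ofEnd R (actEnd n K W (LPlus.monomial K ⟨s, hs⟩ i)) := by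
  rw [map_smul, rho_eq_baseChange K W (D₀ := LPlus.monomial K ⟨s, hs⟩ i)]
  exact fun j => monDer_X_map _ s i j

/-- The point `1 + ε r X^s ∂/∂X_i` is the image of a point over the dual numbers of `K` under `ε ↦ r
ε`, and the hypothesis applies to that point. -/
theorem PowAutRep.Integrates.op_smul_monDer (hP : P.Integrates) {s : Fin n →₀ ℕ} (hs : s ≠ 0)
    (i : Fin n) (r : R) : P.op (R := DualNumber R) (infAut (r • monDer R s i)
      (constantCoeff_smul_monDer hs i r)) = 1 + Op.ep (rho K W (r • monDer R s i)) := by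
  have h0 : ∀ j, constantCoeff (monDer K s i (X j)) = 0 :=
    fun j => LPlus.constantCoeff_X K (LPlus.monomial K ⟨s, hs⟩ i) j
  rw [P.op_map (R := DualNumber K) (dualScale K R r)
    (infAut_smul_monDer_X s i r h0 (constantCoeff_smul_monDer hs i r))]
  refine (Op.eq_map fun w => ?_).symm
  have h4 : (P.op (R := DualNumber K) (infAut (monDer K s i) h0)).app (1 ⊗ₜ w) = _ :=
    hP (LPlus.monomial K ⟨s, hs⟩ i) _ (fun j => by rw [infAut_X, infFun, map_X]; rfl) w
  rw [h4, Op.add_app, Op.one_app, Op.ep, Op.smul_app, Op.map_app_one, rho_smul_monDer hs,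
    Op.smul_app, Op.ofEnd_app, actEnd_apply, map_add]
  simp only [LinearMap.rTensor_tmul, AlgHom.toLinearMap_apply, map_one, dualScale_eps,
    TensorProduct.smul_tmul', smul_eq_mul, mul_one]
  rfl

theorem constantCoeff_sum_der {ι : Type*} {t : Finset ι} {F : ι → PowDer n R}
    (hF : ∀ a ∈ t, ∀ j, constantCoeff (F a (X j)) = 0) (j : Fin n) :
    constantCoeff ((∑ a ∈ t, F a) (X j)) = 0 := by
  rw [derivation_sum_apply, map_sum]
  exact Finset.sum_eq_zero fun a ha => hF a ha j

/-- The map `η ↦ 1 + εη` takes sums to products, so finite sums follow from single terms. Infinite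
sums need the universal derivation. -/
theorem PowAutRep.Integrates.op_sum_monDer (hP : P.Integrates)
    (t : Finset (Fin n × {s : Fin n →₀ ℕ // s ≠ 0})) (c : Fin n × {s : Fin n →₀ ℕ // s ≠ 0} → R)
    {η : PowDer n R} (hη : ∀ i, constantCoeff (η (X i)) = 0)
    (h : η = ∑ a ∈ t, c a • monDer R a.2.1 a.1) :
    P.op (R := DualNumber R) (infAut η hη) = 1 + Op.ep (rho K W η) := by
  classical
  induction t using Finset.induction_on generalizing η with
  | empty =>
    rw [Finset.sum_empty] at h
    subst h
    rw [map_zero, Op.ep_zero, add_zero]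
    exact (congrArg _ (infAut_zero hη)).trans (map_one _)
  | insert a t ha ih =>
    rw [Finset.sum_insert ha] at h
    have h0 := constantCoeff_sum_der (t := t) (F := fun a => c a • monDer R a.2.1 a.1)
      fun a _ => constantCoeff_smul_monDer a.2.2 a.1 (c a)
    subst h
    rw [infAut_add _ _ (constantCoeff_smul_monDer a.2.2 a.1 (c a)) h0, map_mul,
      hP.op_smul_monDer a.2.2, ih h0 rfl, Op.one_add_ep_mul, map_add]

theorem rho_congr {D D' : PowDer n R} (h : ∀ i (s : Fin n →₀ ℕ), s ≠ 0 →
    s.degree ≤ weightBound n K W → coeff s (D (X i)) = coeff s (D' (X i))) :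
    rho K W D = rho K W D' := by
  rw [rho_apply, rho_apply]
  refine Finset.sum_congr rfl fun k hk => ?_
  rw [rhoCoeff_apply, rhoCoeff_apply]
  refine Finset.sum_congr rfl fun i _ => Finset.sum_congr rfl fun s hs => ?_
  rw [h i s (ne_zero_of_mem_degSet hs)
    (by rw [mem_degSet.1 hs]; have := Finset.mem_range.1 hk; omega)]

/-- The value of the operator on one vector involves finitely many variables of the universal ring.
Setting the remaining variables to zero does not change it, but turns the universal derivation into
a finite sum. -/
theorem PowAutRep.Integrates.op_univDer (hP : P.Integrates) :
    P.op (R := DualNumber (UnivRing K n)) (infAut (univDer K n) constantCoeff_univDer) =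
      1 + Op.ep (rho K W (univDer K n)) := by
  classical
  refine Op.ext fun w => ?_
  obtain ⟨t₀, ht₀⟩ := exists_rTensor_killHom_eq ((P.op (R := DualNumber (UnivRing K n))
    (infAut (univDer K n) constantCoeff_univDer)).app (1 ⊗ₜ w))
  -- The variables of degree up to the weight bound are kept too, so that `rho` does not change when
  -- the others are set to zero.
  let t₁ : Finset (Fin n × {s : Fin n →₀ ℕ // s ≠ 0}) := Finset.univ ×ˢ
    ((Finsupp.finite_of_degree_le (weightBound n K W)).toFinset.subtype fun s => s ≠ 0)
  have h1 := ht₀ (t₀ ∪ t₁) Finset.subset_union_left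
  set t := t₀ ∪ t₁ with ht
  have h0 := constantCoeff_derMap (killHom K n t).toRingHom (constantCoeff_univDer (K := K) (n := n))
  rw [← Op.map_app_one, ← P.op_map (dualMap (killHom K n t))
    (infAut_derMap_X (killHom K n t) _ constantCoeff_univDer h0),
    hP.op_sum_monDer t MvPolynomial.X h0 (derMap_killHom_univDer t)] at h1
  rw [← h1, rho_congr (D' := univDer K n)]
  intro i s hs hsd
  have hmem : (i, (⟨s, hs⟩ : {s : Fin n →₀ ℕ // s ≠ 0})) ∈ t := by
    rw [ht]
    refine Finset.mem_union_right _ (Finset.mem_product.2 ⟨Finset.mem_univ _, ?_⟩)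
    simpa using hsd
  rw [derMap_X, coeff_map, coeff_univDer hs]
  have h2 : killHom K n t (MvPolynomial.X (i, ⟨s, hs⟩)) =
    if (i, ⟨s, hs⟩) ∈ t then MvPolynomial.X (i, ⟨s, hs⟩) else 0 := MvPolynomial.aeval_X _ _
  exact h2.trans (if_pos hmem)

/-- A representation that integrates the action of `L̂₊` has the expected differential over every
ring of coefficients. -/
theorem PowAutRep.Integrates.op_infAut (hP : P.Integrates) {η : PowDer n R}
    (hη : ∀ i, constantCoeff (η (X i)) = 0) :
    P.op (R := DualNumber R) (infAut η hη) = 1 + Op.ep (rho K W η) := by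
  let f : UnivRing K n →ₐ[K] R := MvPolynomial.aeval fun a => coeff a.2.1 (η (X a.1))
  have h : η = derMap f.toRingHom (univDer K n) := derivation_ext fun i => by
    rw [derMap_X]
    ext s
    rw [coeff_map]
    by_cases hs : s = 0
    · subst hs
      rw [coeff_zero_eq_constantCoeff_apply, coeff_zero_eq_constantCoeff_apply, hη,
        constantCoeff_univDer, map_zero]
    · rw [coeff_univDer hs]
      exact (MvPolynomial.aeval_X (fun a : Fin n × {s : Fin n →₀ ℕ // s ≠ 0} => coeff a.2.1 (η (X a.1)))
        (i, ⟨s, hs⟩)).symm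
  -- The proof argument of `infAut` depends on the derivation, so the derivation is generalized
  -- before it is replaced by the base change of the universal one.
  have key {η' : PowDer n R} (hη' : ∀ i, constantCoeff (η' (X i)) = 0)
      (h : η' = derMap f.toRingHom (univDer K n)) :
      P.op (R := DualNumber R) (infAut η' hη') = 1 + Op.ep (rho K W η') := by
    subst h
    rw [P.op_map (dualMap f) (infAut_derMap_X f _ constantCoeff_univDer hη'), hP.op_univDer,
      Op.map_dualMap_one_add_ep, rho_derMap]
  exact key hη h

end Differential

/-! ### Taylor expansions and changes of coordinates. -/

section Taylor

open MvPowerSeries PowAut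

variable {K : Type*} [Field K] {n : ℕ} {B : Type*} [CommRing B] [Algebra K B]

variable (K n B) in
/-- Uniformizing parameters `x_i` with the commuting derivations `∂/∂x_i`, which form a basis of
the module of derivations. -/
structure Coords where
  x : Fin n → B
  d : Fin n → Derivation K B B
  d_x : ∀ i j, d i (x j) = if i = j then 1 else 0
  comm : ∀ i j b, d i (d j b) = d j (d i b)
  eq_sum : ∀ (η : Derivation K B B) (b : B), η b = ∑ i, η (x i) * d i b

/-- Because the factors commute, one more factor `a i` can be moved to the right end of the ordered
product. -/
theorem prod_map_pow_add_single {M : Type*} [Monoid M] {n : ℕ} (a : Fin n → M)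
    (ha : ∀ i j, Commute (a i) (a j)) (s : Fin n →₀ ℕ) (i : Fin n) (l : List (Fin n))
    (hl : l.Nodup) : (l.map fun j => a j ^ (s + Finsupp.single i 1 : Fin n →₀ ℕ) j).prod =
      (l.map fun j => a j ^ s j).prod * (if i ∈ l then a i else 1) := by
  induction l with
  | nil => simp
  | cons j l ih =>
    rw [List.nodup_cons] at hl
    rw [List.map_cons, List.prod_cons, ih hl.2, List.map_cons, List.prod_cons]
    by_cases hij : i = j
    · subst hij
      rw [if_neg hl.1, mul_one, if_pos List.mem_cons_self, Finsupp.add_apply,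
        Finsupp.single_eq_same, pow_succ, mul_assoc, mul_assoc]
      congr 1
      have : Commute (a i) (l.map fun j => a j ^ s j).prod :=
        Commute.list_prod_right _ _ fun y hy => by
          obtain ⟨j, -, rfl⟩ := List.mem_map.1 hy
          exact (ha i j).pow_right _
      exact this.eq
    · have h1 : (s + Finsupp.single i 1 : Fin n →₀ ℕ) j = s j := by
        rw [Finsupp.add_apply, Finsupp.single_eq_of_ne (Ne.symm hij), add_zero]
      rw [h1, mul_assoc]
      simp [List.mem_cons, hij]

theorem iterDer_zero (d : Fin n → Derivation K B B) (f : B) : iterDer d 0 f = f := by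
  have : iterDer d 0 = 1 := List.prod_eq_one fun y hy => by
    obtain ⟨i, rfl⟩ := (List.mem_ofFn' _ _).1 hy
    simp
  rw [this]; rfl

theorem iterDer_add_single {d : Fin n → Derivation K B B}
    (hd : ∀ i j b, d i (d j b) = d j (d i b)) (s : Fin n →₀ ℕ) (i : Fin n) (f : B) :
    iterDer d (s + Finsupp.single i 1) f = iterDer d s (d i f) := by
  have h := prod_map_pow_add_single (fun i => (d i : Module.End K B))
    (fun i j => LinearMap.ext fun b => hd i j b) s i (List.finRange n) (List.nodup_finRange n)
  rw [if_pos (List.mem_finRange i)] at h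
  rw [iterDer, iterDer, List.ofFn_eq_map, List.ofFn_eq_map, h]
  rfl

theorem coeff_taylor (d : Fin n → Derivation K B B) (s : Fin n →₀ ℕ) (f : B) :
    coeff s (taylor d f) = taylorCoeff d s f := rfl

theorem constantCoeff_taylor (d : Fin n → Derivation K B B) (f : B) :
    constantCoeff (taylor d f) = f := by
  rw [← coeff_zero_eq_constantCoeff_apply, coeff_taylor, taylorCoeff, iterDer_zero]
  simp

theorem taylor_add (d : Fin n → Derivation K B B) (f g : B) :
    taylor d (f + g) = taylor d f + taylor d g := by
  ext s
  simp only [coeff_taylor, taylorCoeff, map_add, smul_add]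

theorem taylor_zero (d : Fin n → Derivation K B B) : taylor d (0 : B) = 0 := by
  ext s
  simp only [coeff_taylor, taylorCoeff, map_zero, smul_zero]

/-- A derivation of the ring of coefficients, applied to power series. -/
def coeffDer (η : Derivation K B B) (f : MvPowerSeries (Fin n) B) : MvPowerSeries (Fin n) B :=
  fun s => η (coeff s f)

theorem coeff_coeffDer (η : Derivation K B B) (f : MvPowerSeries (Fin n) B) (s : Fin n →₀ ℕ) :
    coeff s (coeffDer η f) = η (coeff s f) := rfl

theorem coeffDer_sub (η : Derivation K B B) (f g : MvPowerSeries (Fin n) B) :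
    coeffDer η (f - g) = coeffDer η f - coeffDer η g := by
  ext s; simp [coeff_coeffDer]

theorem coeffDer_C (η : Derivation K B B) (b : B) :
    coeffDer η (C b : MvPowerSeries (Fin n) B) = C (η b) := by
  classical
  ext s
  rw [coeff_coeffDer, coeff_C, coeff_C]
  split_ifs <;> simp

theorem pderiv_coeffDer (η : Derivation K B B) (f : MvPowerSeries (Fin n) B) (i : Fin n) :
    pderiv B i (coeffDer η f) = coeffDer η (pderiv B i f) := by
  ext s
  rw [coeff_pderiv, coeff_coeffDer, coeff_coeffDer, coeff_pderiv, Derivation.leibniz]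
  have : η ((s i : B) + 1) = 0 := by
    rw [map_add, Derivation.map_natCast, Derivation.map_one_eq_zero, add_zero]
  rw [this, smul_zero, zero_add, smul_eq_mul, mul_comm]

variable [CharZero K]

theorem pderiv_taylor {d : Fin n → Derivation K B B}
    (hd : ∀ i j b, d i (d j b) = d j (d i b)) (i : Fin n) (f : B) :
    pderiv B i (taylor d f) = taylor d (d i f) := by
  ext s
  rw [coeff_pderiv, coeff_taylor, coeff_taylor, taylorCoeff, taylorCoeff, iterDer_add_single hd]
  have h1 : (∏ j, ((s + Finsupp.single i 1 : Fin n →₀ ℕ) j).factorial) =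
      (s i + 1) * ∏ j, (s j).factorial := by
    classical
    rw [← Finset.mul_prod_erase _ _ (Finset.mem_univ i),
      ← Finset.mul_prod_erase Finset.univ (fun j => (s j).factorial) (Finset.mem_univ i), ← mul_assoc,
      Finsupp.add_apply, Finsupp.single_eq_same, Nat.factorial_succ]
    congr 1
    refine Finset.prod_congr rfl fun j hj => ?_
    rw [Finsupp.add_apply, Finsupp.single_eq_of_ne (Finset.ne_of_mem_erase hj), add_zero]
  have h2 : ((s i : B) + 1) = algebraMap K B (s i + 1) := by simp
  rw [h1, h2, mul_comm, ← Algebra.smul_def, smul_smul]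
  congr 1
  have h3 : ((s i : K) + 1) ≠ 0 := by exact_mod_cast Nat.succ_ne_zero (s i)
  push_cast
  rw [mul_inv, ← mul_assoc, mul_inv_cancel₀ h3, one_mul]

theorem mem_ordIdeal_succ_of_pderiv (K : Type*) [Field K] [CharZero K] [Algebra K B] {k : ℕ} {f : MvPowerSeries (Fin n) B}
    (h0 : constantCoeff f = 0) (h : ∀ i, pderiv B i f ∈ ordIdeal n B k) :
    f ∈ ordIdeal n B (k + 1) := by
  intro s hs
  by_cases hs0 : s = 0
  · rw [hs0, coeff_zero_eq_constantCoeff_apply, h0]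
  · obtain ⟨i, hi⟩ : ∃ i, s i ≠ 0 := by
      by_contra! h'
      exact hs0 (Finsupp.ext h')
    have hle : Finsupp.single i 1 ≤ s := Finsupp.single_le_iff.2 (Nat.one_le_iff_ne_zero.2 hi)
    obtain ⟨t, rfl⟩ : ∃ t, s = t + Finsupp.single i 1 :=
      ⟨_, (tsub_add_cancel_of_le hle).symm⟩
    have h1 := h i t (by rw [map_add, Finsupp.degree_single] at hs; omega)
    rw [coeff_pderiv] at h1
    refine nsmul_eq_zero_of_algebra K (k := t i + 1) (Nat.succ_ne_zero _) ?_
    rw [nsmul_eq_mul, mul_comm]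
    exact_mod_cast h1

/-- A family of power series without constant terms which satisfies a homogeneous system of linear
differential equations vanishes. -/
theorem eq_zero_of_pderiv (K : Type*) [Field K] [CharZero K] [Algebra K B] {ι : Type*} {F : ι → MvPowerSeries (Fin n) B}
    (h0 : ∀ a, constantCoeff (F a) = 0)
    (h : ∀ k, (∀ a, F a ∈ ordIdeal n B k) → ∀ a i, pderiv B i (F a) ∈ ordIdeal n B k) (a : ι) :
    F a = 0 := by
  have key (k : ℕ) : ∀ a, F a ∈ ordIdeal n B k := by
    induction k with
    | zero => exact fun a => mem_ordIdeal_zero _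
    | succ k ih => exact fun a => mem_ordIdeal_succ_of_pderiv K (h0 a) (h k ih a)
  exact eq_zero_of_forall_mem_ordIdeal fun k => key k a

/-- The errors `F(f, g) = T(fg) - T(f) T(g)`, with `T` the Taylor expansion, have no constant term
and satisfy `∂_i F(f, g) = F(f, ∂_i g) + F(g, ∂_i f)`. So all of them vanish together. -/
theorem taylor_mul {d : Fin n → Derivation K B B}
    (hd : ∀ i j b, d i (d j b) = d j (d i b)) (f g : B) :
    taylor d (f * g) = taylor d f * taylor d g := by
  refine sub_eq_zero.1 (eq_zero_of_pderiv K
    (F := fun p : B × B => taylor d (p.1 * p.2) - taylor d p.1 * taylor d p.2) (fun p => ?_)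
    (fun k hk p i => ?_) (f, g))
  · rw [map_sub, map_mul, constantCoeff_taylor, constantCoeff_taylor, constantCoeff_taylor, sub_self]
  · have h1 := hk (p.1, d i p.2)
    have h2 := hk (p.2, d i p.1)
    dsimp only at h1 h2
    convert add_mem h1 h2 using 1
    rw [map_sub, Derivation.leibniz, pderiv_taylor hd, pderiv_taylor hd, pderiv_taylor hd,
      Derivation.leibniz, taylor_add, smul_eq_mul, smul_eq_mul, smul_eq_mul, smul_eq_mul]
    ring

theorem taylor_algebraMap {d : Fin n → Derivation K B B}
    (hd : ∀ i j b, d i (d j b) = d j (d i b)) (c : K) :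
    taylor d (algebraMap K B c) = C (algebraMap K B c) := by
  refine sub_eq_zero.1 (eq_zero_of_pderiv K
    (F := fun _ : Unit => taylor d (algebraMap K B c) - C (algebraMap K B c)) (fun p => ?_)
    (fun k hk p i => ?_) ())
  · rw [map_sub, constantCoeff_taylor, constantCoeff_C, sub_self]
  · have h1 : pderiv B i (C (algebraMap K B c)) = 0 := (pderiv B i).map_algebraMap _
    rw [map_sub, pderiv_taylor hd, Derivation.map_algebraMap, taylor_zero, h1, sub_zero]
    exact zero_mem _

namespace Coords

variable (c : Coords K n B)

/-- The Taylor expansion as a homomorphism of algebras. -/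
def taylorHom : B →+* MvPowerSeries (Fin n) B where
  toFun := taylor c.d
  map_one' := by
    have := taylor_algebraMap c.comm (1 : K)
    rwa [map_one, map_one] at this
  map_zero' := taylor_zero c.d
  map_add' := taylor_add c.d
  map_mul' := taylor_mul c.comm

theorem constantCoeff_taylorHom (f : B) : constantCoeff (c.taylorHom f) = f :=
  constantCoeff_taylor c.d f

theorem pderiv_taylorHom (i : Fin n) (f : B) :
    pderiv B i (c.taylorHom f) = c.taylorHom (c.d i f) := pderiv_taylor c.comm i f

theorem taylorHom_algebraMap (r : K) : c.taylorHom (algebraMap K B r) = C (algebraMap K B r) :=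
  taylor_algebraMap c.comm r

theorem taylorHom_x (i : Fin n) : c.taylorHom (c.x i) = C (c.x i) + X i := by
  refine sub_eq_zero.1 (eq_zero_of_pderiv K
    (F := fun _ : Unit => c.taylorHom (c.x i) - (C (c.x i) + X i)) (fun p => ?_)
    (fun k hk p j => ?_) ())
  · simp [constantCoeff_taylorHom]
  · classical
    have h1 : pderiv B j (C (c.x i)) = 0 := (pderiv B j).map_algebraMap _
    rw [map_sub, map_add, h1, zero_add, pderiv_taylorHom, c.d_x, pderiv_X, Pi.single_apply]
    by_cases h : j = i
    · rw [if_pos h, if_pos h.symm, map_one, sub_self]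
      exact zero_mem _
    · rw [if_neg h, if_neg (Ne.symm h), map_zero, sub_self]
      exact zero_mem _

/-- The increment `f(x + X) - f(x)`. -/
def incr (f : B) : MvPowerSeries (Fin n) B := c.taylorHom f - C f

theorem constantCoeff_incr (f : B) : constantCoeff (c.incr f) = 0 := by
  rw [incr, map_sub, constantCoeff_taylorHom, constantCoeff_C, sub_self]

/-- The substitution `X_i ↦ x_i(y + Y) - x_i(y)`. -/
def transHom (c c' : Coords K n B) : MvPowerSeries (Fin n) B →ₐ[B] MvPowerSeries (Fin n) B :=
  substHom (fun i => c'.incr (c.x i)) fun _ => c'.constantCoeff_incr _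

theorem transHom_X (c c' : Coords K n B) (i : Fin n) : transHom c c' (X i) = c'.incr (c.x i) :=
  substHom_X _ _ i

/-- The Taylor expansions in two coordinate systems differ by the substitution. -/
theorem transHom_taylorHom (c c' : Coords K n B) (f : B) :
    transHom c c' (c.taylorHom f) = c'.taylorHom f := by
  have hX (i : Fin n) : constantCoeff (transHom c c' (X i)) = 0 := by
    rw [transHom_X, constantCoeff_incr]
  refine sub_eq_zero.1 (eq_zero_of_pderiv K
    (F := fun f => transHom c c' (c.taylorHom f) - c'.taylorHom f) (fun f => ?_)
    (fun k hk f j => ?_) f)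
  · rw [map_sub, constantCoeff_algHom _ hX, constantCoeff_taylorHom, constantCoeff_taylorHom,
      sub_self]
  · have h1 : pderiv B j (transHom c c' (c.taylorHom f)) =
        ∑ i, c'.taylorHom (c'.d j (c.x i)) * transHom c c' (c.taylorHom (c.d i f)) := by
      have := leibniz_eq_sum (α := (transHom c c').toRingHom) hX
        ((pderiv B j).toLinearMap.toAddMonoidHom.comp (transHom c c').toRingHom.toAddMonoidHom)
        (fun f g => by
          change pderiv B j (transHom c c' (f * g)) = transHom c c' f * pderiv B j (transHom c c' g) +
            transHom c c' g * pderiv B j (transHom c c' f)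
          rw [map_mul, Derivation.leibniz]; rfl)
        (fun r => by
          change pderiv B j (transHom c c' (C r)) = 0
          rw [show transHom c c' (C r) = C r from (transHom c c').commutes r]
          exact (pderiv B j).map_algebraMap _) (c.taylorHom f)
      refine this.trans (Finset.sum_congr rfl fun i _ => ?_)
      change pderiv B j (transHom c c' (X i)) * transHom c c' (pderiv B i (c.taylorHom f)) = _
      rw [pderiv_taylorHom, transHom_X, incr, map_sub, pderiv_taylorHom,
        show pderiv B j (C (c.x i)) = 0 from (pderiv B j).map_algebraMap _, sub_zero]
    rw [map_sub, h1, pderiv_taylorHom, c.eq_sum (c'.d j) f, map_sum, ← Finset.sum_sub_distrib]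
    refine Ideal.sum_mem _ fun i _ => ?_
    rw [map_mul, ← mul_sub]
    exact Ideal.mul_mem_left _ _ (hk _)

theorem transHom_transHom_X (c c' : Coords K n B) (i : Fin n) :
    transHom c c' (transHom c' c (X i)) = X i := by
  rw [transHom_X, incr, map_sub, transHom_taylorHom,
    show transHom c c' (C (c'.x i)) = C (c'.x i) from (transHom c c').commutes _, taylorHom_x,
    add_sub_cancel_left]

/-- The automorphism `X_i ↦ x_i(y + Y) - x_i(y)`. -/
def trans (c c' : Coords K n B) : PowAut n B :=
  PowAut.ofSubst (fun i => c'.incr (c.x i)) (fun i => c.incr (c'.x i))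
    (fun _ => c'.constantCoeff_incr _) (fun _ => c.constantCoeff_incr _)
    (fun i => by rw [← transHom_X c' c i]; exact transHom_transHom_X c c' i)
    (fun i => by rw [← transHom_X c c' i]; exact transHom_transHom_X c' c i)

theorem trans_X (c c' : Coords K n B) (i : Fin n) : (trans c c').1 (X i) = c'.incr (c.x i) :=
  PowAut.ofSubst_X _ _ _ _ _ _ i

theorem trans_taylorHom (c c' : Coords K n B) (f : B) :
    (trans c c').1 (c.taylorHom f) = c'.taylorHom f := transHom_taylorHom c c' f

theorem trans_incr (c c' : Coords K n B) (f : B) : (trans c c').1 (c.incr f) = c'.incr f := by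
  rw [incr, map_sub, trans_taylorHom, PowAut.apply_C, incr]

/-- Each transition carries the increments of one coordinate system to those of another, so it
suffices to compare the images of the variables, which are such increments. This is the cocycle
condition of the bundle. -/
theorem trans_mul_trans (c c' c'' : Coords K n B) :
    trans c' c'' * trans c c' = trans c c'' := PowAut.ext_X fun i => by
  rw [PowAut.mul_apply, trans_X, trans_X, trans_incr]

theorem trans_self (c : Coords K n B) : trans c c = 1 := PowAut.ext_X fun i => by
  rw [trans_X, incr, taylorHom_x, add_sub_cancel_left, PowAut.one_apply]

/-- The derivation `∑ (η_i(x + X) - η_i(x)) ∂/∂X_i` for a vector field `η = ∑ η_i ∂/∂x_i`. -/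
def vert (η : Derivation K B B) : PowDer n B := vecField fun i => c.incr (η (c.x i))

theorem vert_X (η : Derivation K B B) (i : Fin n) : c.vert η (X i) = c.incr (η (c.x i)) :=
  vecField_X _ _

theorem constantCoeff_vert (η : Derivation K B B) (i : Fin n) :
    constantCoeff (c.vert η (X i)) = 0 := by rw [vert_X, constantCoeff_incr]

theorem vert_taylorHom (η : Derivation K B B) (f : B) :
    c.vert η (c.taylorHom f) = ∑ i, c.incr (η (c.x i)) * c.taylorHom (c.d i f) := by
  rw [derivation_eq_sum]
  simp only [vert_X, pderiv_taylorHom]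

/-- The error for `f` has no constant term, and its partial derivatives are the errors for the `∂_j
f`. So `η` on coefficients plus the vertical part lifts `η` through the Taylor expansion. -/
theorem coeffDer_add_vert_taylorHom (η : Derivation K B B) (f : B) :
    coeffDer η (c.taylorHom f) + c.vert η (c.taylorHom f) = c.taylorHom (η f) := by
  refine sub_eq_zero.1 (eq_zero_of_pderiv K
    (F := fun f => coeffDer η (c.taylorHom f) + c.vert η (c.taylorHom f) - c.taylorHom (η f))
    (fun f => ?_) (fun k hk f j => ?_) f)
  · rw [map_sub, map_add, vert_taylorHom, map_sum, Finset.sum_eq_zero, add_zero,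
      ← coeff_zero_eq_constantCoeff_apply, coeff_coeffDer, coeff_zero_eq_constantCoeff_apply,
      constantCoeff_taylorHom, constantCoeff_taylorHom, sub_self]
    intro i _
    rw [map_mul, constantCoeff_incr, zero_mul]
  · convert hk (c.d j f) using 1
    have h1 : pderiv B j (c.vert η (c.taylorHom f)) =
        ∑ i, c.taylorHom (c.d j (η (c.x i))) * c.taylorHom (c.d i f) +
          c.vert η (c.taylorHom (c.d j f)) := by
      rw [vert_taylorHom, vert_taylorHom, map_sum, ← Finset.sum_add_distrib]
      refine Finset.sum_congr rfl fun i _ => ?_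
      rw [Derivation.leibniz, pderiv_taylorHom, incr, map_sub, pderiv_taylorHom,
        show pderiv B j (C (η (c.x i))) = 0 from (pderiv B j).map_algebraMap _, sub_zero, c.comm j i]
      simp only [smul_eq_mul]
      ring
    have h2 : c.taylorHom (c.d j (η f)) =
        ∑ i, c.taylorHom (c.d j (η (c.x i))) * c.taylorHom (c.d i f) +
          c.taylorHom (η (c.d j f)) := by
      rw [c.eq_sum η f, c.eq_sum η (c.d j f), map_sum, map_sum, map_sum, ← Finset.sum_add_distrib]
      refine Finset.sum_congr rfl fun i _ => ?_
      rw [Derivation.leibniz, map_add, smul_eq_mul, smul_eq_mul, map_mul, map_mul, map_mul,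
        c.comm j i]
      ring
    rw [map_sub, map_add, pderiv_coeffDer, pderiv_taylorHom, pderiv_taylorHom, h1, h2]
    abel

end Coords

end Taylor

/-! ### The action of vector fields on `B ⊗ W` and its independence of coordinates. -/

section Action

open MvPowerSeries PowAut

variable {K : Type u} [Field K] {n : ℕ} {W : Type u} [AddCommGroup W] [Module K W]
variable {B B' : Type u} [CommRing B'] [Algebra K B'] [CommRing B] [Algebra K B]

/-- The action of a derivation of `B` on the first factor of `B ⊗ W`. -/
def derAct (η : Derivation K B B) : B ⊗[K] W →ₗ[K] B ⊗[K] W := (η : B →ₗ[K] B).rTensor W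

theorem derAct_tmul (η : Derivation K B B) (b : B) (w : W) :
    derAct η (b ⊗ₜ[K] w) = η b ⊗ₜ w := rfl

theorem derAct_smul (η : Derivation K B B) (b : B) (z : B ⊗[K] W) :
    derAct η (b • z) = η b • z + b • derAct η z := by
  induction z using TensorProduct.induction_on with
  | zero => simp
  | add x y hx hy => simp only [smul_add, map_add, hx, hy]; abel
  | tmul g w =>
    simp only [TensorProduct.smul_tmul', derAct_tmul, smul_eq_mul, Derivation.leibniz,
      TensorProduct.add_tmul, mul_comm g]
    rw [add_comm]

theorem derAct_app (η : Derivation K B B) (A : Op K W B) (z : B ⊗[K] W) :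
    derAct η (A.app z) = (Op.der η A).app z + A.app (derAct η z) := by
  induction z using TensorProduct.induction_on with
  | zero => simp
  | add x y hx hy => simp only [map_add, hx, hy]; abel
  | tmul b w =>
    rw [derAct_tmul, Op.app_tmul, Op.app_tmul A (η b), Op.app_tmul _ b, Op.der_app, derAct_smul,
      add_comm]
    rfl

theorem derAct_lie (η μ : Derivation K B B) (z : B ⊗[K] W) :
    derAct ⁅η, μ⁆ z = derAct η (derAct μ z) - derAct μ (derAct η z) := by
  induction z using TensorProduct.induction_on with
  | zero => simp
  | add x y hx hy => simp only [map_add, hx, hy]; abel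
  | tmul b w => simp only [derAct_tmul, Derivation.commutator_apply, TensorProduct.sub_tmul]

variable [LieRingModule (LPlus K n) W] [LieModule K (LPlus K n) W]
variable [CharZero K] [Module.Finite K W]

theorem rho_add_eps (D D' : PowDer n B) :
    rho K W (derMap (inlR B) D + (DualNumber.eps : DualNumber B) • derMap (inlR B) D') =
      Op.inl (rho K W D) + Op.ep (rho K W D') := by
  have h (D : PowDer n B) : rho K W (derMap (inlR B) D) =
    Op.map (inlHom K B) (rho K W D) := rho_derMap (inlHom K B) D
  rw [map_add, map_smul, h, h]
  rfl

/-- `rho` commutes with base change; base change along `r ↦ r + ε η(r)` gives the derivative as the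
`ε`-part. -/
theorem der_rho (η : Derivation K B B) (D : PowDer n B) :
    Op.der η (rho K W D) = rho K W (vecField fun i => coeffDer η (D (X i))) := by
  have h1 : derMap (derHom K η).toRingHom D = derMap (inlR B) D + (DualNumber.eps : DualNumber B) •
      derMap (inlR B) (vecField fun i => coeffDer η (D (X i))) := derivation_ext fun i => by
    rw [Derivation.add_apply, Derivation.smul_apply, derMap_X, derMap_X, derMap_X, vecField_X]
    ext1 s
    rw [map_add, coeff_smul, coeff_map, coeff_map, coeff_map, coeff_coeffDer]
    exact derHom_apply η _
  have h2 := rho_derMap (W := W) (derHom K η) D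
  rw [h1, rho_add_eps, Op.map_derHom_eq] at h2
  exact (Op.inl_add_ep_injective h2).2.symm

theorem rho_eq_sumCoeff (D : PowDer n B) :
    rho K W D = sumCoeff (weightBound n K W) (rhoT K W D) := by
  rw [rho_apply, sumCoeff]
  simp only [coeff_rhoT]

/-- Evaluation at `t = 1` of the bracket relation for the generating functions, which are
polynomials by the weight bound. -/
theorem rho_lie {D D' : PowDer n B} (hD : ∀ i, constantCoeff (D (X i)) = 0)
    (hD' : ∀ i, constantCoeff (D' (X i)) = 0) :
    rho K W ⁅D, D'⁆ = rho K W D * rho K W D' - rho K W D' * rho K W D := by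
  have h (D : PowDer n B) (k : ℕ) (hk : weightBound n K W ≤ k) :
      PowerSeries.coeff k (rhoT K W D) = 0 := by
    rw [coeff_rhoT, rhoCoeff_eq_zero_of_le K W hk]
  rw [rho_eq_sumCoeff, rho_eq_sumCoeff, rho_eq_sumCoeff, ← sumCoeff_mul (h D) (h D'),
    ← sumCoeff_mul (h D') (h D), ← sumCoeff_eq_of_le (Nat.le_mul_of_pos_left _ two_pos) (h _),
    rhoT_lie K W hD hD', sumCoeff, sumCoeff, sumCoeff, ← Finset.sum_sub_distrib]
  simp only [map_sub]

namespace Coords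

variable (c : Coords K n B)

variable (W) in
/-- The action of a vector field on `B ⊗ W`. -/
def vecAct (η : Derivation K B B) : B ⊗[K] W →ₗ[K] B ⊗[K] W :=
  derAct η + (rho K W (c.vert η)).app.restrictScalars K

theorem vecAct_apply (η : Derivation K B B) (z : B ⊗[K] W) :
    c.vecAct W η z = derAct η z + (rho K W (c.vert η)).app z := rfl

theorem incr_add (f g : B) : c.incr (f + g) = c.incr f + c.incr g := by
  rw [incr, incr, incr, map_add, map_add]; abel

theorem incr_sub (f g : B) : c.incr (f - g) = c.incr f - c.incr g := by
  rw [incr, incr, incr, map_sub, map_sub]; abel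

theorem vert_add (η μ : Derivation K B B) : c.vert (η + μ) = c.vert η + c.vert μ :=
  derivation_ext fun i => by
    rw [Derivation.add_apply, vert_X, vert_X, vert_X, Derivation.add_apply, incr_add]

theorem vert_smul (r : K) (η : Derivation K B B) :
    c.vert (r • η) = algebraMap K B r • c.vert η := derivation_ext fun i => by
  rw [Derivation.smul_apply, vert_X, vert_X, Derivation.smul_apply, incr, incr, Algebra.smul_def,
    map_mul, map_mul, taylorHom_algebraMap, smul_eq_C_mul, mul_sub]

theorem vecAct_add (η μ : Derivation K B B) (z : B ⊗[K] W) :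
    c.vecAct W (η + μ) z = c.vecAct W η z + c.vecAct W μ z := by
  have h : derAct (η + μ) z = derAct η z + derAct μ z := by
    rw [derAct, Derivation.coe_add_linearMap, LinearMap.rTensor_add]; rfl
  rw [vecAct_apply, vecAct_apply, vecAct_apply, vert_add, map_add, Op.add_app, h]
  abel

theorem vecAct_ksmul (r : K) (η : Derivation K B B) (z : B ⊗[K] W) :
    c.vecAct W (r • η) z = r • c.vecAct W η z := by
  have h : derAct (r • η) z = r • derAct η z := by
    rw [derAct, Derivation.coe_smul_linearMap, LinearMap.rTensor_smul]; rfl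
  rw [vecAct_apply, vecAct_apply, vert_smul, map_smul, Op.smul_app, h, smul_add, algebraMap_smul]

theorem vecAct_smul (η : Derivation K B B) (b : B) (z : B ⊗[K] W) :
    c.vecAct W η (b • z) = η b • z + b • c.vecAct W η z := by
  rw [vecAct_apply, vecAct_apply, derAct_smul, map_smul, smul_add, add_assoc]

/-- The lift of `η` to power series is `η` on coefficients plus its vertical part. Applying the
lifts of `η` and `μ` in turn to the Taylor expansion of `x_i` and comparing gives the formula. -/
theorem vert_lie (η μ : Derivation K B B) : c.vert ⁅η, μ⁆ =
    (vecField fun i => coeffDer η (c.vert μ (X i))) - (vecField fun i => coeffDer μ (c.vert η (X i))) +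
      ⁅c.vert η, c.vert μ⁆ := derivation_ext fun i => by
  have hC (η : Derivation K B B) (b : B) : c.vert η (C b) = 0 := (c.vert η).map_algebraMap b
  rw [Derivation.add_apply, Derivation.sub_apply, vecField_X, vecField_X,
    Derivation.commutator_apply, vert_X, vert_X, vert_X, Derivation.commutator_apply, incr_sub,
    incr, incr, incr, incr, coeffDer_sub, coeffDer_sub, map_sub, map_sub, hC, hC, sub_zero, sub_zero,
    coeffDer_C, coeffDer_C, ← coeffDer_add_vert_taylorHom c η (μ _),
    ← coeffDer_add_vert_taylorHom c μ (η _)]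
  abel

/-- The cross terms of the commutator are derivatives of operators, `η(ρ(μ^v)) - μ(ρ(η^v))`. They
account for the first two terms of `vert_lie`, and `rho_lie` accounts for the third. -/
theorem vecAct_lie (η μ : Derivation K B B) (z : B ⊗[K] W) : c.vecAct W ⁅η, μ⁆ z =
    c.vecAct W η (c.vecAct W μ z) - c.vecAct W μ (c.vecAct W η z) := by
  simp only [vecAct_apply]
  rw [vert_lie, map_add, map_sub, ← der_rho, ← der_rho, rho_lie (c.constantCoeff_vert η)
    (c.constantCoeff_vert μ), Op.add_app, Op.sub_app, Op.sub_app, Op.mul_app, Op.mul_app, derAct_lie]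
  simp only [map_add, derAct_app]
  abel

/-- The automorphisms of power series which express the invariance of the action. -/
theorem trans_mul_infAut (c c' : Coords K n B) (η : Derivation K B B) :
    baseChange (inlR B) (trans c c') * infAut (c.vert η) (c.constantCoeff_vert η) =
      infAut (c'.vert η) (c'.constantCoeff_vert η) *
        baseChange (derHom K η).toRingHom (trans c c') := PowAut.ext_X fun i => by
  have h1 (f : MvPowerSeries (Fin n) B) : MvPowerSeries.map (derHom K η).toRingHom f =
      MvPowerSeries.map (inlR B) f +
        (DualNumber.eps : DualNumber B) • MvPowerSeries.map (inlR B) (coeffDer η f) := by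
    ext1 s
    rw [map_add, coeff_smul, coeff_map, coeff_map, coeff_map, coeff_coeffDer]
    exact derHom_apply η _
  have hC (b : B) : c'.vert η (C b) = 0 := (c'.vert η).map_algebraMap b
  have h2 : coeffDer η (c'.incr (c.x i)) + c'.vert η (c'.incr (c.x i)) = c'.incr (η (c.x i)) := by
    rw [incr, incr, coeffDer_sub, map_sub, hC, sub_zero, coeffDer_C,
      ← coeffDer_add_vert_taylorHom]
    abel
  rw [PowAut.mul_apply, PowAut.mul_apply, infAut_X, infFun, map_add, map_smul, baseChange_map,
    baseChange_map, baseChange_X, vert_X, trans_X, trans_incr, h1, map_add, map_smul, infAut_map,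
    infAut_map, infFun, infFun, smul_add, eps_smul_eps_smul, add_zero, ← h2, map_add, smul_add]
  abel

/-- The action of vector fields does not depend on the coordinates. -/
theorem op_trans_vecAct {P : PowAutRep K n W} (hP : P.Integrates) (c c' : Coords K n B)
    (η : Derivation K B B) (z : B ⊗[K] W) :
    (P.op (trans c c')).app (c.vecAct W η z) = c'.vecAct W η ((P.op (trans c c')).app z) := by
  have h := congrArg P.op (trans_mul_infAut c c' η)
  have h1 : P.op (R := DualNumber B) (baseChange (inlR B) (trans c c')) =
      Op.inl (P.op (trans c c')) := P.op_map (inlHom K B) fun i => baseChange_X _ _ i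
  have h2 : P.op (R := DualNumber B) (baseChange (derHom K η).toRingHom (trans c c')) =
      Op.inl (P.op (trans c c')) + Op.ep (Op.der η (P.op (trans c c'))) :=
    (P.op_map (derHom K η) fun i => baseChange_X _ _ i).trans (Op.map_derHom_eq _ _)
  rw [map_mul, map_mul, h1, h2, hP.op_infAut, hP.op_infAut, ← Op.inl_one, Op.inl_add_ep_mul,
    ← add_zero (Op.inl (P.op (trans c c'))), ← Op.ep_zero, Op.inl_add_ep_mul] at h
  -- The `ε`-part reads `P(φ) ρ(η^v) = η(P(φ)) + ρ'(η^v) P(φ)`, where `ρ'(η^v)` is taken in the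
  -- coordinates `c'`. The term `η(P(φ))` is what the Leibniz rule for `η` on `B ⊗ W` produces.
  have h3 := (Op.inl_add_ep_injective h).2
  rw [zero_mul, add_zero, one_mul] at h3
  rw [vecAct_apply, vecAct_apply, map_add, derAct_app, ← Op.mul_app, h3, Op.add_app, Op.mul_app]
  abel

/-- Coordinates compatible with a homomorphism of algebras. -/
structure Compat (c : Coords K n B) (c' : Coords K n B') (r : B →ₐ[K] B') : Prop where
  map_x : ∀ i, r (c.x i) = c'.x i
  map_d : ∀ i b, r (c.d i b) = c'.d i (r b)

variable {c} {c' : Coords K n B'} {r : B →ₐ[K] B'}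

theorem Compat.map_taylorHom (h : Compat c c' r) (b : B) :
    MvPowerSeries.map r.toRingHom (c.taylorHom b) = c'.taylorHom (r b) := by
  refine sub_eq_zero.1 (eq_zero_of_pderiv K
    (F := fun b => MvPowerSeries.map r.toRingHom (c.taylorHom b) - c'.taylorHom (r b))
    (fun b => ?_) (fun k hk b i => ?_) b)
  · rw [map_sub, constantCoeff_map, constantCoeff_taylorHom, constantCoeff_taylorHom]
    exact sub_self _
  · have := hk (c.d i b)
    rw [h.map_d] at this
    rwa [map_sub, pderiv_map, pderiv_taylorHom, pderiv_taylorHom]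

theorem Compat.map_incr (h : Compat c c' r) (b : B) :
    MvPowerSeries.map r.toRingHom (c.incr b) = c'.incr (r b) := by
  rw [incr, incr, map_sub, h.map_taylorHom, map_C]; rfl

theorem Compat.rTensor_vecAct (h : Compat c c' r) {η : Derivation K B B} {η' : Derivation K B' B'}
    (hη : ∀ b, r (η b) = η' (r b)) (z : B ⊗[K] W) :
    r.toLinearMap.rTensor W (c.vecAct W η z) = c'.vecAct W η' (r.toLinearMap.rTensor W z) := by
  have h1 : derMap r.toRingHom (c.vert η) = c'.vert η' := derivation_ext fun i => by
    rw [derMap_X, vert_X, vert_X, h.map_incr, hη, h.map_x]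
  have h2 : r.toLinearMap.rTensor W (derAct η z) = derAct η' (r.toLinearMap.rTensor W z) := by
    induction z using TensorProduct.induction_on with
    | zero => simp
    | add x y hx hy => simp only [map_add, hx, hy]
    | tmul b w =>
      rw [derAct_tmul, LinearMap.rTensor_tmul, LinearMap.rTensor_tmul, derAct_tmul]
      exact congrArg (· ⊗ₜ w) (hη b)
  rw [vecAct_apply, vecAct_apply, map_add, h2, ← h1, rho_derMap, Op.map_app]

end Coords

end Action

/-! ### The action of `A # V`, and its vanishing on jets of high order. -/

section JetAction

open MvPowerSeries PowAut

variable {K : Type u} [Field K] {n : ℕ} {W : Type u} [AddCommGroup W] [Module K W]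
  [LieRingModule (LPlus K n) W] [LieModule K (LPlus K n) W] [CharZero K] [Module.Finite K W]
variable {B : Type u} [CommRing B] [Algebra K B]
variable {A : Type u} [CommRing A] [Algebra K A]
  {V : Type u} [LieRing V] [LieAlgebra K V] [Module A V] [LieRingModule V A]
  [LieRinehartRing A V] [LieRinehartAlgebra K A V]

variable (A V B) in
/-- A morphism from a Lie-Rinehart pair to `B` with its derivations. -/
structure DerData (r : A →ₐ[K] B) where
  δ : V →ₗ[K] Derivation K B B
  δ_smul : ∀ (a : A) (v : V) (b : B), δ (a • v) b = r a * δ v b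
  δ_map : ∀ (v : V) (a : A), δ v (r a) = r ⁅v, a⁆
  δ_lie : ∀ v w : V, δ ⁅v, w⁆ = ⁅δ v, δ w⁆

variable {r : A →ₐ[K] B}

namespace Coords

variable (c : Coords K n B) (δ : DerData B A V r)

variable (W) in
/-- The action of `A # V` on `B ⊗ W`. -/
def jetAct : A ⊗[K] V →ₗ[K] B ⊗[K] W →ₗ[K] B ⊗[K] W :=
  TensorProduct.lift (LinearMap.mk₂ K (fun g v => r g • c.vecAct W (δ.δ v))
    (fun g g' v => by rw [map_add, add_smul])
    (fun k g v => by
      ext1; simp)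
    (fun g v v' => LinearMap.ext fun z => by
      rw [map_add]
      simp only [LinearMap.smul_apply, LinearMap.add_apply, vecAct_add, smul_add])
    (fun k g v => LinearMap.ext fun z => by
      rw [map_smul]
      simp only [LinearMap.smul_apply, vecAct_ksmul]
      rw [smul_comm]))

theorem jetAct_tmul (g : A) (v : V) (z : B ⊗[K] W) :
    c.jetAct W δ (g ⊗ₜ v) z = r g • c.vecAct W (δ.δ v) z := rfl

theorem jetAct_smul (a : A) (y : A ⊗[K] V) (z : B ⊗[K] W) :
    c.jetAct W δ (a • y) z = r a • c.jetAct W δ y z := by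
  induction y using TensorProduct.induction_on with
  | zero => simp
  | add x y hx hy => simp only [smul_add, map_add, LinearMap.add_apply, hx, hy]
  | tmul g v => rw [TensorProduct.smul_tmul', jetAct_tmul, jetAct_tmul, smul_eq_mul, map_mul, mul_smul]

theorem jetAct_smul_right (y : A ⊗[K] V) (f : A) (z : B ⊗[K] W) :
    c.jetAct W δ y (r f • z) = r ⁅smashAnchor y, f⁆ • z + r f • c.jetAct W δ y z := by
  induction y using TensorProduct.induction_on with
  | zero => simp
  | add x y hx hy =>
    simp only [smul_add, map_add, LinearMap.add_apply, hx, hy, add_lie, add_smul]; abel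
  | tmul g v =>
    rw [jetAct_tmul, jetAct_tmul, vecAct_smul, δ.δ_map, smashAnchor_tmul,
      LieRinehartRing.lie_smul_eq_mul, smul_add, map_mul, mul_smul, smul_comm (r g) (r f)]

theorem jetAct_smashBracket (y y' : A ⊗[K] V) (z : B ⊗[K] W) :
    c.jetAct W δ (smashBracket K A V y y') z =
      c.jetAct W δ y (c.jetAct W δ y' z) - c.jetAct W δ y' (c.jetAct W δ y z) := by
  induction y using TensorProduct.induction_on with
  | zero => simp
  | add a b ha hb => simp only [map_add, LinearMap.add_apply, ha, hb]; abel
  | tmul f η =>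
    induction y' using TensorProduct.induction_on with
    | zero => simp
    | add a b ha hb => simp only [map_add, LinearMap.add_apply, ha, hb]; abel
    | tmul g μ =>
      rw [smashBracket_tmul, map_add, map_sub, LinearMap.add_apply, LinearMap.sub_apply]
      simp only [jetAct_tmul, vecAct_smul, δ.δ_map, δ.δ_lie, vecAct_lie, smul_add, smul_sub, smul_smul,
        map_mul, mul_comm (r g) (r f)]
      abel

/-- The Taylor expansion as a homomorphism of `K`-algebras. -/
def taylorAlgHom : B →ₐ[K] MvPowerSeries (Fin n) B where
  __ := c.taylorHom
  commutes' k := (c.taylorHom_algebraMap k).trans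
    (IsScalarTower.algebraMap_apply K B (MvPowerSeries (Fin n) B) k).symm

/-- The homomorphism `g ⊗ f ↦ g(x) f(x + X)`. -/
def jetSeries (r : A →ₐ[K] B) : A ⊗[K] A →ₐ[K] MvPowerSeries (Fin n) B :=
  Algebra.TensorProduct.lift
    ((Algebra.ofId B (MvPowerSeries (Fin n) B)).restrictScalars K |>.comp r)
    (AlgHom.comp c.taylorAlgHom r)
    fun _ _ => mul_comm _ _

theorem jetSeries_tmul (g f : A) :
    c.jetSeries r (g ⊗ₜ f) = C (r g) * c.taylorHom (r f) := rfl

theorem constantCoeff_jetSeries (t : A ⊗[K] A) :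
    constantCoeff (c.jetSeries r t) = r (Algebra.TensorProduct.lmul' K t) := by
  induction t using TensorProduct.induction_on with
  | zero => simp
  | add a b ha hb => simp only [map_add, ha, hb]
  | tmul a b =>
    rw [jetSeries_tmul, map_mul, constantCoeff_C, constantCoeff_taylorHom,
      Algebra.TensorProduct.lmul'_apply_tmul, map_mul]

/-- An element of `Δ` goes to a series whose constant term is its image under multiplication, hence
zero. The map is multiplicative, so `Δ^m` goes to order at least `m`. -/
theorem jetSeries_mem {m : ℕ} {t : A ⊗[K] A} (ht : t ∈ KaehlerDifferential.ideal K A ^ m) :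
    c.jetSeries r t ∈ ordIdeal n B m := by
  induction m generalizing t with
  | zero => exact mem_ordIdeal_zero _
  | succ m ih =>
    rw [pow_succ] at ht
    induction ht using Submodule.mul_induction_on' with
    | mem_mul_mem a ha b hb =>
      rw [map_mul]
      refine mul_mem_ordIdeal (ih ha) (mem_ordIdeal_one.2 ?_)
      have h0 : Algebra.TensorProduct.lmul' K b = 0 := RingHom.mem_ker.1 hb
      rw [constantCoeff_jetSeries, h0, map_zero]
    | add x hx y hy hx' hy' => rw [map_add]; exact add_mem hx' hy'

/-- Both sides are additive in `t`, and on `g ⊗ f` the formula is the action of `g # fη`. In this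
form the right-hand side depends on `t` only through its Taylor series and its image under
multiplication. -/
theorem jetAct_smear (η : V) (t : A ⊗[K] A) (z : B ⊗[K] W) :
    c.jetAct W δ (smear η t) z =
      r (Algebra.TensorProduct.lmul' K t) • derAct (δ.δ η) z +
        (rho K W (vecField fun i => c.jetSeries r t * c.taylorHom (δ.δ η (c.x i)) -
          C (r (Algebra.TensorProduct.lmul' K t) * δ.δ η (c.x i)))).app z := by
  induction t using TensorProduct.induction_on with
  | zero =>
    have h : (vecField fun i => c.jetSeries r (0 : A ⊗[K] A) * c.taylorHom (δ.δ η (c.x i)) -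
        C (r (Algebra.TensorProduct.lmul' K (0 : A ⊗[K] A)) * δ.δ η (c.x i))) = 0 :=
      derivation_ext fun i => by rw [vecField_X]; simp
    rw [h]
    simp [Op.zero_app]
  | add t t' ht ht' =>
    have h : (vecField fun i => c.jetSeries r (t + t') * c.taylorHom (δ.δ η (c.x i)) -
        C (r (Algebra.TensorProduct.lmul' K (t + t')) * δ.δ η (c.x i))) =
        (vecField fun i => c.jetSeries r t * c.taylorHom (δ.δ η (c.x i)) -
          C (r (Algebra.TensorProduct.lmul' K t) * δ.δ η (c.x i))) +
        (vecField fun i => c.jetSeries r t' * c.taylorHom (δ.δ η (c.x i)) -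
          C (r (Algebra.TensorProduct.lmul' K t') * δ.δ η (c.x i))) :=
      derivation_ext fun i => by
        rw [Derivation.add_apply, vecField_X, vecField_X, vecField_X]
        simp only [map_add, add_mul]; abel
    rw [h, map_add (rho K W), Op.add_app, map_add (smear η), map_add (c.jetAct W δ),
      LinearMap.add_apply, ht, ht', map_add (Algebra.TensorProduct.lmul' K), map_add r, add_smul]
    abel
  | tmul g f =>
    have h1 : (vecField fun i => c.jetSeries r (g ⊗ₜ[K] f) * c.taylorHom (δ.δ η (c.x i)) -
        C (r (Algebra.TensorProduct.lmul' K (g ⊗ₜ[K] f)) * δ.δ η (c.x i))) =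
        r g • c.vert (δ.δ (f • η)) := derivation_ext fun i => by
      rw [Derivation.smul_apply, vecField_X, vert_X, incr, δ.δ_smul, jetSeries_tmul,
        Algebra.TensorProduct.lmul'_apply_tmul, smul_eq_C_mul]
      simp only [map_mul]
      ring
    have h2 (z : B ⊗[K] W) : derAct (δ.δ (f • η)) z = r f • derAct (δ.δ η) z := by
      induction z using TensorProduct.induction_on with
      | zero => simp
      | add x y hx hy => simp only [smul_add, map_add, hx, hy]
      | tmul b w => rw [derAct_tmul, derAct_tmul, δ.δ_smul, TensorProduct.smul_tmul', smul_eq_mul]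
    rw [smear_tmul, jetAct_tmul, vecAct_apply, h1, map_smul (rho K W), Op.smul_app, h2, smul_add, smul_smul,
      Algebra.TensorProduct.lmul'_apply_tmul, map_mul]

/-- Jets of high order act by zero. -/
theorem jetAct_eq_zero {y : A ⊗[K] V} (hy : y ∈ jetFilt K A V (weightBound n K W + 1))
    (z : B ⊗[K] W) : c.jetAct W δ y z = 0 := by
  induction hy using Submodule.span_induction with
  | zero => simp
  | add a b _ _ ha hb => rw [map_add, LinearMap.add_apply, ha, hb, add_zero]
  | smul a y _ ih => rw [jetAct_smul, ih, smul_zero]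
  | mem y hy =>
    obtain ⟨μ, t, ht, rfl⟩ := hy
    have h0 : Algebra.TensorProduct.lmul' K t = 0 :=
      RingHom.mem_ker.1 (Ideal.pow_le_self (Nat.succ_ne_zero _) ht)
    -- All coefficients up to the weight bound vanish, and `rho` sees no others.
    have h1 : rho K W (vecField fun i => c.jetSeries r t * c.taylorHom (δ.δ μ (c.x i)) -
          C (r (Algebra.TensorProduct.lmul' K t) * δ.δ μ (c.x i))) = rho K W (0 : PowDer n B) := by
      refine rho_congr fun i s hs hsd => ?_
      rw [vecField_X, h0, map_zero, zero_mul, map_zero, sub_zero]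
      rw [Ideal.mul_mem_right _ _ (c.jetSeries_mem ht) s (by omega)]
      simp
    rw [jetAct_smear, h1, h0, map_zero, map_zero, zero_smul, zero_add, Op.zero_app]

end Coords

end JetAction

/-! ### Derivations and algebraic elements in characteristic zero. -/

section AlgebraicDerivation

open Polynomial

variable {S B : Type*} [CommRing S] [CommRing B] [Algebra S B] [IsDomain B] [CharZero B]

/-- In characteristic zero, derivations are determined by their values on a subring over which the
domain is algebraic. -/
theorem derivation_eq_zero_of_isAlgebraic (hS : Function.Injective (algebraMap S B))
    (D : Derivation S B B) {b : B} (hb : IsAlgebraic S b) : D b = 0 := by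
  obtain ⟨p, hp, hpb⟩ := hb
  induction h : p.natDegree using Nat.strong_induction_on generalizing p with
  | _ k ih =>
    have : IsDomain S := hS.isDomain
    have : CharZero S := ⟨fun a b hab => Nat.cast_injective (R := B) (by
      rw [← map_natCast (algebraMap S B), hab, map_natCast])⟩
    have hk : p.natDegree ≠ 0 := fun h0 => by
      rw [eq_C_of_natDegree_eq_zero h0, aeval_C] at hpb
      have h1 : p.coeff 0 = 0 := hS (hpb.trans (map_zero _).symm)
      exact hp (by rw [eq_C_of_natDegree_eq_zero h0, h1, C_0])
    -- Either `p'` is an annihilating polynomial of smaller degree, non-zero because `p` is not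
    -- constant, or `0 = D(p(b)) = p'(b) D(b)` can be divided by `p'(b)`.
    by_cases h1 : aeval b (derivative p) = 0
    · refine ih _ (h ▸ natDegree_derivative_lt hk) (derivative p) (fun h2 => hk ?_) h1 rfl
      exact derivative_eq_zero.1 h2
    · have h2 := D.map_aeval p b
      rw [hpb, map_zero, smul_eq_mul] at h2
      exact (mul_eq_zero.1 h2.symm).resolve_left h1

end AlgebraicDerivation

theorem isAlgebraic_of_isFractionRing_of_injective {S A F : Type*} [CommRing S] [CommRing A]
    [IsDomain A] [Field F] [Algebra S A] [Algebra A F] [Algebra S F] [IsScalarTower S A F]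
    [IsFractionRing A F] (h : Function.Injective (algebraMap S A)) [Algebra.IsAlgebraic S A] :
    Algebra.IsAlgebraic S F := by
  have : IsDomain S := h.isDomain
  have : FaithfulSMul S F := (faithfulSMul_iff_algebraMap_injective S F).2 (by
    rw [IsScalarTower.algebraMap_eq S A F]
    exact (IsFractionRing.injective A F).comp h)
  exact (IsFractionRing.isAlgebraic_iff' S A F).1 inferInstance

/-! ### Coordinates on open subsets of étale charts. -/

section Geometry

variable {K : Type u} [Field K] {X : Scheme.{u}} [X.Over (Spec (CommRingCat.of K))] [IsIntegral X]

theorem res_injective {U V : X.Opens} (h : V ≤ U) [Nonempty V] :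
    Function.Injective (res K h) :=
  map_injective_of_isIntegral X (homOfLE h)

theorem germ_res {U V : X.Opens} (h : V ≤ U) [Nonempty U] [Nonempty V] (f : Γ(X, U)) :
    X.germToFunctionField V (res K h f) = X.germToFunctionField U f :=
  X.presheaf.germ_res_apply (homOfLE h) (genericPoint X) _ f

variable {n : ℕ}

/-- The open set `V` need not be affine. But `𝒪(V)` embeds in the function field, which is the
fraction field of `𝒪(U)` and so algebraic over `K[x₁, …, xₙ]`; and `D` is linear over that ring. For
empty `V` the ring of functions is zero, which is treated separately. -/
theorem derivation_eq_zero_of_chart [CharZero K] (C : EtaleChart K X n) {V : X.Opens} (h : V ≤ C.U)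
    (D : Derivation K Γ(X, V) Γ(X, V)) (hD : ∀ i, D (res K h (C.x i)) = 0) : D = 0 := by
  rcases isEmpty_or_nonempty V with hV | hV
  · have hV' : V = ⊥ := by
      ext p; exact ⟨fun hp => (hV.false ⟨p, hp⟩).elim, fun hp => hp.elim⟩
    have : Subsingleton Γ(X, V) := by subst hV'; infer_instance
    exact Derivation.ext fun f => Subsingleton.elim _ _
  · have hU : Nonempty C.U := hV.map fun p => ⟨p.1, h p.2⟩
    let S := Algebra.adjoin K (Set.range C.x)
    have : IsFractionRing Γ(X, C.U) X.functionField :=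
      functionField_isFractionRing_of_isAffineOpen X C.U C.isAffineOpen
    have := C.isAlgebraic
    have hF : Algebra.IsAlgebraic S X.functionField :=
      isAlgebraic_of_isFractionRing_of_injective (A := Γ(X, C.U)) Subtype.val_injective
    let _ : Algebra S Γ(X, V) := ((res K h).comp S.val).toRingHom.toAlgebra
    have hDS (s : S) : D (algebraMap S Γ(X, V) s) = 0 := by
      change D (res K h s.1) = 0
      obtain ⟨s, hs⟩ := s
      induction hs using Algebra.adjoin_induction with
      | mem x hx => obtain ⟨i, rfl⟩ := hx; exact hD i
      | algebraMap r => rw [AlgHom.commutes]; exact D.map_algebraMap r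
      | add x y _ _ hx hy => rw [map_add, map_add, hx, hy, add_zero]
      | mul x y _ _ hx hy => rw [map_mul, Derivation.leibniz, hx, hy, smul_zero, smul_zero, add_zero]
    have hB : CharZero Γ(X, V) := charZero_of_injective_algebraMap (FaithfulSMul.algebraMap_injective K _)
    let D' : Derivation S Γ(X, V) Γ(X, V) := Derivation.mk'
      { toFun := D, map_add' := map_add D, map_smul' := fun s b => by
          rw [Algebra.smul_def, Derivation.leibniz, hDS, smul_zero, add_zero]; rfl }
      (fun a b => D.leibniz a b)
    refine Derivation.ext fun f => derivation_eq_zero_of_isAlgebraic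
      (fun s t hst => Subtype.ext (res_injective (K := K) h hst)) D' ?_
    have hf := hF.isAlgebraic (X.germToFunctionField V f)
    have : IsScalarTower S Γ(X, V) X.functionField := .of_algebraMap_eq fun s =>
      (germ_res h s.1).symm
    exact (isAlgebraic_algebraMap_iff (X.germToFunctionField_injective V)).1 hf

theorem EtaleChart.der_res_x (C : EtaleChart K X n) {V : X.Opens} (h : V ≤ C.U) (i j : Fin n) :
    C.der h i (res K h (C.x j)) = if i = j then 1 else 0 := by
  rw [EtaleChart.der, ← VectorField.res_der (C.pd i) le_rfl h]
  have := congrArg (res K h) (C.pd_x i j)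
  rw [VectorField.lie_fun] at this
  rw [this]
  split_ifs <;> simp

variable [CharZero K]

/-- The coordinates on an open subset of an étale chart. -/
def EtaleChart.coords (C : EtaleChart K X n) {V : X.Opens} (h : V ≤ C.U) :
    Coords K n Γ(X, V) where
  x i := res K h (C.x i)
  d := C.der h
  d_x := C.der_res_x h
  comm i j b := by
    -- The commutator kills the parameters, because each `∂_j x_k` is a constant.
    have h0 : ⁅C.der h i, C.der h j⁆ = 0 := derivation_eq_zero_of_chart C h _ fun k => by
      rw [Derivation.commutator_apply, C.der_res_x, C.der_res_x]
      split_ifs <;> simp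
    exact sub_eq_zero.1 (DFunLike.congr_fun h0 b)
  eq_sum η b := by
    have hs (b : Γ(X, V)) : (∑ i, η (res K h (C.x i)) • C.der h i) b =
        ∑ i, η (res K h (C.x i)) * C.der h i b := by
      rw [← Derivation.coeFnAddMonoidHom_apply, map_sum, Finset.sum_apply]; rfl
    have h0 : η - ∑ i, η (res K h (C.x i)) • C.der h i = 0 :=
      derivation_eq_zero_of_chart C h _ fun k => by
        rw [Derivation.sub_apply, hs]
        simp [C.der_res_x]
    have h1 := DFunLike.congr_fun h0 b
    rw [Derivation.sub_apply, Derivation.zero_apply, sub_eq_zero] at h1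
    rw [h1, hs]

theorem EtaleChart.coords_compat (C : EtaleChart K X n) {V V' : X.Opens} (h : V ≤ C.U)
    (h' : V' ≤ V) : (C.coords h).Compat (C.coords (h'.trans h)) (res K h') where
  map_x i := res_res K h h' (C.x i)
  map_d i b := VectorField.res_der (C.pd i) h h' b

theorem EtaleChart.isTransition_iff (C₁ C₂ : EtaleChart K X n) {V : X.Opens} (h₁ : V ≤ C₁.U)
    (h₂ : V ≤ C₂.U) (φ : PowAut n Γ(X, V)) :
    C₁.IsTransition C₂ h₁ h₂ φ ↔ φ = Coords.trans (C₁.coords h₁) (C₂.coords h₂) := by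
  refine ⟨fun h => PowAut.ext_X fun i => ?_, ?_⟩
  · rw [h i, Coords.trans_X]; rfl
  · rintro rfl i
    rw [Coords.trans_X]; rfl

end Geometry

/-! ### Uniformizing parameters of standard smooth algebras. -/

section StandardSmooth

variable {K : Type*} [Field K] {A : Type*} [CommRing A] [Algebra K A] {n : ℕ}

/-- A standard smooth algebra has functions whose differentials form a basis. -/
theorem exists_basis_kaehler [Algebra.IsStandardSmoothOfRelativeDimension n K A] :
    ∃ (x : Fin n → A) (b : Module.Basis (Fin n) A Ω[A⁄K]),
      ∀ i, b i = KaehlerDifferential.D K A (x i) := by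
  obtain ⟨ι, σ, _, _, P, hP⟩ :=
    Algebra.IsStandardSmoothOfRelativeDimension.out (n := n) (R := K) (S := A)
  -- The map `P.map` injects relations into variables; the remaining variables have differentials
  -- forming a basis, and their number is the relative dimension.
  have hcard : Nat.card ((Set.range P.map)ᶜ : Set ι) = n := by
    have h1 : Nat.card (Set.range P.map) = Nat.card σ := Nat.card_range_of_injective P.map_inj
    have h2 := Set.ncard_add_ncard_compl (Set.range P.map)
    rw [← Nat.card_coe_set_eq, ← Nat.card_coe_set_eq, h1] at h2
    rw [← hP, Algebra.Presentation.dimension]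
    omega
  let e : ((Set.range P.map)ᶜ : Set ι) ≃ Fin n := Finite.equivFinOfCardEq hcard
  exact ⟨fun i => P.val (e.symm i), P.basisKaehler.reindex e, fun i => by
    rw [Module.Basis.reindex_apply, Algebra.SubmersivePresentation.basisKaehler_apply]⟩

variable {x : Fin n → A} {d : Fin n → Derivation K A A}

theorem derivation_aeval (D : Derivation K A A) (x : Fin n → A) (p : MvPolynomial (Fin n) K) :
    D (MvPolynomial.aeval x p) = ∑ i, MvPolynomial.aeval x (MvPolynomial.pderiv i p) * D (x i) := by
  induction p using MvPolynomial.induction_on with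
  | C a => simp
  | add p q hp hq => simp only [map_add, hp, hq, add_mul, Finset.sum_add_distrib]
  | mul_X p i hp =>
    simp only [map_mul, Derivation.leibniz, MvPolynomial.aeval_X, hp, smul_eq_mul, map_add,
      MvPolynomial.pderiv_X, add_mul, Finset.sum_add_distrib, Finset.mul_sum]
    congr 1
    · simp [Pi.single_apply, apply_ite]
    · exact Finset.sum_congr rfl fun j _ => by ring

/-- Applying `d i` to a relation gives its `i`-th partial derivative as a relation of smaller
degree, zero by induction. In characteristic zero the relation is then constant, hence zero. -/
theorem algebraicIndependent_of_dual [CharZero K] [Nontrivial A]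
    (hd : ∀ i j, d i (x j) = if i = j then 1 else 0) : AlgebraicIndependent K x := by
  rw [algebraicIndependent_iff]
  suffices H : ∀ (k : ℕ) (p : MvPolynomial (Fin n) K), (∀ s, p.coeff s ≠ 0 → s.degree ≤ k) →
      MvPolynomial.aeval x p = 0 → p = 0 from fun p => H p.totalDegree p fun s hs =>
    MvPolynomial.le_totalDegree (MvPolynomial.mem_support_iff.2 hs)
  intro k
  have hC (p : MvPolynomial (Fin n) K) (h : ∀ s, s ≠ 0 → p.coeff s = 0)
      (hp : MvPolynomial.aeval x p = 0) : p = 0 := by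
    have hk : p = MvPolynomial.C (p.coeff 0) := MvPolynomial.ext _ _ fun s => by
      rw [MvPolynomial.coeff_C]
      split_ifs with hs
      · rw [hs]
      · exact h s (Ne.symm hs)
    rw [hk, MvPolynomial.aeval_C, FaithfulSMul.algebraMap_eq_zero_iff] at hp
    rw [hk, hp, map_zero]
  induction k with
  | zero =>
    refine fun p h => hC p fun s hs => by_contra fun h0 => hs ?_
    exact (Finsupp.degree_eq_zero_iff s).1 (Nat.le_zero.1 (h s h0))
  | succ k ih =>
    refine fun p h hp => hC p (fun s hs => ?_) hp
    obtain ⟨i, hi⟩ := Finsupp.ne_iff.1 hs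
    have h1 : MvPolynomial.aeval x (MvPolynomial.pderiv i p) = 0 := by
      have h2 := derivation_aeval (d i) x p
      simpa [hp, hd] using h2.symm
    have h3 : MvPolynomial.pderiv i p = 0 := ih _ (fun m hm => by
      rw [MvPolynomial.coeff_pderiv] at hm
      have h4 := h _ (left_ne_zero_of_mul hm)
      rw [map_add, Finsupp.degree_single] at h4
      omega) h1
    have h5 := MvPolynomial.coeff_pderiv (i := i) p (s - Finsupp.single i 1)
    rw [h3, MvPolynomial.coeff_zero, tsub_add_cancel_of_le
      (Finsupp.single_le_iff.2 (Nat.one_le_iff_ne_zero.2 hi))] at h5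
    exact (mul_eq_zero.1 h5.symm).resolve_right (Nat.cast_add_one_ne_zero _)

/-- The `dx_i` span `Ω[A⁄K]` and vanish over `S = K[x₁, …, xₙ]`, so `A` is unramified over `S`. The
extension of fraction fields is then essentially of finite type and unramified, hence separable and
in particular algebraic. -/
theorem isAlgebraic_of_span [IsDomain A] [Algebra.FiniteType K A]
    (hx : Submodule.span A (Set.range fun i => KaehlerDifferential.D K A (x i)) = ⊤) :
    Algebra.IsAlgebraic (Algebra.adjoin K (Set.range x)) A := by
  let S := Algebra.adjoin K (Set.range x)
  have h1 : Algebra.FormallyUnramified S A := by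
    let D := (KaehlerDifferential.D S A).restrictScalars K
    have hD : D.liftKaehlerDifferential = 0 := by
      refine LinearMap.ext_on_range hx fun i => ?_
      rw [Derivation.liftKaehlerDifferential_comp_D, LinearMap.zero_apply]
      exact (KaehlerDifferential.D S A).map_algebraMap
        (⟨x i, Algebra.subset_adjoin ⟨i, rfl⟩⟩ : S)
    have hD' (a : A) : KaehlerDifferential.D S A a = 0 := by
      change D a = 0
      rw [← D.liftKaehlerDifferential_comp_D, hD, LinearMap.zero_apply]
    refine ⟨subsingleton_of_forall_eq 0 fun z => ?_⟩
    have hz : z ∈ (⊤ : Submodule A Ω[A⁄S]) := trivial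
    rw [← KaehlerDifferential.span_range_derivation] at hz
    induction hz using Submodule.span_induction with
    | mem z hz => obtain ⟨a, rfl⟩ := hz; exact hD' a
    | zero => rfl
    | add a b _ _ ha hb => rw [ha, hb, add_zero]
    | smul a z _ hz => rw [hz, smul_zero]
  let E := FractionRing S
  let F := FractionRing A
  let _ : Algebra E F := (IsFractionRing.lift (K := E) (g := algebraMap S F)
    ((IsFractionRing.injective A F).comp Subtype.val_injective)).toAlgebra
  have : IsScalarTower S E F := .of_algebraMap_eq fun s => (IsFractionRing.lift_algebraMap _ s).symm
  have : Algebra.FormallyUnramified A F := .of_isLocalization (nonZeroDivisors A)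
  have : Algebra.FormallyUnramified S F := .comp S A F
  have : Algebra.FormallyUnramified E F := .of_restrictScalars S E F
  have : Algebra.FiniteType S A := .of_restrictScalars_finiteType K S A
  have : Algebra.EssFiniteType A F := .of_isLocalization F (nonZeroDivisors A)
  have : Algebra.EssFiniteType S F := .comp S A F
  have : Algebra.EssFiniteType E F := .of_comp S E F
  have : Algebra.IsSeparable E F := Algebra.FormallyUnramified.isSeparable E F
  have h2 : Algebra.IsAlgebraic S F :=
    (IsFractionRing.comap_isAlgebraic_iff (A := S) (K := E) (C := F)).2 (Algebra.IsSeparable.isAlgebraic E F)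
  exact ⟨fun a => (isAlgebraic_algebraMap_iff (IsFractionRing.injective A F)).1 (h2.isAlgebraic _)⟩

/-- A standard smooth algebra has uniformizing parameters. -/
theorem exists_uniformizing [CharZero K] [IsDomain A]
    [Algebra.IsStandardSmoothOfRelativeDimension n K A] :
    ∃ (x : Fin n → A) (d : Fin n → Derivation K A A), AlgebraicIndependent K x ∧
      Algebra.IsAlgebraic (Algebra.adjoin K (Set.range x)) A ∧
      ∀ i j, d i (x j) = if i = j then 1 else 0 := by
  obtain ⟨x, b, hb⟩ := exists_basis_kaehler (K := K) (A := A) (n := n)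
  let d (i : Fin n) : Derivation K A A := (b.coord i).compDer (KaehlerDifferential.D K A)
  have hd (i j : Fin n) : d i (x j) = if i = j then 1 else 0 := by
    change b.coord i (KaehlerDifferential.D K A (x j)) = _
    rw [← hb, Module.Basis.coord_apply, b.repr_self, Finsupp.single_apply]
    simp only [eq_comm]
  have : Algebra.IsStandardSmooth K A :=
    Algebra.IsStandardSmoothOfRelativeDimension.isStandardSmooth n
  refine ⟨x, d, algebraicIndependent_of_dual hd, isAlgebraic_of_span ?_, hd⟩
  rw [← b.span_eq]
  congr 2
  exact funext fun i => (hb i).symm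

end StandardSmooth

/-! ### Extension of derivations to the fraction field. -/

section ExtendDerivation

variable {K : Type u} [Field K] {A F : Type u} [CommRing A] [Algebra K A] [Field F] [Algebra A F]
  [IsFractionRing A F]

/-- A derivation of a domain extends to the field of fractions. -/
theorem exists_extend_derivation (d : Derivation K A A) :
    ∃ D : F → F, (∀ f g, D (f + g) = D f + D g) ∧ (∀ f g, D (f * g) = f * D g + g * D f) ∧
      ∀ a, D (algebraMap A F a) = algebraMap A F (d a) := by
  -- The derivation is encoded as the homomorphism `a ↦ a + ε d(a)`. A dual number is a unit if its
  -- first component is, so this extends to `F`, and the second component of the extension is the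
  -- derivation sought.
  let j : A →+* DualNumber F :=
    { toFun a := TrivSqZeroExt.inl (algebraMap A F a) + TrivSqZeroExt.inr (algebraMap A F (d a))
      map_one' := by simp
      map_zero' := by simp
      map_add' a b := by ext <;> simp [Algebra.smul_def]
      map_mul' a b := by
        ext
        · simp
        · simp only [TrivSqZeroExt.snd_mul, TrivSqZeroExt.fst_add, TrivSqZeroExt.fst_inl,
            TrivSqZeroExt.fst_inr, TrivSqZeroExt.snd_add, TrivSqZeroExt.snd_inl,
            TrivSqZeroExt.snd_inr, add_zero, zero_add, Derivation.leibniz, map_add, smul_eq_mul,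
            map_mul, op_smul_eq_smul] }
  have hj (a : A) : j a = TrivSqZeroExt.inl (algebraMap A F a) +
      TrivSqZeroExt.inr (algebraMap A F (d a)) := rfl
  have hu (s : nonZeroDivisors A) : IsUnit (j s) := by
    rw [TrivSqZeroExt.isUnit_iff_isUnit_fst, hj]
    simpa using IsLocalization.map_units F s
  let h : F →+* DualNumber F := IsLocalization.lift (M := nonZeroDivisors A) hu
  have h1 (a : A) : h (algebraMap A F a) = j a := IsLocalization.lift_eq hu a
  have h2 (f : F) : (h f).fst = f := by
    have : (TrivSqZeroExt.fstHom ℤ F F).toRingHom.comp h = RingHom.id F :=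
      IsLocalization.ringHom_ext (nonZeroDivisors A) (RingHom.ext fun a => by
        change (h (algebraMap A F a)).fst = algebraMap A F a
        rw [h1, hj]; simp)
    exact RingHom.congr_fun this f
  refine ⟨fun f => (h f).snd, fun f g => by beta_reduce; rw [map_add, TrivSqZeroExt.snd_add], fun f g => ?_,
    fun a => ?_⟩
  · beta_reduce; rw [map_mul, TrivSqZeroExt.snd_mul, h2, h2, op_smul_eq_smul]; rfl
  · beta_reduce; rw [h1, hj, TrivSqZeroExt.snd_add, TrivSqZeroExt.snd_inl, TrivSqZeroExt.snd_inr, zero_add]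

end ExtendDerivation

/-! ### From derivations of rings to vector fields; étale charts cover `X`. -/

section Geometry

variable {K : Type u} [Field K] {X : Scheme.{u}} [X.Over (Spec (CommRingCat.of K))] [IsIntegral X]

theorem eq_of_germ_eq {V : X.Opens} {f g : Γ(X, V)}
    (h : ∀ [Nonempty V], X.germToFunctionField V f = X.germToFunctionField V g) : f = g := by
  rcases isEmpty_or_nonempty V with hV | hV
  · have hV' : V = ⊥ := by
      ext p; exact ⟨fun hp => (hV.false ⟨p, hp⟩).elim, fun hp => hp.elim⟩
    subst hV'
    exact Subsingleton.elim _ _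
  · exact X.germToFunctionField_injective V h

variable {U : X.Opens} {d : Derivation K Γ(X, U) Γ(X, U)} {D : X.functionField → X.functionField}

/-- `D` is a derivation of the function field which extends the derivation `d` of `𝒪(U)`. -/
structure IsExtension (d : Derivation K Γ(X, U) Γ(X, U)) (D : X.functionField → X.functionField) :
    Prop where
  add : ∀ f g, D (f + g) = D f + D g
  mul : ∀ f g, D (f * g) = f * D g + g * D f
  germ : ∀ [Nonempty U] (a : Γ(X, U)),
    D (X.germToFunctionField U a) = X.germToFunctionField U (d a)

/-- The quotient rule: if `f a^k = c` with `c` regular on `U`, then `D f = a^{-k} (d c - f d(a^k))`,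
which is regular where `a` is invertible. -/
theorem IsExtension.exists_basicOpen (hD : IsExtension d D) (hU : IsAffineOpen U) (a : Γ(X, U)) [Nonempty (X.basicOpen a)] (f : Γ(X, X.basicOpen a)) :
    ∃ g : Γ(X, X.basicOpen a), X.germToFunctionField _ g = D (X.germToFunctionField _ f) := by
  have : Nonempty U := ⟨⟨_, X.basicOpen_le a (Classical.arbitrary (X.basicOpen a)).2⟩⟩
  have hloc := hU.isLocalization_basicOpen a
  obtain ⟨⟨c, _, k, rfl⟩, hc⟩ := IsLocalization.surj (Submonoid.powers a) f
  have hunit : IsUnit (res K (X.basicOpen_le a) (a ^ k)) := by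
    rw [map_pow]
    exact (RingedSpace.isUnit_res_basicOpen X.toRingedSpace a).pow k
  obtain ⟨v, hv⟩ := hunit
  have hc' : f * v.1 = res K (X.basicOpen_le a) c := by rw [hv]; exact hc
  refine ⟨(v⁻¹).1 * (res K (X.basicOpen_le a) (d c) - f * res K (X.basicOpen_le a) (d (a ^ k))), ?_⟩
  have h1 := congrArg (fun z => D (X.germToFunctionField _ z)) hc'
  beta_reduce at h1
  rw [map_mul, hD.mul, hv, germ_res, germ_res, hD.germ, hD.germ] at h1
  have h2 : X.germToFunctionField _ v.1 * X.germToFunctionField _ (v⁻¹).1 = 1 := by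
    rw [← map_mul, Units.mul_inv, map_one]
  rw [map_mul, map_sub, map_mul, germ_res, germ_res, ← h1,
    ← germ_res (K := K) (X.basicOpen_le a) (a ^ k), ← hv]
  linear_combination (D (X.germToFunctionField _ f)) * h2

/-- Non-empty basic open sets of `U` cover `V`. On each of them `D f` is regular, and these
functions agree on overlaps because they have the same image in the function field. -/
theorem IsExtension.exists_der (hD : IsExtension d D) (hU : IsAffineOpen U) {V : X.Opens} (hV : V ≤ U) (f : Γ(X, V)) :
    ∃ g : Γ(X, V), ∀ [Nonempty V], X.germToFunctionField _ g = D (X.germToFunctionField _ f) := by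
  let I := {a : Γ(X, U) // X.basicOpen a ≤ V ∧ Nonempty (X.basicOpen a)}
  have _ (i : I) : Nonempty (X.basicOpen i.1) := i.2.2
  choose g hg using fun i : I =>
    hD.exists_basicOpen hU i.1 (res K i.2.1 f)
  obtain ⟨s, hs, -⟩ := X.sheaf.existsUnique_gluing' (fun i : I => X.basicOpen i.1) V
    (fun i => homOfLE i.2.1) (fun p hp => by
      obtain ⟨a, ha, hpa⟩ := hU.exists_basicOpen_le ⟨p, hp⟩ (hV hp)
      exact TopologicalSpace.Opens.mem_iSup.2 ⟨⟨a, ha, ⟨⟨p, hpa⟩⟩⟩, hpa⟩) g (fun i j => by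
      refine eq_of_germ_eq ?_
      intro _
      change X.germToFunctionField _ (res K inf_le_left (g i)) =
        X.germToFunctionField _ (res K inf_le_right (g j))
      have hVn : Nonempty V := i.2.2.map fun p => ⟨p.1, i.2.1 p.2⟩
      rw [germ_res, germ_res, hg, hg, germ_res, germ_res])
  refine ⟨s, ?_⟩
  intro hVn
  obtain ⟨p, hp⟩ := id hVn
  obtain ⟨a, ha, hpa⟩ := hU.exists_basicOpen_le ⟨p, hp⟩ (hV hp)
  have h0 : Nonempty (X.basicOpen a) := ⟨⟨p, hpa⟩⟩
  have h1 := hg ⟨a, ha, h0⟩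
  rw [← hs ⟨a, ha, h0⟩, germ_res] at h1
  rw [← h1]
  exact (germ_res (K := K) ha s).symm

/-- A derivation of the ring of functions on an affine open set extends to a vector field. -/
theorem exists_vectorField (hU : IsAffineOpen U) (d : Derivation K Γ(X, U) Γ(X, U)) :
    ∃ η : VectorField K U, ∀ f : Γ(X, U), ⁅η, f⁆ = d f := by
  obtain ⟨D, hD⟩ : ∃ D, IsExtension d D := by
    rcases isEmpty_or_nonempty U with hE | hE
    · exact ⟨fun _ => 0, by simp, by simp, fun {_} => isEmptyElim (Classical.arbitrary U)⟩
    · have := functionField_isFractionRing_of_isAffineOpen X U hU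
      obtain ⟨D, h1, h2, h3⟩ := exists_extend_derivation (F := X.functionField) d
      exact ⟨D, h1, h2, h3⟩
  choose e he using fun (V : {V : X.Opens // V ≤ U}) => hD.exists_der hU V.2
  have hn (V : {V : X.Opens // V ≤ U}) (h : Nonempty V.1) : Nonempty U :=
    h.map fun p => ⟨p.1, V.2 p.2⟩
  have hmul (V : {V : X.Opens // V ≤ U}) (f g : Γ(X, V.1)) : e V (f * g) = f * e V g + g * e V f :=
    eq_of_germ_eq fun {_} => by
      rw [he, map_mul, hD.mul, map_add, map_mul, map_mul, he, he]
  have hK (V : {V : X.Opens // V ≤ U}) (c : K) : e V (algebraMap K Γ(X, V.1) c) = 0 :=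
    eq_of_germ_eq fun {hV} => by
      have := hn V hV
      rw [he, map_zero, ← (res K V.2).commutes, germ_res, hD.germ, d.map_algebraMap, map_zero]
  refine ⟨⟨fun V => Derivation.mk'
    { toFun := e V
      map_add' := fun f g => eq_of_germ_eq fun {_} => by
        rw [he, map_add, hD.add, map_add, he, he]
      map_smul' := fun c f => by
        rw [Algebra.smul_def, hmul, hK, mul_zero, add_zero, RingHom.id_apply, Algebra.smul_def] }
    (hmul V), fun V V' h f => eq_of_germ_eq fun {hV'} => ?_⟩, fun f => eq_of_germ_eq fun {_} => ?_⟩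
  · have hV : Nonempty V.1 := hV'.map fun p => ⟨p.1, h p.2⟩
    change X.germToFunctionField _ (res K h (e V f)) = X.germToFunctionField _ (e V' (res K h f))
    rw [germ_res, he, he, germ_res]
  · change X.germToFunctionField _ (e ⟨U, le_rfl⟩ f) = _
    rw [he, hD.germ]

variable (X) in
/-- The étale charts cover a smooth integral scheme. -/
theorem exists_etaleChart [CharZero K] (n : ℕ)
    [SmoothOfRelativeDimension n (X ↘ Spec (CommRingCat.of K))] (p : X) :
    ∃ C : EtaleChart K X n, p ∈ C.U := by
  obtain ⟨T, hT, V, hV, hp, e, hs⟩ :=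
    SmoothOfRelativeDimension.exists_isStandardSmoothOfRelativeDimension (n := n)
      (f := X ↘ Spec (CommRingCat.of K)) p
  -- `Spec K` is a single point, so the affine open set of the base is everything.
  have hT' : T = ⊤ := by
    have : Subsingleton (Spec (CommRingCat.of K)) :=
      inferInstanceAs (Subsingleton (PrimeSpectrum K))
    ext q
    rw [Subsingleton.elim q ((X ↘ Spec (CommRingCat.of K)) p)]
    exact ⟨fun _ => trivial, fun _ => e hp⟩
  subst hT'
  have hs' : Algebra.IsStandardSmoothOfRelativeDimension n K Γ(X, V) := by
    rw [← RingHom.isStandardSmoothOfRelativeDimension_algebraMap]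
    have := hs.comp (RingHom.IsStandardSmoothOfRelativeDimension.equiv
      (Scheme.ΓSpecIso (CommRingCat.of K)).symm.commRingCatIsoToRingEquiv)
    rwa [add_zero] at this
  have : Nonempty V := ⟨⟨p, hp⟩⟩
  obtain ⟨x, d, h1, h2, h3⟩ := exists_uniformizing (K := K) (A := Γ(X, V)) (n := n)
  choose η hη using fun i => exists_vectorField hV (d i)
  exact ⟨⟨V, hV, x, h1, h2, η, fun i j => (hη i (x j)).trans (h3 i j)⟩, hp⟩

end Geometry

/-! ### Sections of `𝒪 ⊗ W` glue. -/

section Gluing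

variable {K : Type u} [Field K] {X : Scheme.{u}} [X.Over (Spec (CommRingCat.of K))]
variable {W : Type u} [AddCommGroup W] [Module K W]

theorem resW_resW {V V' V'' : X.Opens} (h : V' ≤ V) (h' : V'' ≤ V') (z : Γ(X, V) ⊗[K] W) :
    resW h' (resW h z) = resW (h'.trans h) z := by
  induction z using TensorProduct.induction_on with
  | zero => simp
  | add x y hx hy => simp only [map_add, hx, hy]
  | tmul f w => exact congrArg (· ⊗ₜ w) (res_res K h h' f)

theorem resW_self {V : X.Opens} (z : Γ(X, V) ⊗[K] W) : resW le_rfl z = z := by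
  induction z using TensorProduct.induction_on with
  | zero => simp
  | add x y hx hy => simp only [map_add, hx, hy]
  | tmul f w => exact congrArg (· ⊗ₜ w) (res_self K f)

/-- The coefficients of a section of `𝒪 ⊗ W` with respect to a linear form on `W`. -/
def tensorCoord (l : W →ₗ[K] K) (V : X.Opens) : Γ(X, V) ⊗[K] W →ₗ[K] Γ(X, V) :=
  (TensorProduct.rid K Γ(X, V)).toLinearMap ∘ₗ l.lTensor Γ(X, V)

theorem tensorCoord_tmul (l : W →ₗ[K] K) (V : X.Opens) (f : Γ(X, V)) (w : W) :
    tensorCoord l V (f ⊗ₜ w) = l w • f := by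
  simp [tensorCoord]

theorem res_tensorCoord (l : W →ₗ[K] K) {V V' : X.Opens} (h : V' ≤ V) (z : Γ(X, V) ⊗[K] W) :
    res K h (tensorCoord l V z) = tensorCoord l V' (resW h z) := by
  induction z using TensorProduct.induction_on with
  | zero => simp
  | add x y hx hy => simp only [map_add, hx, hy]
  | tmul f w =>
    rw [tensorCoord_tmul, map_smul]
    exact (tensorCoord_tmul l V' (res K h f) w).symm

theorem sum_tensorCoord {m : ℕ} (b : Module.Basis (Fin m) K W) {V : X.Opens}
    (z : Γ(X, V) ⊗[K] W) : ∑ k, tensorCoord (b.coord k) V z ⊗ₜ[K] b k = z := by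
  induction z using TensorProduct.induction_on with
  | zero => simp
  | add x y hx hy =>
    simp only [map_add, TensorProduct.add_tmul, Finset.sum_add_distrib, hx, hy]
  | tmul f w =>
    simp only [tensorCoord_tmul, TensorProduct.smul_tmul, ← TensorProduct.tmul_sum,
      Module.Basis.coord_apply, b.sum_repr]

variable [Module.Finite K W]

theorem resW_ext {ι : Type*} {V : X.Opens} (U : ι → X.Opens) (hU : ∀ i, U i ≤ V)
    (hcov : V ≤ iSup U) {z z' : Γ(X, V) ⊗[K] W} (h : ∀ i, resW (hU i) z = resW (hU i) z') :
    z = z' := by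
  let b := Module.finBasis K W
  rw [← sum_tensorCoord b z, ← sum_tensorCoord b z']
  refine Finset.sum_congr rfl fun k _ => congrArg (· ⊗ₜ[K] b k) ?_
  refine X.sheaf.eq_of_locally_eq' U V (fun i => homOfLE (hU i)) hcov _ _ fun i => ?_
  change res K (hU i) _ = res K (hU i) _
  rw [res_tensorCoord, res_tensorCoord, h]

/-- A basis of the finite-dimensional space `W` reduces the claim to the sheaf property of `𝒪`,
coordinate by coordinate. -/
theorem exists_resW_eq {ι : Type*} {V : X.Opens} (U : ι → X.Opens) (hU : ∀ i, U i ≤ V)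
    (hcov : V ≤ iSup U) (z : ∀ i, Γ(X, U i) ⊗[K] W)
    (h : ∀ i j, resW (inf_le_left : U i ⊓ U j ≤ U i) (z i) = resW inf_le_right (z j)) :
    ∃ s : Γ(X, V) ⊗[K] W, ∀ i, resW (hU i) s = z i := by
  let b := Module.finBasis K W
  have h1 (k) := X.sheaf.existsUnique_gluing' U V (fun i => homOfLE (hU i)) hcov
    (fun i => tensorCoord (b.coord k) (U i) (z i)) (fun i j => by
      change res K inf_le_left _ = res K inf_le_right _
      rw [res_tensorCoord, res_tensorCoord, h])
  choose s hs _ using h1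
  refine ⟨∑ k, (s k : Γ(X, V)) ⊗ₜ[K] b k, fun i => ?_⟩
  rw [map_sum, ← sum_tensorCoord b (z i)]
  exact Finset.sum_congr rfl fun k _ => congrArg (· ⊗ₜ[K] b k) (hs k i)

end Gluing

/-! ### The bundle `𝒥^W` is a sheaf, trivialized on charts. -/

section JetSheaf

variable {K : Type u} [Field K] [CharZero K] {X : Scheme.{u}} [X.Over (Spec (CommRingCat.of K))]
  [IsIntegral X] {n : ℕ} {W : Type u} [AddCommGroup W] [Module K W] (P : PowAutRep K n W)

/-- The transition map from one chart to another. -/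
def glue (C₁ C₂ : EtaleChart K X n) {V : X.Opens} (h₁ : V ≤ C₁.U) (h₂ : V ≤ C₂.U) :
    Γ(X, V) ⊗[K] W →ₗ[Γ(X, V)] Γ(X, V) ⊗[K] W :=
  P.act Γ(X, V) (Coords.trans (C₁.coords h₁) (C₂.coords h₂))

theorem resW_glue (C₁ C₂ : EtaleChart K X n) {V V' : X.Opens} (h₁ : V ≤ C₁.U) (h₂ : V ≤ C₂.U)
    (h : V' ≤ V) (z : Γ(X, V) ⊗[K] W) :
    resW h (glue P C₁ C₂ h₁ h₂ z) = glue P C₁ C₂ (h.trans h₁) (h.trans h₂) (resW h z) :=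
  (P.act_baseChange (res K h) _ _ (fun i => by
    rw [Coords.trans_X, Coords.trans_X, (C₂.coords_compat h₂ h).map_incr,
      (C₁.coords_compat h₁ h).map_x]) z).symm

theorem glue_glue (C₁ C₂ C₃ : EtaleChart K X n) {V : X.Opens} (h₁ : V ≤ C₁.U) (h₂ : V ≤ C₂.U)
    (h₃ : V ≤ C₃.U) (z : Γ(X, V) ⊗[K] W) :
    glue P C₂ C₃ h₂ h₃ (glue P C₁ C₂ h₁ h₂ z) = glue P C₁ C₃ h₁ h₃ z := by
  rw [glue, glue, glue, ← Coords.trans_mul_trans (C₁.coords h₁) (C₂.coords h₂)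
    (C₃.coords h₃), map_mul]
  rfl

theorem glue_self (C : EtaleChart K X n) {V : X.Opens} (h : V ≤ C.U) (z : Γ(X, V) ⊗[K] W) :
    glue P C C h h z = z := by
  rw [glue, Coords.trans_self, map_one]
  rfl

variable {P}

namespace JetSections

/-- The expression of a section of `𝒥^W` in an étale chart over an open subset. -/
def expr {V : X.Opens} (s : JetSections P V) (C : EtaleChart K X n) (V' : X.Opens) (h : V' ≤ V)
    (hC : V' ≤ C.U) : Γ(X, V') ⊗[K] W := s.1 C ⟨_, h, hC⟩

/-- Construction of sections of `𝒥^W`. -/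
def ofExpr {V : X.Opens}
    (s : ∀ (C : EtaleChart K X n) (V' : X.Opens), V' ≤ V → V' ≤ C.U → Γ(X, V') ⊗[K] W)
    (hr : ∀ (C : EtaleChart K X n) (V' V'' : X.Opens) (h : V' ≤ V) (hC : V' ≤ C.U) (h' : V'' ≤ V'),
      resW h' (s C V' h hC) = s C V'' (h'.trans h) (h'.trans hC))
    (hg : ∀ (C₁ C₂ : EtaleChart K X n) (V' : X.Opens) (h : V' ≤ V) (h₁ : V' ≤ C₁.U)
      (h₂ : V' ≤ C₂.U), s C₂ V' h h₂ = glue P C₁ C₂ h₁ h₂ (s C₁ V' h h₁)) :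
    JetSections P V :=
  ⟨fun C V' => s C V'.1 V'.2.1 V'.2.2, fun C V' V'' h => hr C V'.1 V''.1 V'.2.1 V'.2.2 h,
    fun C₁ C₂ V' h h₁ h₂ φ hφ => by
      rw [(C₁.isTransition_iff C₂ h₁ h₂ φ).1 hφ]
      exact hg C₁ C₂ V' h h₁ h₂⟩

variable {V : X.Opens} (s : JetSections P V)

theorem resW_expr (C : EtaleChart K X n) (V' V'' : X.Opens) (h : V' ≤ V) (hC : V' ≤ C.U)
    (h' : V'' ≤ V') :
    resW h' (s.expr C V' h hC) = s.expr C V'' (h'.trans h) (h'.trans hC) :=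
  s.2.1 C ⟨V', h, hC⟩ ⟨V'', h'.trans h, h'.trans hC⟩ h'

theorem expr_eq_glue (C₁ C₂ : EtaleChart K X n) (V' : X.Opens) (h : V' ≤ V) (h₁ : V' ≤ C₁.U)
    (h₂ : V' ≤ C₂.U) : s.expr C₂ V' h h₂ = glue P C₁ C₂ h₁ h₂ (s.expr C₁ V' h h₁) :=
  s.2.2 C₁ C₂ V' h h₁ h₂ _ ((C₁.isTransition_iff C₂ h₁ h₂ _).2 rfl)

variable {s} in
theorem ext_expr {t : JetSections P V}
    (h : ∀ (C : EtaleChart K X n) (V' : X.Opens) (h : V' ≤ V) (h' : V' ≤ C.U),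
      s.expr C V' h h' = t.expr C V' h h') : s = t :=
  Subtype.ext (funext fun C => funext fun V' => h C V'.1 V'.2.1 V'.2.2)

theorem expr_smul (f : Γ(X, V)) (C : EtaleChart K X n) (V' : X.Opens) (h : V' ≤ V)
    (hC : V' ≤ C.U) : (f • s).expr C V' h hC = res K h f • s.expr C V' h hC := rfl

/-- The expression in one chart containing `V` determines all others by the transition maps.
Conversely, any expression may be spread to the other charts, consistently by the cocycle condition.
-/
theorem triv_bijective (C : EtaleChart K X n) {V : X.Opens} (h : V ≤ C.U) :
    Function.Bijective (triv (P := P) C h) := by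
  refine ⟨fun s t hst => ext_expr fun C' V' h₁ h₂ => ?_, fun z => ?_⟩
  · rw [s.expr_eq_glue C C' V' h₁ (h₁.trans h) h₂, t.expr_eq_glue C C' V' h₁ (h₁.trans h) h₂,
      ← s.resW_expr C V V' le_rfl h h₁, ← t.resW_expr C V V' le_rfl h h₁]
    exact congrArg (fun z => glue P C C' _ _ (resW h₁ z)) hst
  · refine ⟨ofExpr (fun C' V' h₁ h₂ => glue P C C' (h₁.trans h) h₂ (resW h₁ z))
      (fun C' V' V'' h₁ h₂ h' => ?_) (fun C₁ C₂ V' h' h₁ h₂ => ?_), ?_⟩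
    · rw [resW_glue, resW_resW]
    · rw [glue_glue]
    · exact (glue_self P C h _).trans (resW_self z)

variable [Module.Finite K W]

/-- In each chart separately the expressions glue as sections of `𝒪 ⊗ W`. Compatibility with
restrictions and transitions may be checked on the covering sets, where it holds for the given
sections. -/
theorem existsUnique_gluing {ι : Type*} (U : ι → X.Opens) (sf : ∀ i, JetSections P (U i))
    (h : ∀ i j (C : EtaleChart K X n) (V : X.Opens) (hi : V ≤ U i) (hj : V ≤ U j) (hC : V ≤ C.U),
      (sf i).expr C V hi hC = (sf j).expr C V hj hC) :
    ∃! s : JetSections P (iSup U), ∀ i, restrict P (le_iSup U i) s = sf i := by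
  have hcov {V : X.Opens} (hV : V ≤ iSup U) : V ≤ ⨆ i, U i ⊓ V := by
    rw [← iSup_inf_eq]; exact le_inf hV le_rfl
  choose s hs using fun (C : EtaleChart K X n) (V : X.Opens) (hV : V ≤ iSup U) (hC : V ≤ C.U) =>
    exists_resW_eq (fun i => U i ⊓ V) (fun i => inf_le_right) (hcov hV)
      (fun i => (sf i).expr C (U i ⊓ V) inf_le_left (inf_le_right.trans hC)) (fun i j => by
        rw [resW_expr, resW_expr]
        exact h i j C _ _ _ _)
  have hres (C : EtaleChart K X n) (V : X.Opens) (hV : V ≤ iSup U) (hC : V ≤ C.U) (i : ι)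
      (V' : X.Opens) (h' : V' ≤ V) (hi : V' ≤ U i) :
      resW h' (s C V hV hC) = (sf i).expr C V' hi (h'.trans hC) := by
    rw [← (sf i).resW_expr C (U i ⊓ V) V' inf_le_left (inf_le_right.trans hC) (le_inf hi h'),
      ← hs C V hV hC i, resW_resW]
  refine ⟨ofExpr s (fun C V V' hV hC h' => ?_) (fun C₁ C₂ V hV h₁ h₂ => ?_), fun i => ?_,
    fun t ht => ?_⟩
  · refine resW_ext _ (fun i => inf_le_right) (hcov (h'.trans hV)) fun i => ?_
    rw [resW_resW, hres C V hV hC i _ _ inf_le_left, hres C V' _ _ i _ _ inf_le_left]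
  · refine resW_ext _ (fun i => inf_le_right) (hcov hV) fun i => ?_
    rw [resW_glue, hres _ _ hV h₁ i _ _ inf_le_left, hres _ _ hV h₂ i _ _ inf_le_left,
      (sf i).expr_eq_glue C₁ C₂]
  · refine ext_expr fun C V hi hC => ?_
    exact (resW_self _).symm.trans (hres C V (hi.trans (le_iSup U i)) hC i V le_rfl hi)
  · refine ext_expr fun C V hV hC => resW_ext _ (fun i => inf_le_right) (hcov hV) fun i => ?_
    refine Eq.trans ?_ (hres C V hV hC i _ inf_le_right inf_le_left).symm
    rw [← ht i, resW_expr]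
    rfl

end JetSections

variable [Module.Finite K W]

variable (X P) in
theorem jetPresheaf_isSheaf : Presheaf.IsSheaf (Opens.grothendieckTopology X)
    (jetPresheaf (X := X) P).presheaf := by
  refine (TopCat.Presheaf.isSheaf_iff_isSheafUniqueGluing (jetAbPresheaf (X := X) P)).2
    fun ι U sf hsf => ?_
  refine JetSections.existsUnique_gluing U sf fun i j C V hi hj hC => ?_
  exact congrArg (fun s : JetSections P (U i ⊓ U j) => s.expr C V (le_inf hi hj) hC) (hsf i j)

end JetSheaf

/-! ### The universal property of the strong enveloping algebra. -/

section Enveloping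

variable {K : Type*} [CommRing K] {A : Type*} [CommRing A] [Algebra K A]
  {L : Type*} [AddCommGroup L] [Module A L] [Bracket L L] {anchor : L → A → A}
  {T : Type*} [Ring T] [Algebra K T] (a : A → T) (l : L → T)
  (h : ∀ x y, StrongRel K A L anchor x y →
    FreeAlgebra.lift K (Sum.elim a l) x = FreeAlgebra.lift K (Sum.elim a l) y)

/-- The homomorphism from the strong enveloping algebra given by operators which satisfy its
defining relations. -/
def StrongEnv.lift : StrongEnv K A L anchor →ₐ[K] T :=
  RingQuot.liftAlgHom K ⟨FreeAlgebra.lift K (Sum.elim a l), h⟩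

theorem StrongEnv.lift_ofFun (f : A) : lift a l h (ofFun K A L anchor f) = a f := by
  rw [lift, ofFun, RingQuot.liftAlgHom_mkAlgHom_apply, FreeAlgebra.lift_ι_apply, Sum.elim_inl]

theorem StrongEnv.lift_ofLie (ξ : L) : lift a l h (ofLie K A L anchor ξ) = l ξ := by
  rw [lift, ofLie, RingQuot.liftAlgHom_mkAlgHom_apply, FreeAlgebra.lift_ι_apply, Sum.elim_inr]

end Enveloping

/-! ### The action of completed jets in a chart. -/

section JetOperators

variable {K : Type u} [Field K] [CharZero K] {X : Scheme.{u}} [X.Over (Spec (CommRingCat.of K))]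
  {n : ℕ} {W : Type u} [AddCommGroup W] [Module K W] [Module.Finite K W]
  [LieRingModule (LPlus K n) W] [LieModule K (LPlus K n) W]

/-- The derivations of `𝒪(V)` given by vector fields on `U ⊇ V`. -/
def derData {U V : X.Opens} (h : V ≤ U) :
    DerData Γ(X, V) Γ(X, U) (VectorField K U) (res K h) where
  δ := { toFun η := η.der h, map_add' _ _ := rfl, map_smul' _ _ := rfl }
  δ_smul _ _ _ := rfl
  δ_map η a := (η.res_der le_rfl h a).symm
  δ_lie _ _ := rfl

variable {U V : X.Opens}

theorem Jets.eq_mk_of_le {ξ : JetField K U} {y : Γ(X, U) ⊗[K] VectorField K U} {m k : ℕ}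
    (hk : k ≤ m) (hy : Submodule.Quotient.mk y = ξ.1 m) : Submodule.Quotient.mk y = ξ.1 k := by
  induction hk using Nat.decreasingInduction with
  | self => exact hy
  | of_succ k _ ih =>
    rw [← ξ.2 k, ← ih]; rfl

variable (K) in
theorem Jets.exists_mk_eq (m : ℕ) (ξ : JetField K U) :
    ∃ y : Γ(X, U) ⊗[K] VectorField K U, Submodule.Quotient.mk y = ξ.1 m :=
  Submodule.Quotient.mk_surjective _ _

variable [IsIntegral X]

variable (W) in
/-- The action of jets of vector fields in an étale chart. -/
def jetEnd (C : EtaleChart K X n) (h : V ≤ U) (hC : V ≤ C.U) (ξ : JetField K U) :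
    Γ(X, V) ⊗[K] W →ₗ[K] Γ(X, V) ⊗[K] W :=
  (C.coords hC).jetAct W (derData h) (Jets.exists_mk_eq K (weightBound n K W + 1) ξ).choose

variable (C : EtaleChart K X n) (h : V ≤ U) (hC : V ≤ C.U)

/-- Two representatives of the same jet modulo `Δ^m`, with `m = weightBound + 1`, differ by an
element that acts by zero. So any convenient representative may be used. -/
theorem jetEnd_eq {ξ : JetField K U} {y : Γ(X, U) ⊗[K] VectorField K U}
    (hy : Submodule.Quotient.mk y = ξ.1 (weightBound n K W + 1)) (z : Γ(X, V) ⊗[K] W) :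
    jetEnd W C h hC ξ z = (C.coords hC).jetAct W (derData h) y z := by
  have h1 := (Jets.exists_mk_eq K (weightBound n K W + 1) ξ).choose_spec
  rw [← sub_eq_zero, jetEnd, ← LinearMap.sub_apply,
    ← map_sub ((C.coords hC).jetAct W (derData h))]
  exact Coords.jetAct_eq_zero _ _ ((Submodule.Quotient.eq _).1 (h1.trans hy.symm)) z

theorem jetEnd_add (ξ ζ : JetField K U) (z : Γ(X, V) ⊗[K] W) :
    jetEnd W C h hC (ξ + ζ) z = jetEnd W C h hC ξ z + jetEnd W C h hC ζ z := by
  obtain ⟨y, hy⟩ := Jets.exists_mk_eq K (weightBound n K W + 1) ξ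
  obtain ⟨y', hy'⟩ := Jets.exists_mk_eq K (weightBound n K W + 1) ζ
  rw [jetEnd_eq C h hC hy, jetEnd_eq C h hC hy', jetEnd_eq C h hC (ξ := ξ + ζ) (y := y + y'),
    map_add, LinearMap.add_apply]
  exact congrArg₂ (· + ·) hy hy'

theorem jetEnd_smul (f : Γ(X, U)) (ξ : JetField K U) (z : Γ(X, V) ⊗[K] W) :
    jetEnd W C h hC (f • ξ) z = res K h f • jetEnd W C h hC ξ z := by
  obtain ⟨y, hy⟩ := Jets.exists_mk_eq K (weightBound n K W + 1) ξ
  rw [jetEnd_eq C h hC hy, jetEnd_eq C h hC (ξ := f • ξ) (y := f • y), Coords.jetAct_smul]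
  exact congrArg (f • ·) hy

theorem jetEnd_lie (ξ ζ : JetField K U) (z : Γ(X, V) ⊗[K] W) : jetEnd W C h hC ⁅ξ, ζ⁆ z =
    jetEnd W C h hC ξ (jetEnd W C h hC ζ z) - jetEnd W C h hC ζ (jetEnd W C h hC ξ z) := by
  obtain ⟨y, hy⟩ := Jets.exists_mk_eq K (weightBound n K W + 1) ξ
  obtain ⟨y', hy'⟩ := Jets.exists_mk_eq K (weightBound n K W + 1) ζ
  rw [jetEnd_eq C h hC hy, jetEnd_eq C h hC hy', jetEnd_eq C h hC hy, jetEnd_eq C h hC hy',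
    jetEnd_eq C h hC (ξ := ⁅ξ, ζ⁆) (y := smashBracket _ _ _ y y'), Coords.jetAct_smashBracket]
  exact congrArg₂ (quotBracket _) hy hy'

theorem jetEnd_smul_right (ξ : JetField K U) (f : Γ(X, U)) (z : Γ(X, V) ⊗[K] W) :
    jetEnd W C h hC ξ (res K h f • z) =
      res K h ⁅Jets.anchor ξ, f⁆ • z + res K h f • jetEnd W C h hC ξ z := by
  obtain ⟨y, hy⟩ := Jets.exists_mk_eq K (weightBound n K W + 1) ξ
  have h1 : Jets.anchor ξ = smashAnchor y := by
    change Submodule.liftQ (jetFilt K Γ(X, U) (VectorField K U) 1) smashAnchor jetFilt_one_le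
      (ξ.1 1) = _
    -- The anchor reads the component at level `1`; the level `weightBound + 1` of the
    -- representative is at least that.
    rw [← Jets.eq_mk_of_le (Nat.le_add_left 1 _) hy]
    exact Submodule.liftQ_apply _ _ _
  rw [jetEnd_eq C h hC hy, jetEnd_eq C h hC hy, Coords.jetAct_smul_right, h1]

theorem resW_jetEnd {V' : X.Opens} (h' : V' ≤ V) (ξ : JetField K U) (z : Γ(X, V) ⊗[K] W) :
    resW h' (jetEnd W C h hC ξ z) =
      jetEnd W C (h'.trans h) (h'.trans hC) ξ (resW h' z) := by
  obtain ⟨y, hy⟩ := Jets.exists_mk_eq K (weightBound n K W + 1) ξ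
  rw [jetEnd_eq C h hC hy, jetEnd_eq C _ _ hy]
  induction y using TensorProduct.induction_on generalizing ξ with
  | zero => simp
  | add y y' ih ih' =>
    simp only [map_add, LinearMap.add_apply]
    rw [ih (Jets.of y) rfl, ih' (Jets.of y') rfl]
  | tmul g η =>
    rw [Coords.jetAct_tmul, Coords.jetAct_tmul, resW_smul, res_res]
    exact congrArg _ ((C.coords_compat hC h').rTensor_vecAct (η.res_der h h') z)

theorem jetEnd_map {U' : X.Opens} (hU : U' ≤ U) (h : V ≤ U') (ξ : JetField K U)
    (z : Γ(X, V) ⊗[K] W) : jetEnd W C h hC (Jets.map _ (VectorField.restrict K hU) ξ) z =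
      jetEnd W C (h.trans hU) hC ξ z := by
  obtain ⟨y, hy⟩ := Jets.exists_mk_eq K (weightBound n K W + 1) ξ
  rw [jetEnd_eq C (h.trans hU) hC hy, jetEnd_eq C h hC (y := smashMap _ (VectorField.restrict K hU) y)]
  · clear hy
    induction y using TensorProduct.induction_on with
    | zero => simp
    | add y y' ih ih' => simp only [map_add, LinearMap.add_apply, ih, ih']
    | tmul g η =>
      change res K h (res K hU g) • (C.coords hC).vecAct W (η.der (h.trans hU)) z =
        res K (h.trans hU) g • (C.coords hC).vecAct W (η.der (h.trans hU)) z
      rw [res_res]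
  · simp only [Jets.map]
    rw [← hy]
    rfl

/-- On `g # η` this is the independence of the action of `η` from the coordinates, together with
linearity of the gluing over functions. -/
theorem glue_jetEnd {P : PowAutRep K n W} (hP : P.Integrates) (C₁ C₂ : EtaleChart K X n)
    (h₁ : V ≤ C₁.U) (h₂ : V ≤ C₂.U) (ξ : JetField K U) (z : Γ(X, V) ⊗[K] W) :
    glue P C₁ C₂ h₁ h₂ (jetEnd W C₁ h h₁ ξ z) = jetEnd W C₂ h h₂ ξ (glue P C₁ C₂ h₁ h₂ z) := by
  obtain ⟨y, hy⟩ := Jets.exists_mk_eq K (weightBound n K W + 1) ξ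
  rw [jetEnd_eq C₁ h h₁ hy, jetEnd_eq C₂ h h₂ hy]
  clear hy
  induction y using TensorProduct.induction_on with
  | zero => simp
  | add y y' ih ih' => simp only [map_add, LinearMap.add_apply, ih, ih']
  | tmul g η =>
    rw [Coords.jetAct_tmul, Coords.jetAct_tmul, map_smul]
    exact congrArg _ (Coords.op_trans_vecAct hP _ _ _ z)

end JetOperators

/-! ### The structure of a sheaf of `AV`-modules. -/

section AVAction

variable {K : Type u} [Field K] [CharZero K] {X : Scheme.{u}} [X.Over (Spec (CommRingCat.of K))]
  [IsIntegral X] {n : ℕ} {W : Type u} [AddCommGroup W] [Module K W] [Module.Finite K W]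
  [LieRingModule (LPlus K n) W] [LieModule K (LPlus K n) W]
  {P : PowAutRep K n W} (hP : P.Integrates) {U : X.Opens}

instance JetSections.moduleBase : Module K (JetSections P U) :=
  Module.compHom _ (algebraMap K Γ(X, U))

theorem JetSections.ksmul_eq (c : K) (s : JetSections P U) :
    c • s = algebraMap K Γ(X, U) c • s := rfl

theorem JetSections.expr_ksmul (c : K) (s : JetSections P U) (C : EtaleChart K X n) (V' : X.Opens)
    (h : V' ≤ U) (hC : V' ≤ C.U) : (c • s).expr C V' h hC = c • s.expr C V' h hC := by
  rw [ksmul_eq, expr_smul, AlgHom.commutes, algebraMap_smul]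

/-- The action of a function on sections of `𝒥^W`. -/
def funEnd (f : Γ(X, U)) : Module.End K (JetSections P U) where
  toFun s := f • s
  map_add' := smul_add f
  map_smul' c s := by
    rw [JetSections.ksmul_eq, smul_smul, mul_comm, ← smul_smul]; rfl

/-- The action of a jet of vector fields on sections of `𝒥^W`. -/
def jetFieldEnd (ξ : JetField K U) : Module.End K (JetSections P U) where
  toFun s := JetSections.ofExpr (fun C _ h hC => jetEnd W C h hC ξ (s.expr C _ h hC))
    (fun C V' V'' h hC h' => by rw [resW_jetEnd, JetSections.resW_expr])
    (fun C₁ C₂ V' h h₁ h₂ => by rw [glue_jetEnd _ hP, ← JetSections.expr_eq_glue])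
  map_add' s t := JetSections.ext_expr fun C V' h hC =>
    map_add (jetEnd W C h hC ξ) (s.expr C V' h hC) (t.expr C V' h hC)
  map_smul' c s := JetSections.ext_expr fun C V' h hC => by
    rw [JetSections.expr_ksmul]
    exact (congrArg (jetEnd W C h hC ξ) (s.expr_ksmul c C V' h hC)).trans
      (map_smul (jetEnd W C h hC ξ) c _)

theorem expr_jetFieldEnd (ξ : JetField K U) (s : JetSections P U) (C : EtaleChart K X n)
    (V' : X.Opens) (h : V' ≤ U) (hC : V' ≤ C.U) :
    (jetFieldEnd hP ξ s).expr C V' h hC = jetEnd W C h hC ξ (s.expr C V' h hC) := rfl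

variable (U) in
/-- The action of `𝒜𝒱(U)` on the sections of `𝒥^W` over `U`. -/
def avHom : AVAlg K U →ₐ[K] Module.End K (JetSections P U) :=
  StrongEnv.lift funEnd (jetFieldEnd hP) fun x y hxy => by
    induction hxy with
    | algebraMap c =>
      rw [FreeAlgebra.lift_ι_apply, AlgHom.commutes]
      rfl
    | add_left f g =>
      simp only [map_add, FreeAlgebra.lift_ι_apply, Sum.elim_inl]
      exact LinearMap.ext fun s => add_smul f g s
    | mul_left f g =>
      simp only [map_mul, FreeAlgebra.lift_ι_apply, Sum.elim_inl]
      exact LinearMap.ext fun s => mul_smul f g s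
    | add_right ξ ζ =>
      simp only [map_add, FreeAlgebra.lift_ι_apply, Sum.elim_inr]
      exact LinearMap.ext fun s => JetSections.ext_expr fun C V' h hC => jetEnd_add C h hC ξ ζ _
    | smul_right f ξ =>
      simp only [map_mul, FreeAlgebra.lift_ι_apply, Sum.elim_inl, Sum.elim_inr]
      exact LinearMap.ext fun s => JetSections.ext_expr fun C V' h hC => jetEnd_smul C h hC f ξ _
    | lie ξ ζ =>
      simp only [map_sub, map_mul, FreeAlgebra.lift_ι_apply, Sum.elim_inr]
      exact LinearMap.ext fun s => JetSections.ext_expr fun C V' h hC => jetEnd_lie C h hC ξ ζ _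
    | anchor ξ f =>
      simp only [map_sub, map_mul, FreeAlgebra.lift_ι_apply, Sum.elim_inl, Sum.elim_inr]
      exact LinearMap.ext fun s => JetSections.ext_expr fun C V' h hC =>
        eq_sub_of_add_eq (jetEnd_smul_right C h hC ξ f _).symm

theorem avHom_ofFun (f : Γ(X, U)) (s : JetSections P U) :
    avHom hP U (StrongEnv.ofFun K _ _ _ f) s = f • s :=
  LinearMap.congr_fun (StrongEnv.lift_ofFun _ _ _ f) s

theorem avHom_ofLie (ξ : JetField K U) (s : JetSections P U) :
    avHom hP U (StrongEnv.ofLie K _ _ _ ξ) s = jetFieldEnd hP ξ s :=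
  LinearMap.congr_fun (StrongEnv.lift_ofLie _ _ _ ξ) s

/-- Linear endomorphisms as endomorphisms of the additive group. -/
def toAddEnd (M : Type*) [AddCommGroup M] [Module K M] : Module.End K M →+* AddMonoid.End M where
  toFun f := f.toAddMonoidHom
  map_one' := rfl
  map_mul' _ _ := rfl
  map_zero' := rfl
  map_add' _ _ := rfl

variable (X) in
/-- The structure of a sheaf of `AV`-modules on `𝒥^W`. -/
def jetStructure (hS : Presheaf.IsSheaf (Opens.grothendieckTopology X)
    (jetPresheaf (X := X) P).presheaf) : AVModuleStructure K (jetSheaf P hS) where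
  act U := (toAddEnd (JetSections P U.1)).comp (avHom hP U.1).toRingHom
  act_ofFun U f s := avHom_ofFun hP f s
  act_res {U V} h ξ s := by
    refine (congrArg (JetSections.restrict P h) (avHom_ofLie hP ξ s)).trans
      (Eq.trans ?_ (avHom_ofLie hP (Jets.map _ (VectorField.restrict K h) ξ)
        (JetSections.restrict P h s)).symm)
    refine JetSections.ext_expr fun C V' h' hC => ?_
    rw [expr_jetFieldEnd, jetEnd_map]
    rfl

end AVAction

/-! ### The explicit formula for the action of `f ∂/∂x_i`. -/

section Formula

open MvPowerSeries

variable {K : Type u} [Field K] {n : ℕ} {W : Type u} [AddCommGroup W] [Module K W]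
  [LieRingModule (LPlus K n) W] [LieModule K (LPlus K n) W] [CharZero K] [Module.Finite K W]
  {B : Type u} [CommRing B] [Algebra K B]

theorem finite_monomial_act (i : Fin n) :
    {s | ∃ w : W, ⁅LPlus.monomial K s i, w⁆ ≠ 0}.Finite := by
  refine Set.Finite.of_finite_image ((Finsupp.finite_of_degree_le (weightBound n K W)).subset ?_)
    (f := Subtype.val) Subtype.val_injective.injOn
  rintro _ ⟨s, ⟨w, hw⟩, rfl⟩
  by_contra hs
  apply hw
  rw [← actEnd_apply, ← actMon_of_ne K W s.2, actMon_eq_zero K W (not_le.1 hs),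
    LinearMap.zero_apply]

theorem rho_app_of_single {D : PowDer n B} {i : Fin n} {F : MvPowerSeries (Fin n) B}
    (hD : ∀ j, D (X j) = if i = j then F else 0) (g : B) (w : W) :
    (rho K W D).app (g ⊗ₜ w) = ∑ᶠ s : {s : Fin n →₀ ℕ // s ≠ 0},
      (g * coeff s.1 F) ⊗ₜ[K] ⁅LPlus.monomial K s i, w⁆ := by
  classical
  let φ (s : Fin n →₀ ℕ) : B ⊗[K] W := (g * coeff s F) ⊗ₜ[K] actMon K W s i w
  have hφ (s : {s : Fin n →₀ ℕ // s ≠ 0}) :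
      (g * coeff s.1 F) ⊗ₜ[K] ⁅LPlus.monomial K s i, w⁆ = φ s.1 := by
    simp only [φ]
    rw [actMon_of_ne K W s.2, actEnd_apply]
  simp only [hφ]
  -- The multi-indices of degree from `1` to the weight bound, grouped by degree as in `rho`; all
  -- others act by zero and do not contribute to the sum.
  let T := (Finset.range (weightBound n K W)).biUnion fun k => degSet n (k + 1)
  have hT (s : Fin n →₀ ℕ) : s ∈ T ↔ s ≠ 0 ∧ s.degree ≤ weightBound n K W := by
    simp only [T, Finset.mem_biUnion, Finset.mem_range, mem_degSet]
    rw [Ne, ← Finsupp.degree_eq_zero_iff]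
    exact ⟨fun ⟨k, hk, hs⟩ => by omega, fun h => ⟨s.degree - 1, by omega, by omega⟩⟩
  rw [finsum_eq_sum_of_support_subset (s := T.subtype (· ≠ 0)),
    Finset.sum_subtype_of_mem φ fun s hs => ((hT s).1 hs).1, Finset.sum_biUnion, rho_apply,
    Op.sum_app]
  · refine Finset.sum_congr rfl fun k _ => ?_
    rw [rhoCoeff_apply, Op.sum_app, Finset.sum_eq_single i]
    · rw [Op.sum_app]
      refine Finset.sum_congr rfl fun s _ => ?_
      rw [hD, if_pos rfl, Op.smul_app, Op.ofEnd_app, TensorProduct.smul_tmul', smul_eq_mul, mul_comm]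
    · intro j _ hj
      simp only [hD, if_neg hj.symm, map_zero, zero_smul, Finset.sum_const_zero, Op.zero_app]
    · simp
  · intro k _ l _ hkl
    rw [Function.onFun, Finset.disjoint_left]
    intro s hs hs'
    rw [mem_degSet] at hs hs'
    omega
  · intro s hs
    rw [Finset.mem_coe, Finset.mem_subtype, hT]
    refine ⟨s.2, not_lt.1 fun h => hs ?_⟩
    simp only [φ]
    rw [actMon_eq_zero K W h, LinearMap.zero_apply, TensorProduct.tmul_zero]

/-- The action of the vector field `f ∂/∂x_i`. -/
theorem Coords.vecAct_tmul (c : Coords K n B) {η : Derivation K B B} {f : B} {i : Fin n}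
    (hη : ∀ b, η b = f * c.d i b) (g : B) (w : W) :
    c.vecAct W η (g ⊗ₜ w) = (f * c.d i g) ⊗ₜ[K] w +
      ∑ᶠ s : {s : Fin n →₀ ℕ // s ≠ 0},
        (g * taylorCoeff c.d s.1 f) ⊗ₜ[K] ⁅LPlus.monomial K s i, w⁆ := by
  rw [vecAct_apply, derAct_tmul, hη, rho_app_of_single (i := i) (F := c.incr f)]
  · congr 2
    funext s
    rw [incr, map_sub, coeff_C, if_neg s.2, sub_zero]
    rfl
  · intro j
    rw [vert_X, hη, c.d_x]
    split_ifs
    · rw [mul_one]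
    · rw [mul_zero, incr, map_zero, map_zero, sub_zero]

end Formula

end AVSheaf

end

/-! ### The theorem. -/

theorem theorem17 {K : Type u} [Field K] [IsAlgClosed K] [CharZero K] (n : ℕ)
    (X : Scheme.{u}) [X.Over (Spec (CommRingCat.of K))] [IsIntegral X]
    [SmoothOfRelativeDimension n (X ↘ Spec (CommRingCat.of K))]
    (W : Type u) [AddCommGroup W] [Module K W] [Module.Finite K W]
    [LieRingModule (LPlus K n) W] [LieModule K (LPlus K n) W] (hW : IsRational K n W) :
    -- only finitely many of the `X^s ∂/∂X_i` act on `W` by non-zero operators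
    (∀ i : Fin n, {s | ∃ w : W, ⁅LPlus.monomial K s i, w⁆ ≠ 0}.Finite) ∧
    -- the action of `L̂₊` on `W` integrates to the group scheme `Aut K[[X₁, …, Xₙ]]`
    (∃ P : PowAutRep K n W, P.Integrates) ∧
    -- the étale charts cover `X`
    (∀ p : X, ∃ C : EtaleChart K X n, p ∈ C.U) ∧
    -- the automorphisms `φ_G` given by the changes of coordinates are well-defined
    (∀ (C₁ C₂ : EtaleChart K X n) (V : X.Opens) (h₁ : V ≤ C₁.U) (h₂ : V ≤ C₂.U),
      ∃! φ : PowAut n Γ(X, V), C₁.IsTransition C₂ h₁ h₂ φ) ∧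
    ∀ P : PowAutRep K n W, P.Integrates →
      ∃ hP : Presheaf.IsSheaf (Opens.grothendieckTopology X) (jetPresheaf (X := X) P).presheaf,
        -- `𝒥^W` is a vector bundle with fibre `W`, trivialized over the étale charts
        (∀ (C : EtaleChart K X n) (V : X.Opens) (h : V ≤ C.U),
          Function.Bijective (jetSheaf.triv hP C h)) ∧
        -- `𝒥^W` is a sheaf of `AV`-modules, with the given local action of vector fields
        ∃ S : AVModuleStructure K (jetSheaf P hP),
          ∀ (C : EtaleChart K X n) (i : Fin n) (f g : Γ(X, C.U)) (w : W)
            (σ : Γ(jetSheaf P hP, C.U)), jetSheaf.triv hP C le_rfl σ = g ⊗ₜ[K] w →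
            jetSheaf.triv hP C le_rfl (S.lieAct ⟨C.U, C.isAffineOpen⟩ (f • C.pd i) σ) =
              (f * ⁅C.pd i, g⁆) ⊗ₜ[K] w +
                ∑ᶠ s : {s : Fin n →₀ ℕ // s ≠ 0},
                  (g * taylorCoeff (C.der le_rfl) s.1 f) ⊗ₜ[K] ⁅LPlus.monomial K s i, w⁆ := by
  obtain ⟨τ, hτ⟩ := id hW
  refine ⟨finite_monomial_act, ⟨autRep hτ, autRep_integrates hτ⟩, exists_etaleChart X n,
    fun C₁ C₂ V h₁ h₂ => ⟨Coords.trans (C₁.coords h₁) (C₂.coords h₂),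
      (C₁.isTransition_iff C₂ h₁ h₂ _).2 rfl, fun φ => (C₁.isTransition_iff C₂ h₁ h₂ φ).1⟩,
    fun P hP => ⟨jetPresheaf_isSheaf X P, fun C V h => JetSections.triv_bijective C h,
      jetStructure X hP _, fun C i f g w σ hσ => ?_⟩⟩
  -- The jet `1 # f ∂/∂x_i` comes from `A # V`, so it is its own representative at every level and
  -- acts as the vector field.
  have h1 : jetEnd W C le_rfl le_rfl (Jets.of (1 ⊗ₜ (f • C.pd i))) (g ⊗ₜ w) =
      (C.coords le_rfl).vecAct W ((f • C.pd i).der le_rfl) (g ⊗ₜ w) := by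
    rw [jetEnd_eq C le_rfl le_rfl (y := 1 ⊗ₜ (f • C.pd i)) rfl, Coords.jetAct_tmul, map_one,
      one_smul]
    rfl
  have h2 := (C.coords le_rfl).vecAct_tmul (η := (f • C.pd i).der le_rfl) (f := f) (i := i)
    (fun b => by rw [VectorField.smul_der, res_self]; rfl) g w
  refine Eq.trans ?_ (h1.trans h2)
  refine (congrArg (JetSections.triv C le_rfl) (avHom_ofLie hP _ σ)).trans ?_
  exact congrArg (jetEnd W C le_rfl le_rfl (Jets.of (1 ⊗ₜ (f • C.pd i)))) hσ
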